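/- Let $\mathbb T^3=(\mathbb R/2\pi\mathbb Z)^3$ with Haar (Lebesgue) measure of total mass $(2\pi)^3$, let $|p|$ denote the Euclidean distance of $p\in\mathbb T^3$ to $0$, and put $\bar\pi=(\pi,\pi,\pi)$. Let $w_0\in\mathbb R$, let $w_1,v_0,v_1,v_2:\mathbb T^3\to\mathbb R$ be continuous, and let $w_2:(\mathbb T^3)^2\to\mathbb R$ be continuous and symmetric, with minimum $m$. On $\mathcal H=\mathbb C\oplus L_2(\mathbb T^3)\oplus L_2^{\rm s}((\mathbb T^3)^2)$ (complex functions; $L_2^{\rm s}$ denotes the symmetric ones) consider the bounded self-adjoint operator matrix $$H=\begin{pmatrix}H_{00}&H_{01}&0\\ H_{01}^*&H_{11}&H_{12}\\ 0&H_{12}^*&H_{22}\end{pmatrix},$$ where $H_{00}f_0=w_0f_0$, $H_{01}f_1=\int v_0(s)f_1(s)\,ds$, $(H_{11}f_1)(p)=w_1(p)f_1(p)$, $(H_{12}f_2)(p)=\int v_1(s)f_2(p,s)\,ds$ and $$(H_{22}f_2)(p,q)=w_2(p,q)f_2(p,q)-v_2(q)\int v_2(s)f_2(p,s)\,ds-v_2(p)\int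 v_2(s)f_2(s,q)\,ds .$$ For $p\in\mathbb T^3$ let $h_1(p)$ act on $\mathbb C\oplus L_2(\mathbb T^3)$ and $h_2(p)$ on $L_2(\mathbb T^3)$ by $$h_1(p)(f_0,f_1)=\Big(w_1(p)f_0+\tfrac1{\sqrt2}\int v_1(s)f_1(s)\,ds,\ \tfrac1{\sqrt2}v_1f_0+w_2(p,\cdot)f_1\Big),\qquad h_2(p)f=w_2(p,\cdot)f-v_2\int v_2(s)f(s)\,ds .$$ Put $\sigma_\alpha=\bigcup_{p}\sigma_{\rm disc}(h_\alpha(p))$ for $\alpha=1,2$, where $\sigma_{\rm disc}$ is the set of isolated points of the spectrum that are eigenvalues of finite multiplicity, and $$\Delta_1(p;z)=w_1(p)-z-\frac12\int\frac{v_1(s)^2\,ds}{w_2(p,s)-z},\qquad \Delta_2(p;z)=1-\int\frac{v_2(s)^2\,ds}{w_2(p,s)-z}.$$ Let $E^{(\alpha)}_{\min}$ and $E^{(\alpha)}_{\max}$ be the minimum and the maximum of $\sigma_\alpha\cap(-\infty,m]$. Assume: (A1) for $(\alpha,\beta)=(1,2)$ or for $(\alpha,\beta)=(2,1)$, $v_\alpha$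 is $2\bar\pi$-periodic and $\int v_\beta(s)g(s)\,ds=0$ for every $2\bar\pi$-periodic $g\in L_2(\mathbb T^3)$ (on $\mathbb T^3=\mathbb R^3/(2\pi\mathbb Z)^3$ every function is $2\bar\pi$-periodic, so this amounts to $v_\beta=0$); (A2) $w_2$ is $2\bar\pi$-periodic in each variable; $w_2$ has a unique minimum, attained at a point $(p_0,p_0)$, and it is non-degenerate (positive definite Hessian); $w_1$ and $w_2$ have continuous partial derivatives of third order. For $\alpha\in\{1,2\}$ consider the conditions: (A3)$_\alpha$ $\Delta_\alpha(\cdot\,;E^{(\alpha)}_{\min})$ has finitely many zeros $p_1,\dots,p_n$; there are $C,\delta>0$ and $\beta_i\in(0,2]$ with $|\Delta_\alpha(p;E^{(\alpha)}_{\min})|\ge C|p-p_i|^{\beta_i}$ whenever $|p-p_i|<\delta$, $i=1,\dots,n$; and $\Delta_\alpha(p;E^{(\alpha)}_{\min})>0$ for all other $p$; (A4)$_\alpha$ $\Delta_\alpha(\cdot\,;E^{(\alpha)}_{\max})$ has finitely many zeros $q_1,\dots,q_k$; there are $K,\rho>0$ and $\gamma_j\in(0,2]$ with $|\Delta_\alpha(p;E^{(\alpha)}_{\max})|\ge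 K|p-q_j|^{\gamma_j}$ whenever $|p-q_j|<\rho$, $j=1,\dots,k$; and $\Delta_\alpha(p;E^{(\alpha)}_{\max})<0$ for all other $p$. Assume that for $\alpha=1$ and also for $\alpha=2$ one of the following holds (not necessarily the same one for both): ($\alpha$.1) $\min_p\Delta_\alpha(p;m)>0$; ($\alpha$.2) $\min_p\Delta_\alpha(p;m)<0\le\max_p\Delta_\alpha(p;m)$, and (A3)$_\alpha$; ($\alpha$.3) $\max_p\Delta_\alpha(p;m)<0$, and (A3)$_\alpha$ and (A4)$_\alpha$. Then $H$ has only finitely many discrete eigenvalues in $(-\infty,m)$. -/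

import Mathlib

open MeasureTheory Module
open scoped ENNReal

noncomputable section

namespace ThreeParticle

/-! ### The torus -/

instance factTwoPiPos : Fact (0 < 2 * Real.pi) := ⟨Real.two_pi_pos⟩

/-- The torus `𝕋³ = (ℝ / 2πℤ)³`; its `volume` is the Haar measure of total mass `(2π)³`. -/
abbrev T3 : Type := Fin 3 → AddCircle (2 * Real.pi)

/-- The quotient map `ℝ³ → 𝕋³`. -/
def toT3 (x : Fin 3 → ℝ) : T3 := fun i => (x i : AddCircle (2 * Real.pi))

/-- The point `2π̄`, where `π̄ = (π, π, π)`. -/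
def twoPiBar : T3 := toT3 (fun _ => 2 * Real.pi)

/-- The Euclidean length `|p|` on the torus. The norm on the circle is the distance
to `0` modulo `2π`. -/
def tnorm (p : T3) : ℝ := Real.sqrt (∑ i, ‖p i‖ ^ 2)

/-! ### Hilbert spaces -/

/-- `L₂(X)`, complex valued. -/
abbrev L2 (X : Type) [MeasureSpace X] : Type := Lp ℂ 2 (volume : Measure X)

/-- A bounded operator `L₂(X) → L₂(Y)` given by a formula `T` on functions. -/
def opOfFormula {X Y : Type} [MeasureSpace X] [MeasureSpace Y] (T : (X → ℂ) → Y → ℂ)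
    (hcongr : ∀ f g : X → ℂ, f =ᵐ[volume] g → T f =ᵐ[volume] T g)
    (hmem : ∀ f, MemLp f 2 volume → MemLp (T f) 2 volume)
    (hadd : ∀ f g, MemLp f 2 volume → MemLp g 2 volume → T (f + g) =ᵐ[volume] T f + T g)
    (hsmul : ∀ (c : ℂ) (f), MemLp f 2 volume → T (c • f) =ᵐ[volume] c • T f)
    (C : ℝ)
    (hbound : ∀ f, MemLp f 2 volume →
      eLpNorm (T f) 2 volume ≤ ENNReal.ofReal C * eLpNorm f 2 volume) :
    L2 X →L[ℂ] L2 Y :=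
  LinearMap.mkContinuous
    { toFun := fun f => (hmem f (Lp.memLp f)).toLp (T f)
      map_add' := fun f g => by
        rw [← MemLp.toLp_add]
        exact MemLp.toLp_congr _ _
          ((hcongr _ _ (Lp.coeFn_add f g)).trans (hadd _ _ (Lp.memLp f) (Lp.memLp g)))
      map_smul' := fun c f => by
        rw [RingHom.id_apply, ← MemLp.toLp_const_smul]
        exact MemLp.toLp_congr _ _
          ((hcongr _ _ (Lp.coeFn_smul c f)).trans (hsmul c _ (Lp.memLp f))) }
    (max C 0) (fun f => by
      have h := hbound f (Lp.memLp f)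
      simp only [LinearMap.coe_mk, AddHom.coe_mk, Lp.norm_toLp]
      rw [Lp.norm_def, ← ENNReal.toReal_ofReal (le_max_right C 0), ← ENNReal.toReal_mul]
      refine ENNReal.toReal_mono (ENNReal.mul_ne_top ENNReal.ofReal_ne_top (Lp.eLpNorm_ne_top f))
        (h.trans ?_)
      gcongr
      exact le_max_left _ _)

lemma opOfFormula_coeFn {X Y : Type} [MeasureSpace X] [MeasureSpace Y] (T : (X → ℂ) → Y → ℂ)
    (h1 h2 h3 h4 C h5) (f : L2 X) :
    opOfFormula T h1 h2 h3 h4 C h5 f =ᵐ[volume] T f :=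
  MemLp.coeFn_toLp (h2 _ (Lp.memLp f))

/-- A real continuous function on a compact space is bounded, so multiplying by it keeps a
function in `L₂`. -/
lemma mul_bound {X : Type} [TopologicalSpace X] [CompactSpace X] (φ : C(X, ℝ)) (f : X → ℂ)
    (x : X) : ‖(φ x : ℂ) * f x‖ ≤ ‖φ‖ * ‖f x‖ := by
  rw [norm_mul, Complex.norm_real]
  gcongr
  exact φ.norm_coe_le_norm x

/-- Multiplication by a real continuous function `φ`: `(φ f)(x) = φ(x) f(x)`. -/
def mulOp {X : Type} [TopologicalSpace X] [CompactSpace X] [MeasureSpace X] [BorelSpace X]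
    (φ : C(X, ℝ)) : L2 X →L[ℂ] L2 X :=
  opOfFormula (fun f x => (φ x : ℂ) * f x)
    (fun f g h => by filter_upwards [h] with x hx; rw [hx])
    (fun f hf => hf.of_le_mul
      ((Complex.continuous_ofReal.comp φ.continuous).aestronglyMeasurable.mul hf.1)
      (Filter.Eventually.of_forall (mul_bound φ f)))
    (fun f g _ _ => Filter.Eventually.of_forall fun x => by simp [mul_add])
    (fun c f _ => Filter.Eventually.of_forall fun x => by simp [mul_left_comm])
    ‖φ‖
    (fun f _ => eLpNorm_le_mul_eLpNorm_of_ae_le_mul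
      (Filter.Eventually.of_forall (mul_bound φ f)) 2)

/-- `(Sf)(p, q) = f(q, p)`. -/
def swapOp : L2 (T3 × T3) →L[ℂ] L2 (T3 × T3) :=
  (Lp.compMeasurePreservingₗᵢ ℂ Prod.swap
    (Measure.measurePreserving_swap (μ := (volume : Measure T3))
      (ν := (volume : Measure T3)))).toContinuousLinearMap

lemma swapOp_coeFn (f : L2 (T3 × T3)) : swapOp f =ᵐ[volume] fun x => f x.swap :=
  Lp.coeFn_compMeasurePreserving f _

lemma partialInt_memLp_bound (v : C(T3, ℝ)) (f : T3 × T3 → ℂ) (hf : MemLp f 2 volume) :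
    eLpNorm (fun p => ∫ s, (v s : ℂ) * f (p, s)) 2 (volume : Measure T3) ≤
      ENNReal.ofReal (‖v‖ * (volume (Set.univ : Set T3) ^ (1 / 2 : ℝ)).toReal) *
        eLpNorm f 2 volume := by
  set M : ℝ≥0∞ := volume (Set.univ : Set T3) ^ (1 / 2 : ℝ) with hM
  have hMtop : M ≠ ∞ := ENNReal.rpow_ne_top_of_nonneg (by norm_num) (measure_ne_top _ _)
  set K : ℝ≥0∞ := ENNReal.ofReal ‖v‖ * M with hK
  have hKK : ENNReal.ofReal (‖v‖ * M.toReal) = K := by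
    rw [ENNReal.ofReal_mul (norm_nonneg v), ENNReal.ofReal_toReal hMtop]
  have hfm : AEStronglyMeasurable f ((volume : Measure T3).prod volume) := hf.1
  have hpt : ∀ᵐ p ∂(volume : Measure T3),
      ‖∫ s, (v s : ℂ) * f (p, s)‖ₑ ≤ K * eLpNorm (fun s => f (p, s)) 2 volume := by
    filter_upwards [hfm.prodMk_left] with p hp
    calc ‖∫ s, (v s : ℂ) * f (p, s)‖ₑ
        ≤ ∫⁻ s, ‖(v s : ℂ) * f (p, s)‖ₑ := enorm_integral_le_lintegral_enorm _
      _ = eLpNorm (fun s => (v s : ℂ) * f (p, s)) 1 volume := eLpNorm_one_eq_lintegral_enorm.symm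
      _ ≤ ENNReal.ofReal ‖v‖ * eLpNorm (fun s => f (p, s)) 1 volume :=
          eLpNorm_le_mul_eLpNorm_of_ae_le_mul
            (Filter.Eventually.of_forall (mul_bound v fun s => f (p, s))) 1
      _ ≤ ENNReal.ofReal ‖v‖ * (eLpNorm (fun s => f (p, s)) 2 volume * M) := by
          gcongr
          refine (eLpNorm_le_eLpNorm_mul_rpow_measure_univ (p := 1) (q := 2)
            (by norm_num) hp).trans_eq ?_
          rw [hM]
          norm_num
      _ = K * eLpNorm (fun s => f (p, s)) 2 volume := by rw [hK]; ring
  rw [hKK]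
  have h2 : ∀ {X : Type} [MeasureSpace X] (g : X → ℂ),
      eLpNorm g 2 volume = (∫⁻ x, ‖g x‖ₑ ^ (2 : ℝ)) ^ (1 / 2 : ℝ) := fun g => by
    rw [eLpNorm_eq_lintegral_rpow_enorm_toReal (by norm_num) (by norm_num)]
    norm_num
  have h3 : ∀ {X : Type} [MeasureSpace X] (g : X → ℂ),
      eLpNorm g 2 volume ^ (2 : ℝ) = ∫⁻ x, ‖g x‖ₑ ^ (2 : ℝ) := fun g => by
    rw [h2, ← ENNReal.rpow_mul]
    norm_num
  rw [← ENNReal.rpow_le_rpow_iff (z := 2) (by norm_num), h3,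
    ENNReal.mul_rpow_of_nonneg _ _ (by norm_num), h3]
  calc ∫⁻ p, ‖∫ s, (v s : ℂ) * f (p, s)‖ₑ ^ (2 : ℝ)
      ≤ ∫⁻ p, K ^ (2 : ℝ) * ∫⁻ s, ‖f (p, s)‖ₑ ^ (2 : ℝ) := by
        refine lintegral_mono_ae ?_
        filter_upwards [hpt] with p hp
        refine (ENNReal.rpow_le_rpow hp (by norm_num)).trans_eq ?_
        rw [ENNReal.mul_rpow_of_nonneg _ _ (by norm_num), h3]
    _ = K ^ (2 : ℝ) * ∫⁻ p, ∫⁻ s, ‖f (p, s)‖ₑ ^ (2 : ℝ) :=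
        lintegral_const_mul' _ _ (ENNReal.rpow_ne_top_of_nonneg (by norm_num)
          (ENNReal.mul_ne_top ENNReal.ofReal_ne_top hMtop))
    _ = K ^ (2 : ℝ) * ∫⁻ x : T3 × T3, ‖f x‖ₑ ^ (2 : ℝ) := by
        rw [Measure.volume_eq_prod, lintegral_prod _ (hfm.enorm.pow_const _)]

lemma mul_snd_aestronglyMeasurable (v : C(T3, ℝ)) {f : T3 × T3 → ℂ}
    (hf : AEStronglyMeasurable f volume) :
    AEStronglyMeasurable (fun x : T3 × T3 => (v x.2 : ℂ) * f x)
      ((volume : Measure T3).prod volume) :=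
  ((Complex.continuous_ofReal.comp
    (v.continuous.comp continuous_snd)).aestronglyMeasurable).mul hf

lemma mul_snd_integrable (v : C(T3, ℝ)) {f : T3 × T3 → ℂ} (hf : MemLp f 2 volume) :
    Integrable (fun x : T3 × T3 => (v x.2 : ℂ) * f x) ((volume : Measure T3).prod volume) := by
  have h : MemLp (fun x : T3 × T3 => (v x.2 : ℂ) * f x) 2 volume :=
    hf.of_le_mul (mul_snd_aestronglyMeasurable v hf.1)
      (Filter.Eventually.of_forall
        (mul_bound (v.comp ⟨Prod.snd, continuous_snd⟩ : C(T3 × T3, ℝ)) f))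
  exact h.integrable (by norm_num)

/-- The partial integral `f ↦ (p ↦ ∫ v(s) f(p, s) ds)`. -/
def partialIntOp (v : C(T3, ℝ)) : L2 (T3 × T3) →L[ℂ] L2 T3 :=
  opOfFormula (fun f p => ∫ s, (v s : ℂ) * f (p, s))
    (fun f g h => by
      filter_upwards [Measure.ae_ae_of_ae_prod h] with p hp
      refine integral_congr_ae ?_
      filter_upwards [hp] with s hs
      rw [hs])
    (fun f hf => ⟨(mul_snd_aestronglyMeasurable v hf.1).integral_prod_right',
      (partialInt_memLp_bound v f hf).trans_lt
        (ENNReal.mul_lt_top ENNReal.ofReal_lt_top hf.2)⟩)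
    (fun f g hf hg => by
      filter_upwards [(mul_snd_integrable v hf).prod_right_ae,
        (mul_snd_integrable v hg).prod_right_ae] with p hp hq
      simp only [Pi.add_apply, mul_add]
      exact integral_add hp hq)
    (fun c f _ => Filter.Eventually.of_forall fun p => by
      simp only [Pi.smul_apply, smul_eq_mul, mul_left_comm _ c]
      exact integral_const_mul c _)
    (‖v‖ * (volume (Set.univ : Set T3) ^ (1 / 2 : ℝ)).toReal)
    (partialInt_memLp_bound v)

lemma tensor_bound (v : C(T3, ℝ)) (g : T3 → ℂ) (hg : MemLp g 2 volume) :
    eLpNorm (fun x : T3 × T3 => (v x.2 : ℂ) * g x.1) 2 volume ≤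
      ENNReal.ofReal (‖v‖ * (volume (Set.univ : Set T3) ^ (1 / 2 : ℝ)).toReal) *
        eLpNorm g 2 volume := by
  have hMtop : volume (Set.univ : Set T3) ^ (1 / 2 : ℝ) ≠ ∞ :=
    ENNReal.rpow_ne_top_of_nonneg (by norm_num) (measure_ne_top _ _)
  have h1 : eLpNorm (fun x : T3 × T3 => (v x.2 : ℂ) * g x.1) 2 volume ≤
      ENNReal.ofReal ‖v‖ * eLpNorm (fun x : T3 × T3 => g x.1) 2 volume :=
    eLpNorm_le_mul_eLpNorm_of_ae_le_mul (Filter.Eventually.of_forall fun x => by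
      rw [norm_mul, Complex.norm_real]
      gcongr
      exact v.norm_coe_le_norm x.2) 2
  refine h1.trans_eq ?_
  have hmap : Measure.map Prod.fst (volume : Measure (T3 × T3)) =
      volume (Set.univ : Set T3) • (volume : Measure T3) := by
    rw [Measure.volume_eq_prod, Measure.map_fst_prod]
  have h2 : eLpNorm (fun x : T3 × T3 => g x.1) 2 volume =
      volume (Set.univ : Set T3) ^ (1 / 2 : ℝ) * eLpNorm g 2 volume := by
    have := eLpNorm_map_measure (p := 2) (μ := (volume : Measure (T3 × T3))) (f := Prod.fst)
      (g := g) (by rw [hmap]; exact hg.1.smul_measure _) measurable_fst.aemeasurable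
    rw [hmap, eLpNorm_smul_measure_of_ne_top (by norm_num)] at this
    rw [show (fun x : T3 × T3 => g x.1) = g ∘ Prod.fst from rfl, ← this]
    norm_num
  rw [h2, ENNReal.ofReal_mul (norm_nonneg v), ENNReal.ofReal_toReal hMtop, mul_assoc]

/-- The tensor product `g ↦ ((p, q) ↦ v(q) g(p))`. -/
def tensorOp (v : C(T3, ℝ)) : L2 T3 →L[ℂ] L2 (T3 × T3) :=
  opOfFormula (fun g x => (v x.2 : ℂ) * g x.1)
    (fun f g h => by
      filter_upwards [Measure.quasiMeasurePreserving_fst.ae_eq_comp h] with x hx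
      simp only [Function.comp_apply] at hx
      rw [hx])
    (fun g hg => ⟨mul_snd_aestronglyMeasurable v
        (hg.1.comp_quasiMeasurePreserving Measure.quasiMeasurePreserving_fst),
      (tensor_bound v g hg).trans_lt (ENNReal.mul_lt_top ENNReal.ofReal_lt_top hg.2)⟩)
    (fun f g _ _ => Filter.Eventually.of_forall fun x => by simp [mul_add])
    (fun c f _ => Filter.Eventually.of_forall fun x => by simp [mul_left_comm])
    (‖v‖ * (volume (Set.univ : Set T3) ^ (1 / 2 : ℝ)).toReal)
    (tensor_bound v)

/-- The real function `v` as an element of `L₂(𝕋³)`. -/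
def vec (v : C(T3, ℝ)) : L2 T3 :=
  (MemLp.of_bound (Complex.continuous_ofReal.comp v.continuous).aestronglyMeasurable ‖v‖
    (Filter.Eventually.of_forall fun x => by
      simpa using v.norm_coe_le_norm x) : MemLp (fun s => (v s : ℂ)) 2 volume).toLp _

lemma inner_vec (v : C(T3, ℝ)) (f : L2 T3) :
    inner ℂ (vec v) f = ∫ s, (v s : ℂ) * f s := by
  rw [L2.inner_def]
  refine integral_congr_ae ?_
  have h : (vec v : T3 → ℂ) =ᵐ[volume] fun s => (v s : ℂ) := MemLp.coeFn_toLp _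
  filter_upwards [h] with s hs
  rw [hs, RCLike.inner_apply, Complex.conj_ofReal, mul_comm]

/-- The functional `f ↦ ∫ v(s) f(s) ds`. -/
def intOp (v : C(T3, ℝ)) : L2 T3 →L[ℂ] ℂ :=
  LinearMap.mkContinuous
    { toFun := fun f => ∫ s, (v s : ℂ) * f s
      map_add' := fun f g => by simp only [← inner_vec, inner_add_right]
      map_smul' := fun c f => by simp only [← inner_vec, inner_smul_right]; rfl }
    ‖vec v‖ (fun f => by
      simp only [LinearMap.coe_mk, AddHom.coe_mk, ← inner_vec]
      exact norm_inner_le_norm _ _)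

/-- `L₂ˢ((𝕋³)²)`: the symmetric functions, `f(q, p) = f(p, q)`. -/
abbrev L2Sym : Submodule ℂ (L2 (T3 × T3)) :=
  (swapOp - ContinuousLinearMap.id ℂ (L2 (T3 × T3))).ker

lemma mem_L2Sym (f : L2 (T3 × T3)) : f ∈ L2Sym ↔ swapOp f = f := by
  simp [sub_eq_zero]

lemma swapOp_swapOp (f : L2 (T3 × T3)) : swapOp (swapOp f) = f := by
  apply Lp.ext
  have hq : Measure.QuasiMeasurePreserving (Prod.swap : T3 × T3 → T3 × T3) volume volume :=
    (Measure.measurePreserving_swap (μ := (volume : Measure T3))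
      (ν := (volume : Measure T3))).quasiMeasurePreserving
  filter_upwards [swapOp_coeFn (swapOp f), hq.ae_eq_comp (swapOp_coeFn f)] with x h1 h2
  rw [h1]
  simpa using h2

/-- The space `ℋ₀ ⊕ ℋ₁ = ℂ ⊕ L₂(𝕋³)`. -/
abbrev Cut2 : Type := WithLp 2 (ℂ × L2 T3)

/-- The three-particle cut subspace `ℋ = ℋ₀ ⊕ ℋ₁ ⊕ ℋ₂ = ℂ ⊕ L₂(𝕋³) ⊕ L₂ˢ((𝕋³)²)`. -/
abbrev Cut3 : Type := WithLp 2 (ℂ × WithLp 2 (L2 T3 × L2Sym))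

/-! ### The operators -/

/-- The parameters of the model. -/
structure Model where
  w0 : ℝ
  w1 : C(T3, ℝ)
  w2 : C(T3 × T3, ℝ)
  v0 : C(T3, ℝ)
  v1 : C(T3, ℝ)
  v2 : C(T3, ℝ)
  w2_symm : ∀ p q, w2 (p, q) = w2 (q, p)

/-- The potential `(V f)(p, q) = v(q) ∫ v(s) f(p, s) ds + v(p) ∫ v(s) f(s, q) ds`. -/
def potential (v : C(T3, ℝ)) : L2 (T3 × T3) →L[ℂ] L2 (T3 × T3) :=
  tensorOp v ∘L partialIntOp v + swapOp ∘L tensorOp v ∘L partialIntOp v ∘L swapOp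

lemma potential_coeFn (v : C(T3, ℝ)) (f : L2 (T3 × T3)) :
    potential v f =ᵐ[volume] fun x =>
      (v x.2 : ℂ) * (∫ s, (v s : ℂ) * f (x.1, s)) +
        (v x.1 : ℂ) * ∫ s, (v s : ℂ) * f (s, x.2) := by
  have hq : Measure.QuasiMeasurePreserving (Prod.swap : T3 × T3 → T3 × T3) volume volume :=
    (Measure.measurePreserving_swap (μ := (volume : Measure T3))
      (ν := (volume : Measure T3))).quasiMeasurePreserving
  have hI : ∀ g : L2 (T3 × T3), ∀ᵐ x : T3 × T3,
      tensorOp v (partialIntOp v g) x = (v x.2 : ℂ) * ∫ s, (v s : ℂ) * g (x.1, s) := fun g => by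
    have h1 : (partialIntOp v g : T3 → ℂ) =ᵐ[volume] fun p => ∫ s, (v s : ℂ) * g (p, s) :=
      opOfFormula_coeFn _ _ _ _ _ _ _ _
    have h2 : (tensorOp v (partialIntOp v g) : T3 × T3 → ℂ) =ᵐ[volume]
        fun x => (v x.2 : ℂ) * partialIntOp v g x.1 := opOfFormula_coeFn _ _ _ _ _ _ _ _
    have h3 := Measure.quasiMeasurePreserving_fst (μ := (volume : Measure T3))
      (ν := (volume : Measure T3)) |>.ae_eq_comp h1
    filter_upwards [h2, h3] with x hx hy
    simp only [Function.comp_apply] at hy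
    rw [hx, hy]
  have hs : ∀ᵐ q : T3, ∫ s, (v s : ℂ) * swapOp f (q, s) = ∫ s, (v s : ℂ) * f (s, q) := by
    filter_upwards [Measure.ae_ae_of_ae_prod (swapOp_coeFn f)] with q hqq
    refine integral_congr_ae ?_
    filter_upwards [hqq] with s hss
    rw [hss, Prod.swap_prod_mk]
  have hs' := Measure.quasiMeasurePreserving_snd (μ := (volume : Measure T3))
      (ν := (volume : Measure T3)) |>.ae hs
  filter_upwards [Lp.coeFn_add (tensorOp v (partialIntOp v f))
      (swapOp (tensorOp v (partialIntOp v (swapOp f)))), hI f,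
    swapOp_coeFn (tensorOp v (partialIntOp v (swapOp f))), hq.ae (hI (swapOp f)), hs']
    with x h1 h2 h3 h4 h5
  change (tensorOp v (partialIntOp v f) +
    swapOp (tensorOp v (partialIntOp v (swapOp f))) : L2 (T3 × T3)) x = _
  rw [h1, Pi.add_apply, h2, h3, h4, Prod.fst_swap, Prod.snd_swap, h5]

lemma potential_symm (v : C(T3, ℝ)) (f : L2 (T3 × T3)) (hf : f ∈ L2Sym) :
    potential v f ∈ L2Sym := by
  rw [mem_L2Sym] at hf ⊢
  change swapOp (tensorOp v (partialIntOp v f) +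
    swapOp (tensorOp v (partialIntOp v (swapOp f)))) =
      tensorOp v (partialIntOp v f) + swapOp (tensorOp v (partialIntOp v (swapOp f)))
  rw [map_add, swapOp_swapOp, hf]
  exact add_comm _ _

lemma mulOp_symm (w : C(T3 × T3, ℝ)) (hw : ∀ p q, w (p, q) = w (q, p)) (f : L2 (T3 × T3))
    (hf : f ∈ L2Sym) : mulOp w f ∈ L2Sym := by
  rw [mem_L2Sym] at hf ⊢
  apply Lp.ext
  have hq : Measure.QuasiMeasurePreserving (Prod.swap : T3 × T3 → T3 × T3) volume volume :=
    (Measure.measurePreserving_swap (μ := (volume : Measure T3))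
      (ν := (volume : Measure T3))).quasiMeasurePreserving
  have h : (mulOp w f : T3 × T3 → ℂ) =ᵐ[volume] fun x => (w x : ℂ) * f x :=
    opOfFormula_coeFn _ _ _ _ _ _ _ _
  filter_upwards [swapOp_coeFn (mulOp w f), hq.ae_eq_comp h, h, swapOp_coeFn f]
    with x h1 h2 h3 h4
  simp only [Function.comp_apply] at h2
  rw [h1, h2, h3, ← h4, hf]
  congr 2
  exact hw x.2 x.1

namespace Model

variable (P : Model)

/-- `H₀₁ f₁ = ∫ v₀(s) f₁(s) ds`. -/
def H01 : L2 T3 →L[ℂ] ℂ := intOp P.v0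

/-- `(H₁₁ f₁)(p) = w₁(p) f₁(p)`. -/
def H11 : L2 T3 →L[ℂ] L2 T3 := mulOp P.w1

/-- `(H₁₂ f₂)(p) = ∫ v₁(s) f₂(p, s) ds`. -/
def H12 : L2Sym →L[ℂ] L2 T3 := partialIntOp P.v1 ∘L L2Sym.subtypeL

/-- `(H₂₂ f₂)(p, q) = w₂(p, q) f₂(p, q) - (V f₂)(p, q)`. -/
def H22 : L2Sym →L[ℂ] L2Sym :=
  ((mulOp P.w2 - potential P.v2) ∘L L2Sym.subtypeL).codRestrict L2Sym fun f =>
    L2Sym.sub_mem (mulOp_symm P.w2 P.w2_symm f f.2) (potential_symm P.v2 f f.2)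

/-- The operator matrix
`(f₀, f₁, f₂) ↦ (w₀ f₀ + H₀₁ f₁, H₀₁* f₀ + H₁₁ f₁ + H₁₂ f₂, H₁₂* f₁ + H₂₂ f₂)`. -/
def H : Cut3 →L[ℂ] Cut3 :=
  let π0 : Cut3 →L[ℂ] ℂ := WithLp.fstL 2 ℂ ℂ (WithLp 2 (L2 T3 × L2Sym))
  let π12 : Cut3 →L[ℂ] WithLp 2 (L2 T3 × L2Sym) :=
    WithLp.sndL 2 ℂ ℂ (WithLp 2 (L2 T3 × L2Sym))
  let π1 : Cut3 →L[ℂ] L2 T3 := WithLp.fstL 2 ℂ (L2 T3) L2Sym ∘L π12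
  let π2 : Cut3 →L[ℂ] L2Sym := WithLp.sndL 2 ℂ (L2 T3) L2Sym ∘L π12
  let row0 : Cut3 →L[ℂ] ℂ := (P.w0 : ℂ) • π0 + P.H01 ∘L π1
  let row1 : Cut3 →L[ℂ] L2 T3 :=
    ContinuousLinearMap.adjoint P.H01 ∘L π0 + P.H11 ∘L π1 + P.H12 ∘L π2
  let row2 : Cut3 →L[ℂ] L2Sym := ContinuousLinearMap.adjoint P.H12 ∘L π1 + P.H22 ∘L π2
  (WithLp.prodContinuousLinearEquiv 2 ℂ ℂ (WithLp 2 (L2 T3 × L2Sym))).symm.toContinuousLinearMap ∘L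
    row0.prod
      ((WithLp.prodContinuousLinearEquiv 2 ℂ (L2 T3) L2Sym).symm.toContinuousLinearMap ∘L
        row1.prod row2)

/-- The function `q ↦ w₂(p, q)`. -/
def w2At (p : T3) : C(T3, ℝ) := P.w2.comp ⟨fun q => (p, q), by fun_prop⟩

/-- `h₀₁ f₁ = (1 / √2) ∫ v₁(s) f₁(s) ds`. -/
def h01 : L2 T3 →L[ℂ] ℂ := ((1 / Real.sqrt 2 : ℝ) : ℂ) • intOp P.v1

/-- The operator
`h₁(p) : (f₀, f₁) ↦ (w₁(p) f₀ + h₀₁ f₁, h₀₁* f₀ + w₂(p, ·) f₁)`. -/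
def h1 (p : T3) : Cut2 →L[ℂ] Cut2 :=
  let π0 : Cut2 →L[ℂ] ℂ := WithLp.fstL 2 ℂ ℂ (L2 T3)
  let π1 : Cut2 →L[ℂ] L2 T3 := WithLp.sndL 2 ℂ ℂ (L2 T3)
  (WithLp.prodContinuousLinearEquiv 2 ℂ ℂ (L2 T3)).symm.toContinuousLinearMap ∘L
    ((P.w1 p : ℂ) • π0 + P.h01 ∘L π1).prod
      (ContinuousLinearMap.adjoint P.h01 ∘L π0 + mulOp (P.w2At p) ∘L π1)

/-- The operator `(h₂(p) f)(q) = w₂(p, q) f(q) - v₂(q) ∫ v₂(s) f(s) ds`. -/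
def h2 (p : T3) : L2 T3 →L[ℂ] L2 T3 :=
  mulOp (P.w2At p) - (intOp P.v2).smulRight (vec P.v2)

end Model

/-! ### Discrete spectrum -/

/-- The (real) discrete spectrum of a bounded self-adjoint operator: the eigenvalues of finite
multiplicity that are isolated points of the spectrum. -/
def discSpec {E : Type} [NormedAddCommGroup E] [InnerProductSpace ℂ E] (A : E →L[ℂ] E) : Set ℝ :=
  {x | End.HasEigenvalue (A : E →ₗ[ℂ] E) (x : ℂ) ∧
    FiniteDimensional ℂ (End.eigenspace (A : E →ₗ[ℂ] E) (x : ℂ)) ∧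
    ∃ ε > 0, ∀ μ ∈ spectrum ℂ A, μ ≠ (x : ℂ) → ε ≤ ‖μ - (x : ℂ)‖}

namespace Model

variable (P : Model)

/-- `m = min w₂`, the bottom of the three-particle branch `[m, M]`. -/
def m : ℝ := ⨅ x, P.w2 x

/-- `Δ₁(p; z) = w₁(p) - z - (1/2) ∫ v₁(s)² / (w₂(p, s) - z) ds`. -/
def Δ₁ (p : T3) (z : ℝ) : ℝ := P.w1 p - z - 1 / 2 * ∫ s, P.v1 s ^ 2 / (P.w2 (p, s) - z)

/-- `Δ₂(p; z) = 1 - ∫ v₂(s)² / (w₂(p, s) - z) ds`. -/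
def Δ₂ (p : T3) (z : ℝ) : ℝ := 1 - ∫ s, P.v2 s ^ 2 / (P.w2 (p, s) - z)

/-- `σ₁ = ⋃ₚ σ_disc(h₁(p))`. -/
def σ₁ : Set ℝ := ⋃ p, discSpec (P.h1 p)

/-- `σ₂ = ⋃ₚ σ_disc(h₂(p))`. -/
def σ₂ : Set ℝ := ⋃ p, discSpec (P.h2 p)

/-! ### Assumptions -/

/-- `w₂` is `2π̄`-periodic in each variable. -/
def W2Periodic : Prop :=
  (∀ q, Function.Periodic (fun p => P.w2 (p, q)) twoPiBar) ∧
    ∀ p, Function.Periodic (fun q => P.w2 (p, q)) twoPiBar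

/-- `w₂` in the coordinates of `ℝ³ × ℝ³`. -/
def w2Lift (x : (Fin 3 → ℝ) × (Fin 3 → ℝ)) : ℝ := P.w2 (toT3 x.1, toT3 x.2)

/-- `w₂` has a unique minimum, at a point `(p₀, p₀)`; it is non-degenerate (the Hessian there is
positive definite); and `w₁`, `w₂` are three times continuously differentiable. -/
def MinimumAndSmoothness : Prop :=
  (∃ x₀ : Fin 3 → ℝ,
    (∀ y : T3 × T3, y ≠ (toT3 x₀, toT3 x₀) → P.w2 (toT3 x₀, toT3 x₀) < P.w2 y) ∧
    ∀ ξ : (Fin 3 → ℝ) × (Fin 3 → ℝ), ξ ≠ 0 →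
      0 < iteratedFDeriv ℝ 2 P.w2Lift (x₀, x₀) (fun _ => ξ)) ∧
  ContDiff ℝ 3 (fun x : Fin 3 → ℝ => P.w1 (toT3 x)) ∧ ContDiff ℝ 3 P.w2Lift

end Model

/-- `v` is `2π̄`-periodic, and `∫ v'(s) g(s) ds = 0` for every `2π̄`-periodic `g ∈ L₂(𝕋³)`. -/
def PeriodicAndOrthogonal (v v' : C(T3, ℝ)) : Prop :=
  Function.Periodic v twoPiBar ∧
    ∀ g : T3 → ℂ, MemLp g 2 volume → Function.Periodic g twoPiBar →
      ∫ s, (v' s : ℂ) * g s = 0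

/-- The function `D` has finitely many zeros `p₁, …, pₙ`, near each of which
`|D(p)| ≥ C |p - pᵢ| ^ βᵢ` with an exponent `βᵢ ∈ (0, 2]`. -/
def ZeroOrder (D : T3 → ℝ) : Prop :=
  ∃ (n : ℕ) (pt : Fin n → T3) (β : Fin n → ℝ) (C δ : ℝ),
    {p | D p = 0} = Set.range pt ∧ 0 < C ∧ 0 < δ ∧ (∀ i, β i ∈ Set.Ioc 0 2) ∧
      ∀ i p, tnorm (p - pt i) < δ → C * tnorm (p - pt i) ^ β i ≤ |D p|

/-- The zero-order condition at `E_min = min (σ ∩ (-∞, m])`: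
there `Δ(·; E_min)` satisfies `ZeroOrder` and is positive off its zeros. -/
def ZeroOrderAtMin (Δ : T3 → ℝ → ℝ) (σ : Set ℝ) (m : ℝ) : Prop :=
  ZeroOrder (fun p => Δ p (sInf (σ ∩ Set.Iic m))) ∧
    ∀ p, Δ p (sInf (σ ∩ Set.Iic m)) ≠ 0 → 0 < Δ p (sInf (σ ∩ Set.Iic m))

/-- The zero-order condition at `E_max = max (σ ∩ (-∞, m])`:
there `Δ(·; E_max)` satisfies `ZeroOrder` and is negative off its zeros. -/
def ZeroOrderAtMax (Δ : T3 → ℝ → ℝ) (σ : Set ℝ) (m : ℝ) : Prop :=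
  ZeroOrder (fun p => Δ p (sSup (σ ∩ Set.Iic m))) ∧
    ∀ p, Δ p (sSup (σ ∩ Set.Iic m)) ≠ 0 → Δ p (sSup (σ ∩ Set.Iic m)) < 0

/-- One of the three regimes: `min Δ(·; m) > 0`; or `min Δ(·; m) < 0 ≤ max Δ(·; m)` and the
zero-order condition at `E_min`; or `max Δ(·; m) < 0` and both zero-order conditions. -/
def Regime (Δ : T3 → ℝ → ℝ) (σ : Set ℝ) (m : ℝ) : Prop :=
  (∀ p, 0 < Δ p m) ∨
  ((∃ p, Δ p m < 0) ∧ (∃ p, 0 ≤ Δ p m) ∧ ZeroOrderAtMin Δ σ m) ∨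
  ((∀ p, Δ p m < 0) ∧ ZeroOrderAtMin Δ σ m ∧ ZeroOrderAtMax Δ σ m)

end ThreeParticle

end

namespace ThreeParticle

/-! On this torus $2\bar\pi=0$, so (A1) forces $v_1=0$ or $v_2=0$ (`PeriodicAndOrthogonal.eq_zero`).
If $v_2=0$, then $H$ is a block operator with corner $A$ on $\mathbb C\oplus L_2$, coupling $B$ and
corner $D=w_2$. If $v_1=0$, then $H$ splits into $A$ and $H_{22}=w_2-BB^*$ with $B$ built from
$\sqrt2\,v_2$. Setting $f=-B^*h$ turns $H_{22}h=zh$ into $f+B^*h=0$, $Bf+w_2h=zh$: again a block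
problem, in which the spectral parameter multiplies only the second row. A weight
$\varepsilon\in\{0,1\}$ on the first row covers both situations, with determinants $\Delta_2$ and
$\Delta_1$ respectively.

For $b<m$ the Schur complement $S(b)=A-\varepsilon b-B^*(w_2-b)^{-1}B$ acts on the $L_2(\mathbb
T^3)$ component as multiplication by $\Delta(p;b)$ minus half the integral operator with continuous
kernel $v(p)v(s)/(w_2(p,s)-b)$ (`schurL2_coeFn`). If $S(b)\ge0$ off finitely many dimensions, only
finitely many eigenvalues lie below $b$; if $S(b)\le0$ off finitely many dimensions, only finitely
many lie in $(b,m)$ (`card_le_of_schur_sign`).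

At $b=E_{\min}$ or $E_{\max}$ the determinant has one sign and zeros of order at most 2, so
$1/|\Delta|$ is integrable in dimension three and $\|f\|_1^2\le C\int|\Delta||f|^2$. The kernel is,
up to a small error in sup norm, of finite rank, and the error is absorbed by the multiplication
part (`exists_schurL2_sign`). If instead $\Delta(\cdot\,;m)>0$, the non-degenerate minimum of $w_2$
makes the kernels converge in Hilbert–Schmidt norm as $b\uparrow m$, so one finite codimension
serves every $b$ near $m$ (`exists_schurL2_nonneg`).

What remains are the energies strictly between $E_{\min}$ and $E_{\max}$ (or $m$). There
$\Delta(\cdot\,;z)$ always has a zero, because it is decreasing in $z$ and the torus is connected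
(`Regime.cases`). A zero at $p$ gives approximate eigenvectors concentrated near $p$, so $z$ belongs
to the spectrum of $H$ (`mem_spectrum_of_Δ₁`, `mem_spectrum_of_Δ₂`). This interval therefore
contains no isolated spectral point. -/

/-! ### Integrability on the torus of functions with singularities of order two. -/

lemma integrableOn_abs_rpow {r : ℝ} (hr : -1 < r) (a : ℝ) (ha : 0 ≤ a) :
    IntegrableOn (fun x : ℝ => |x| ^ r) (Set.Ioc (-a) a) := by
  have h0 : IntervalIntegrable (fun x : ℝ => |x| ^ r) volume 0 a := by
    refine (intervalIntegral.intervalIntegrable_rpow' (a := 0) (b := a) hr).congr ?_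
    intro x hx
    rw [Set.uIoc_of_le ha] at hx
    simp only [abs_of_pos hx.1]
  have h1 := h0.comp_sub_left 0
  simp only [zero_sub, abs_neg, sub_zero] at h1
  exact (intervalIntegrable_iff_integrableOn_Ioc_of_le (by linarith)).1 (h1.symm.trans h0)

lemma integrable_norm_rpow {r : ℝ} (hr : -1 < r) :
    Integrable (fun x : AddCircle (2 * Real.pi) => ‖x‖ ^ r) := by
  have hm := AddCircle.measurePreserving_mk (2 * Real.pi) (-Real.pi)
  rw [← hm.integrable_comp (by
    exact (measurable_norm.pow_const r).aestronglyMeasurable)]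
  rw [show -Real.pi + 2 * Real.pi = Real.pi by ring]
  refine (integrableOn_abs_rpow hr Real.pi Real.pi_pos.le).congr_fun (fun x hx => ?_)
    measurableSet_Ioc
  simp only [Function.comp_apply]
  rw [(AddCircle.norm_coe_eq_abs_iff (2 * Real.pi) (by positivity)).2]
  rw [abs_of_pos Real.two_pi_pos, abs_le]
  constructor <;> linarith [hx.1, hx.2]

lemma tnorm_sq (p : T3) : tnorm p ^ 2 = ∑ i, ‖p i‖ ^ 2 :=
  Real.sq_sqrt (by positivity)

lemma tnorm_nonneg (p : T3) : 0 ≤ tnorm p := Real.sqrt_nonneg _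

lemma continuous_tnorm : Continuous tnorm := by
  unfold tnorm
  fun_prop

lemma tnorm_eq_zero {p : T3} : tnorm p = 0 ↔ p = 0 := by
  rw [← sq_eq_zero_iff, tnorm_sq, Finset.sum_eq_zero_iff_of_nonneg (fun i _ => by positivity)]
  simp [funext_iff]

lemma tnorm_pos {p : T3} (hp : p ≠ 0) : 0 < tnorm p :=
  (tnorm_nonneg p).lt_of_ne fun h => hp (tnorm_eq_zero.1 h.symm)

instance nullSingletonClass_circle :
    NullSingletonClass (volume : Measure (AddCircle (2 * Real.pi))) where
  measure_singleton x := by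
    have h := AddCircle.volume_closedBall (2 * Real.pi) (x := x) 0
    rw [Metric.closedBall_zero] at h
    simp [h, Real.pi_pos.le]

/-- By the inequality of arithmetic and geometric means, $|p|^2\ge\prod_i|p_i|^{2/3}$. This reduces
the claim to three one-dimensional integrals with exponent $-2/3>-1$, without polar coordinates. -/
lemma integrable_inv_tnorm_sq : Integrable (fun p : T3 => (tnorm p ^ 2)⁻¹) := by
  have h : Integrable (fun p : T3 => ∏ i, ‖p i‖ ^ (-(2 / 3) : ℝ)) :=
    Integrable.fintype_prod (f := fun _ x => ‖x‖ ^ (-(2 / 3) : ℝ))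
      fun _ => integrable_norm_rpow (by norm_num)
  refine h.mono' ((continuous_tnorm.pow 2).measurable.inv.aestronglyMeasurable) ?_
  -- The coordinate hyperplanes must be removed: there the majorant takes the default value
  -- $0^{-2/3}=0$ and the bound fails.
  have hae : ∀ᵐ p : T3, ∀ i, p i ≠ 0 := ae_all_iff.2 fun i => by
    exact Measure.ae_eval_ne
      (μ := fun _ : Fin 3 => (volume : Measure (AddCircle (2 * Real.pi)))) i 0
  filter_upwards [hae] with p hp
  have hpos : ∀ i, 0 < ‖p i‖ := fun i => norm_pos_iff.2 (hp i)
  have h23 : ∀ i, ‖p i‖ ^ (-(2 / 3) : ℝ) = ((‖p i‖ ^ 2) ^ (1 / 3 : ℝ))⁻¹ := fun i => by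
    rw [Real.rpow_neg (norm_nonneg _), ← Real.rpow_natCast, ← Real.rpow_mul (norm_nonneg _)]
    norm_num
  rw [Real.norm_of_nonneg (by positivity), tnorm_sq]
  simp only [h23, Finset.prod_inv_distrib]
  refine inv_anti₀ (Finset.prod_pos fun i _ => by have := hpos i; positivity) ?_
  have := Real.geom_mean_le_arith_mean3_weighted (w₁ := 1 / 3) (w₂ := 1 / 3) (w₃ := 1 / 3)
    (by norm_num) (by norm_num) (by norm_num) (sq_nonneg ‖p 0‖) (sq_nonneg ‖p 1‖)
    (sq_nonneg ‖p 2‖) (by norm_num)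
  simp only [Fin.prod_univ_three, Fin.sum_univ_three]
  nlinarith [sq_nonneg ‖p 0‖, sq_nonneg ‖p 1‖, sq_nonneg ‖p 2‖]

lemma integrable_inv_tnorm_sub_sq (a : T3) : Integrable (fun p : T3 => (tnorm (p - a) ^ 2)⁻¹) :=
  integrable_inv_tnorm_sq.comp_sub_right a

/-- Near each zero $|D|^{-1}\le C^{-1}|p-p_i|^{-2}$, which is integrable in dimension three; away
from the zeros compactness bounds $|D|$ from below. -/
lemma ZeroOrder.integrable_inv {D : T3 → ℝ} (hD : ZeroOrder D) (hc : Continuous D) :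
    Integrable (fun p => |D p|⁻¹) ∧ ∀ᵐ p, D p ≠ 0 := by
  obtain ⟨n, pt, β, C, δ, hz, hC, hδ, hβ, hb⟩ := hD
  -- The radius is capped at 1 so that $t^2\le t^{\beta_i}$ for $\beta_i\le2$.
  set δ' := min δ 1 with hδ'
  have hδpos : 0 < δ' := lt_min hδ one_pos
  set K : Set T3 := {p | ∀ i, δ' ≤ tnorm (p - pt i)} with hK
  have hKc : IsCompact K := by
    refine IsClosed.isCompact ?_
    simp only [hK, Set.ofPred_forall]
    exact isClosed_iInter fun i =>
      isClosed_le continuous_const (continuous_tnorm.comp (continuous_id.sub continuous_const))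
  have hKne : ∀ p ∈ K, D p ≠ 0 := by
    intro p hp h0
    have : p ∈ Set.range pt := hz ▸ h0
    obtain ⟨i, rfl⟩ := this
    have := hp i
    rw [sub_self, tnorm_eq_zero.2 rfl] at this
    linarith
  obtain ⟨c, hc0, hcK⟩ : ∃ c > 0, ∀ p ∈ K, c ≤ |D p| := by
    rcases K.eq_empty_or_nonempty with h | h
    · exact ⟨1, one_pos, by simp [h]⟩
    · obtain ⟨q, hq, hmin⟩ := hKc.exists_isMinOn h hc.abs.continuousOn
      exact ⟨|D q|, abs_pos.2 (hKne q hq), fun p hp => hmin hp⟩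
  constructor
  · have hint : Integrable (fun p : T3 => c⁻¹ + ∑ i, C⁻¹ * (tnorm (p - pt i) ^ 2)⁻¹) :=
      (integrable_const _).add
        (integrable_finsetSum _ fun i _ => (integrable_inv_tnorm_sub_sq (pt i)).const_mul _)
    refine hint.mono' (hc.abs.measurable.inv.aestronglyMeasurable)
      (Filter.Eventually.of_forall fun p => ?_)
    rw [Real.norm_of_nonneg (by positivity)]
    have hs : 0 ≤ ∑ i, C⁻¹ * (tnorm (p - pt i) ^ 2)⁻¹ := Finset.sum_nonneg fun i _ => by positivity
    by_cases hp : p ∈ K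
    · have := inv_anti₀ hc0 (hcK p hp)
      linarith
    · simp only [hK, Set.mem_ofPred_eq, not_forall, not_le] at hp
      obtain ⟨i, hi⟩ := hp
      have hsi : C⁻¹ * (tnorm (p - pt i) ^ 2)⁻¹ ≤ ∑ i, C⁻¹ * (tnorm (p - pt i) ^ 2)⁻¹ :=
        Finset.single_le_sum (f := fun i => C⁻¹ * (tnorm (p - pt i) ^ 2)⁻¹)
          (fun j _ => by positivity) (Finset.mem_univ i)
      have hcinv : 0 ≤ c⁻¹ := by positivity
      -- At the zero itself `|D p|⁻¹` is $0$ by convention, so the bound is trivial.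
      by_cases h0 : p = pt i
      · have : D p = 0 := by
          have : p ∈ {p | D p = 0} := hz ▸ ⟨i, h0.symm⟩
          exact this
        rw [this]
        simp only [abs_zero, inv_zero]
        linarith
      · have ht : 0 < tnorm (p - pt i) := tnorm_pos (sub_ne_zero.2 h0)
        have h1 := hb i p (hi.trans_le (min_le_left _ _))
        have h2 : tnorm (p - pt i) ^ (2 : ℝ) ≤ tnorm (p - pt i) ^ β i :=
          Real.rpow_le_rpow_of_exponent_ge ht (hi.le.trans (min_le_right _ _)) (hβ i).2
        rw [Real.rpow_two] at h2
        have h3 : C * tnorm (p - pt i) ^ 2 ≤ |D p| :=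
          (mul_le_mul_of_nonneg_left h2 hC.le).trans h1
        have := inv_anti₀ (by positivity) h3
        rw [mul_inv] at this
        linarith
  · have : {p | D p = 0}.Finite := hz ▸ Set.finite_range pt
    have h0 := this.measure_zero (volume : Measure T3)
    rw [← compl_mem_ae_iff] at h0
    exact h0

/-! ### Quadratic growth of $w_2$ at its minimum. -/

/-- Let $l$ be the least value of the Hessian on the unit sphere. Near $x_0$ the linearization error
of the gradient costs at most $l/2$, so along a ray the derivative of $f$ is at least $\frac
l2t\|\xi\|^2$; integrating gives the constant $l/4$. -/
lemma exists_quadratic_lower_bound {E : Type*} [NormedAddCommGroup E] [NormedSpace ℝ E]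
    [FiniteDimensional ℝ E] {f : E → ℝ} (hf : ContDiff ℝ 2 f) {x₀ : E}
    (hmin : ∀ x, f x₀ ≤ f x) (hpos : ∀ ξ, ξ ≠ 0 → 0 < fderiv ℝ (fderiv ℝ f) x₀ ξ ξ) :
    ∃ c > 0, ∃ r > 0, ∀ ξ, ‖ξ‖ < r → f x₀ + c * ‖ξ‖ ^ 2 ≤ f (x₀ + ξ) := by
  set L := fderiv ℝ (fderiv ℝ f) x₀ with hL
  obtain ⟨l, hl0, hl⟩ : ∃ l > 0, ∀ ξ, l * ‖ξ‖ ^ 2 ≤ L ξ ξ := by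
    -- The sphere is empty only when $E$ is trivial.
    rcases (Metric.sphere (0 : E) 1).eq_empty_or_nonempty with h | h
    · refine ⟨1, one_pos, fun ξ => ?_⟩
      have : ξ = 0 := by
        by_contra hξ
        have : (‖ξ‖⁻¹ • ξ) ∈ Metric.sphere (0 : E) 1 := by
          simp [norm_smul, norm_ne_zero_iff.2 hξ]
        simp [h] at this
      simp [this]
    · obtain ⟨e, he, hemin⟩ := (isCompact_sphere (0 : E) 1).exists_isMinOn h
        (f := fun ξ => L ξ ξ) (by fun_prop)
      have he0 : e ≠ 0 := by
        rintro rfl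
        simp at he
      refine ⟨L e e, hpos e he0, fun ξ => ?_⟩
      by_cases hξ : ξ = 0
      · simp [hξ]
      · have hmem : (‖ξ‖⁻¹ • ξ) ∈ Metric.sphere (0 : E) 1 := by
          simp [norm_smul, norm_ne_zero_iff.2 hξ]
        have h1 := hemin hmem
        simp only [Set.mem_ofPred_eq, map_smul, FunLike.coe_smul, Pi.smul_apply, smul_eq_mul] at h1
        have h2 : 0 < ‖ξ‖ := norm_pos_iff.2 hξ
        calc L e e * ‖ξ‖ ^ 2 ≤ (‖ξ‖⁻¹ * (‖ξ‖⁻¹ * L ξ ξ)) * ‖ξ‖ ^ 2 := by gcongr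
          _ = L ξ ξ := by field_simp
  have hdf : Differentiable ℝ f := hf.differentiable (by norm_num)
  have hd : HasFDerivAt (fderiv ℝ f) L x₀ :=
    ((hf.fderiv_right (m := 1) (by norm_num)).differentiable (by norm_num) x₀).hasFDerivAt
  have h0 : fderiv ℝ f x₀ = 0 :=
    IsLocalMin.fderiv_eq_zero (Filter.Eventually.of_forall hmin)
  have hev := hd.isLittleO.def (half_pos hl0)
  obtain ⟨r, hr, hball⟩ := Metric.eventually_nhds_iff.1 hev
  refine ⟨l / 4, by positivity, r, hr, fun ξ hξ => ?_⟩
  have hder : ∀ t : ℝ, HasDerivAt (fun t : ℝ => f (x₀ + t • ξ) - t ^ 2 * (l / 4 * ‖ξ‖ ^ 2))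
      (fderiv ℝ f (x₀ + t • ξ) ξ - 2 * t * (l / 4 * ‖ξ‖ ^ 2)) t := by
    intro t
    have h1 : HasDerivAt (fun t : ℝ => x₀ + t • ξ) ξ t := by
      simpa using ((hasDerivAt_id t).smul_const ξ).const_add x₀
    have h2 := (hdf (x₀ + t • ξ)).hasFDerivAt.comp_hasDerivAt t h1
    have h3 := ((hasDerivAt_pow 2 t).mul_const (l / 4 * ‖ξ‖ ^ 2))
    convert! h2.sub h3 using 1
    simp
  have hmono : MonotoneOn (fun t : ℝ => f (x₀ + t • ξ) - t ^ 2 * (l / 4 * ‖ξ‖ ^ 2))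
      (Set.Icc 0 1) := by
    refine monotoneOn_of_deriv_nonneg (convex_Icc 0 1)
      (fun t _ => (hder t).continuousAt.continuousWithinAt)
      (fun t _ => (hder t).differentiableAt.differentiableWithinAt) fun t ht => ?_
    rw [interior_Icc] at ht
    rw [(hder t).deriv]
    have hdist : dist (x₀ + t • ξ) x₀ < r := by
      rw [dist_eq_norm, add_sub_cancel_left, norm_smul, Real.norm_of_nonneg ht.1.le]
      nlinarith [norm_nonneg ξ, ht.2]
    have h1 := hball hdist
    rw [h0, sub_zero, add_sub_cancel_left, norm_smul, Real.norm_of_nonneg ht.1.le] at h1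
    have h2 : ‖(fderiv ℝ f (x₀ + t • ξ) - L (t • ξ)) ξ‖ ≤ l / 2 * (t * ‖ξ‖) * ‖ξ‖ :=
      (ContinuousLinearMap.le_opNorm _ _).trans (by gcongr)
    rw [Real.norm_eq_abs, abs_le] at h2
    have h3 := h2.1
    simp only [FunLike.coe_sub, Pi.sub_apply, map_smul, FunLike.coe_smul, Pi.smul_apply,
      smul_eq_mul] at h3
    have h4 := mul_le_mul_of_nonneg_left (hl ξ) ht.1.le
    nlinarith
  have := hmono (Set.left_mem_Icc.2 zero_le_one) (Set.right_mem_Icc.2 zero_le_one) zero_le_one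
  simp only [zero_smul, add_zero, one_smul] at this
  linarith

/-- The representative nearest to $0$ realizes the norm of the circle; it carries the local estimate
in $\mathbb R^3$ over to the torus. -/
lemma exists_lift_circle (a : AddCircle (2 * Real.pi)) :
    ∃ t : ℝ, (t : AddCircle (2 * Real.pi)) = a ∧ |t| = ‖a‖ := by
  obtain ⟨t, rfl⟩ := QuotientAddGroup.mk_surjective a
  refine ⟨t - round ((2 * Real.pi)⁻¹ * t) * (2 * Real.pi), ?_, ?_⟩
  · have := AddCircle.coe_period (2 * Real.pi)
    rw [← zsmul_eq_mul, AddCircle.coe_sub, AddCircle.coe_zsmul, this, smul_zero, sub_zero]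
  · exact (AddCircle.norm_eq (2 * Real.pi)).symm

lemma exists_lift (x₀ : Fin 3 → ℝ) (p : T3) :
    ∃ ξ : Fin 3 → ℝ, toT3 (x₀ + ξ) = p ∧ ∀ i, |ξ i| = ‖(p - toT3 x₀) i‖ := by
  choose ξ h1 h2 using fun i => exists_lift_circle ((p - toT3 x₀) i)
  refine ⟨ξ, funext fun i => ?_, h2⟩
  have := h1 i
  simp only [toT3, Pi.add_apply, AddCircle.coe_add, this, Pi.sub_apply]
  abel

lemma norm_le_tnorm (p : T3) (i : Fin 3) : ‖p i‖ ≤ tnorm p := by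
  refine Real.le_sqrt_of_sq_le ?_
  exact Finset.single_le_sum (f := fun i => ‖p i‖ ^ 2) (fun _ _ => by positivity)
    (Finset.mem_univ i)

/-- The quadratic growth of `w₂` at its minimum `(p₀, p₀)`. -/
def Model.QuadraticMin (P : Model) (p₀ : T3) (c : ℝ) : Prop :=
  0 < c ∧ ∀ p q, c * (tnorm (p - p₀) ^ 2 + tnorm (q - p₀) ^ 2) ≤ P.w2 (p, q) - P.m

lemma Model.m_le (P : Model) (x : T3 × T3) : P.m ≤ P.w2 x :=
  ciInf_le (isCompact_range P.w2.continuous).bddBelow x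

lemma Model.MinimumAndSmoothness.exists_quadraticMin {P : Model}
    (h : P.MinimumAndSmoothness) : ∃ p₀ c, P.QuadraticMin p₀ c := by
  obtain ⟨⟨x₀, hmin, hpos⟩, -, hw⟩ := h
  set p₀ := toT3 x₀ with hp₀
  have hmin' : ∀ y, P.w2 (p₀, p₀) ≤ P.w2 y := fun y => by
    by_cases hy : y = (p₀, p₀)
    · rw [hy]
    · exact (hmin y hy).le
  have hm : P.m = P.w2 (p₀, p₀) :=
    le_antisymm (P.m_le _) (le_ciInf hmin')
  obtain ⟨c, hc, r, hr, hb⟩ := exists_quadratic_lower_bound (f := P.w2Lift) (x₀ := (x₀, x₀))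
    (hw.of_le (by norm_num)) (fun x => hmin' _)
    (fun ξ hξ => by simpa [iteratedFDeriv_two_apply] using hpos ξ hξ)
  have hN : Continuous fun x : T3 × T3 => tnorm (x.1 - p₀) ^ 2 + tnorm (x.2 - p₀) ^ 2 := by
    have := continuous_tnorm
    fun_prop
  obtain ⟨N, hN0, hNb⟩ : ∃ N > 0, ∀ p q : T3, tnorm (p - p₀) ^ 2 + tnorm (q - p₀) ^ 2 ≤ N := by
    obtain ⟨N, hN⟩ := (isCompact_range hN).bddAbove
    exact ⟨max N 1, by positivity, fun p q => (hN ⟨(p, q), rfl⟩).trans (le_max_left _ _)⟩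
  -- Away from $(p_0,p_0)$, uniqueness of the minimum and compactness give a positive gap.
  obtain ⟨c', hc', hcK⟩ : ∃ c' > 0, ∀ p q : T3, (r ≤ tnorm (p - p₀) ∨ r ≤ tnorm (q - p₀)) →
      c' ≤ P.w2 (p, q) - P.m := by
    set K : Set (T3 × T3) := {x | r ≤ tnorm (x.1 - p₀) ∨ r ≤ tnorm (x.2 - p₀)} with hK
    have hKc : IsCompact K := by
      refine IsClosed.isCompact ?_
      have := continuous_tnorm
      have h1 : IsClosed {x : T3 × T3 | r ≤ tnorm (x.1 - p₀)} :=
        isClosed_le (by fun_prop) (by fun_prop)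
      have h2 : IsClosed {x : T3 × T3 | r ≤ tnorm (x.2 - p₀)} :=
        isClosed_le (by fun_prop) (by fun_prop)
      exact h1.union h2
    rcases K.eq_empty_or_nonempty with h | h
    · refine ⟨1, one_pos, fun p q hpq => ?_⟩
      have : (p, q) ∈ K := hpq
      simp [h] at this
    · obtain ⟨y, hy, hymin⟩ := hKc.exists_isMinOn h (f := fun x => P.w2 x - P.m) (by fun_prop)
      refine ⟨P.w2 y - P.m, ?_, fun p q hpq => hymin (show (p, q) ∈ K from hpq)⟩
      rw [hm, gt_iff_lt, sub_pos]
      refine hmin y ?_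
      rintro rfl
      simp only [hK, Set.mem_ofPred_eq, sub_self, tnorm_eq_zero.2 rfl, or_self] at hy
      linarith
  -- The 6 compares the Euclidean lengths of two vectors of $\mathbb R^3$ with the sup norm on
  -- $\mathbb R^3\times\mathbb R^3$; $c'/N$ serves the region away from the minimum, $N$ bounding
  -- $|p-p_0|^2+|q-p_0|^2$.
  refine ⟨p₀, min (c / 6) (c' / N), by positivity, fun p q => ?_⟩
  by_cases hpq : r ≤ tnorm (p - p₀) ∨ r ≤ tnorm (q - p₀)
  · calc _ ≤ c' / N * N := by
          gcongr
          · exact min_le_right _ _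
          · exact hNb p q
      _ = c' := by field_simp
      _ ≤ _ := hcK p q hpq
  · push Not at hpq
    obtain ⟨ξ, hξp, hξ⟩ := exists_lift x₀ p
    obtain ⟨η, hηq, hη⟩ := exists_lift x₀ q
    have hξr : ‖ξ‖ < r := (pi_norm_lt_iff hr).2 fun i => by
      rw [Real.norm_eq_abs, hξ]
      exact (norm_le_tnorm _ i).trans_lt hpq.1
    have hηr : ‖η‖ < r := (pi_norm_lt_iff hr).2 fun i => by
      rw [Real.norm_eq_abs, hη]
      exact (norm_le_tnorm _ i).trans_lt hpq.2
    have h1 := hb (ξ, η) (by rw [Prod.norm_mk]; exact max_lt hξr hηr)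
    simp only [Model.w2Lift, Prod.mk_add_mk, hξp, hηq] at h1
    rw [← hp₀, ← hm] at h1
    have hs : ∀ (ξ : Fin 3 → ℝ) (p : T3), (∀ i, |ξ i| = ‖(p - p₀) i‖) →
        tnorm (p - p₀) ^ 2 ≤ 3 * ‖ξ‖ ^ 2 := by
      intro ξ p hξ
      rw [tnorm_sq]
      calc ∑ i, ‖(p - p₀) i‖ ^ 2 ≤ ∑ _i : Fin 3, ‖ξ‖ ^ 2 := by
            refine Finset.sum_le_sum fun i _ => ?_
            rw [← hξ, ← Real.norm_eq_abs]
            gcongr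
            exact norm_le_pi_norm ξ i
        _ = 3 * ‖ξ‖ ^ 2 := by simp
    have h2 := hs ξ p hξ
    have h3 := hs η q hη
    have h4 : ‖ξ‖ ^ 2 ≤ ‖(ξ, η)‖ ^ 2 := by gcongr; exact le_max_left _ _
    have h5 : ‖η‖ ^ 2 ≤ ‖(ξ, η)‖ ^ 2 := by gcongr; exact le_max_right _ _
    calc _ ≤ c / 6 * (tnorm (p - p₀) ^ 2 + tnorm (q - p₀) ^ 2) := by
          gcongr
          exact min_le_left _ _
      _ ≤ c / 6 * (6 * ‖(ξ, η)‖ ^ 2) := by gcongr; linarith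
      _ = c * ‖(ξ, η)‖ ^ 2 := by ring
      _ ≤ _ := by linarith

/-! ### Counting generalized eigenvalues by the sign of a Schur complement. -/

section Schur

variable {F G : Type*} [NormedAddCommGroup F] [InnerProductSpace ℂ F]
  [NormedAddCommGroup G] [InnerProductSpace ℂ G]

/-- `z` is a generalized eigenvalue of the block operator `(A, B*; B, D)` with respect to
the weight `(ε, 1)`. -/
def IsBlockEigenvalue (A : F →ₗ[ℂ] F) (B : F →ₗ[ℂ] G) (Bs : G →ₗ[ℂ] F) (D : G →ₗ[ℂ] G)
    (ε z : ℝ) : Prop :=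
  ∃ f h, A f + Bs h = ((ε * z : ℝ) : ℂ) • f ∧ B f + D h = (z : ℂ) • h ∧
    0 < ε * ‖f‖ ^ 2 + ‖h‖ ^ 2

/-- The Schur complement `A - ε a - B* R B`. -/
def schur (A : F →ₗ[ℂ] F) (B : F →ₗ[ℂ] G) (Bs : G →ₗ[ℂ] F) (R : G →ₗ[ℂ] G) (ε a : ℝ) :
    F →ₗ[ℂ] F :=
  A - ((ε * a : ℝ) : ℂ) • LinearMap.id - Bs ∘ₗ R ∘ₗ B

variable {A : F →ₗ[ℂ] F} {B : F →ₗ[ℂ] G} {Bs : G →ₗ[ℂ] F} {D R : G →ₗ[ℂ] G} {ε a : ℝ}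

/-- Here $R=(D-a)^{-1}$, and $\varepsilon x$, $y$ are the defects of $(f,h)$ in the eigenvalue
equations at $a$. Since $Bf=y-(D-a)h$, one has $RBf=Ry-h$; so $h$ cancels from the first row and
$Sf=\varepsilon x-B^*Ry$. -/
lemma inner_schur (hB : ∀ f h, inner ℂ (B f) h = inner ℂ f (Bs h))
    (hD : D.IsSymmetric) (hR : ∀ h, R (D h - (a : ℂ) • h) = h)
    (hR' : ∀ h, D (R h) - (a : ℂ) • R h = h)
    {f x : F} {h y : G} (h1 : A f + Bs h = ((ε * a : ℝ) : ℂ) • f + (ε : ℂ) • x)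
    (h2 : B f + D h = (a : ℂ) • h + y) :
    inner ℂ f (schur A B Bs R ε a f) =
      (ε : ℂ) * inner ℂ f x + inner ℂ h y - inner ℂ y (R y) := by
  have hBf : B f = y - (D h - (a : ℂ) • h) := by
    rw [eq_sub_of_add_eq h2]; abel
  have hRB : R (B f) = R y - h := by rw [hBf, map_sub, hR]
  have hS : schur A B Bs R ε a f = (ε : ℂ) • x - Bs (R y) := by
    simp only [schur, LinearMap.sub_apply, LinearMap.smul_apply, LinearMap.id_apply,
      LinearMap.comp_apply, hRB, map_sub, eq_sub_of_add_eq h1]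
    abel
  have hsymm : inner ℂ (D h - (a : ℂ) • h) (R y) = inner ℂ h y := by
    rw [inner_sub_left, hD, inner_smul_left, Complex.conj_ofReal, ← inner_smul_right,
      ← inner_sub_right, hR']
  rw [hS, inner_sub_right, inner_smul_right, ← hB, hBf, inner_sub_left, hsymm]
  ring

/-- The usual orthogonality argument for a symmetric block operator; the weighted form may be
degenerate, as $\varepsilon=0$ is allowed. -/
lemma block_orthogonal (hA : A.IsSymmetric) (hB : ∀ f h, inner ℂ (B f) h = inner ℂ f (Bs h))
    (hD : D.IsSymmetric) {z w : ℝ} (hzw : z ≠ w) {f g : F} {h k : G}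
    (h1 : A f + Bs h = ((ε * z : ℝ) : ℂ) • f) (h2 : B f + D h = (z : ℂ) • h)
    (h3 : A g + Bs k = ((ε * w : ℝ) : ℂ) • g) (h4 : B g + D k = (w : ℂ) • k) :
    (ε : ℂ) * inner ℂ f g + inner ℂ h k = 0 := by
  have hB' : ∀ f h, inner ℂ (Bs h) f = inner ℂ h (B f) := fun f h => by
    rw [← inner_conj_symm, ← hB, inner_conj_symm]
  have e1 : inner ℂ (A f + Bs h) g + inner ℂ (B f + D h) k =
      inner ℂ f (A g + Bs k) + inner ℂ h (B g + D k) := by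
    simp only [inner_add_left, inner_add_right, hA f g, hB, hD h k, hB']
    ring
  rw [h1, h2, h3, h4] at e1
  simp only [inner_smul_left, inner_smul_right, Complex.conj_ofReal] at e1
  have hne : (z : ℂ) - w ≠ 0 := sub_ne_zero.2 (by exact_mod_cast hzw)
  apply mul_left_cancel₀ hne
  push_cast at e1
  linear_combination e1

lemma gram_sum {ι : Type*} [Fintype ι] {f : ι → F} {h : ι → G}
    (horth : ∀ i j, i ≠ j → (ε : ℂ) * inner ℂ (f i) (f j) + inner ℂ (h i) (h j) = 0)
    (α β : ι → ℂ) :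
    (ε : ℂ) * inner ℂ (∑ i, α i • f i) (∑ i, β i • f i) +
        inner ℂ (∑ i, α i • h i) (∑ i, β i • h i) =
      ∑ i, (starRingEnd ℂ) (α i) * β i * ((ε * ‖f i‖ ^ 2 + ‖h i‖ ^ 2 : ℝ) : ℂ) := by
  classical
  simp only [sum_inner, inner_sum, Finset.mul_sum, ← Finset.sum_add_distrib]
  refine Finset.sum_congr rfl fun i _ => ?_
  rw [Finset.sum_eq_single i]
  · simp only [inner_smul_left, inner_smul_right, inner_self_eq_norm_sq_to_K]
    push_cast
    simp only [Complex.coe_algebraMap]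
    ring
  · intro j _ hji
    simp only [inner_smul_left, inner_smul_right]
    linear_combination (starRingEnd ℂ) (α j) * β i * horth j i hji
  · simp

section Count

variable (hA : A.IsSymmetric) (hB : ∀ f h, inner ℂ (B f) h = inner ℂ f (Bs h))
    (hD : D.IsSymmetric) (hR : ∀ h, R (D h - (a : ℂ) • h) = h)
    (hR' : ∀ h, D (R h) - (a : ℂ) • R h = h)

include hA hB hD hR hR'

/-- A combination $\sum c_i(f_i,h_i)$ of eigenvectors has defects $x=\sum c_i(z_i-a)f_i$ and $y=\sum
c_i(z_i-a)h_i$. Weighted orthogonality makes both sums in `inner_schur` diagonal. -/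
lemma re_inner_schur_sum {ι : Type*} [Fintype ι] {z : ι → ℝ} (hz : Function.Injective z)
    {f : ι → F} {h : ι → G}
    (h1 : ∀ i, A (f i) + Bs (h i) = ((ε * z i : ℝ) : ℂ) • f i)
    (h2 : ∀ i, B (f i) + D (h i) = (z i : ℂ) • h i) (c : ι → ℂ) :
    ∃ y : G, (∑ i, ‖c i‖ ^ 2 * (z i - a) ^ 2 * (ε * ‖f i‖ ^ 2 + ‖h i‖ ^ 2) =
        ε * ‖∑ i, (c i * (z i - a)) • f i‖ ^ 2 + ‖y‖ ^ 2) ∧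
      RCLike.re (inner ℂ (∑ i, c i • f i) (schur A B Bs R ε a (∑ i, c i • f i))) =
        ∑ i, ‖c i‖ ^ 2 * (z i - a) * (ε * ‖f i‖ ^ 2 + ‖h i‖ ^ 2) -
          RCLike.re (inner ℂ y (R y)) := by
  have horth : ∀ i j, i ≠ j → (ε : ℂ) * inner ℂ (f i) (f j) + inner ℂ (h i) (h j) = 0 :=
    fun i j hij => block_orthogonal hA hB hD (hz.ne hij) (h1 i) (h2 i) (h1 j) (h2 j)
  have hreal : ∀ w : ℂ, (starRingEnd ℂ) w * w = ((‖w‖ ^ 2 : ℝ) : ℂ) := fun w => by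
    rw [Complex.conj_mul']; push_cast; rfl
  refine ⟨∑ i, (c i * (z i - a)) • h i, ?_, ?_⟩
  · have := gram_sum horth (fun i => c i * (z i - a)) (fun i => c i * (z i - a))
    rw [inner_self_eq_norm_sq_to_K, inner_self_eq_norm_sq_to_K] at this
    have h3 := congrArg Complex.re this
    simp only [Complex.coe_algebraMap] at h3
    rw [← Complex.ofReal_pow, ← Complex.ofReal_pow, ← Complex.ofReal_mul, ← Complex.ofReal_add,
      Complex.ofReal_re] at h3
    rw [h3, Complex.re_sum]
    refine Finset.sum_congr rfl fun i _ => ?_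
    rw [hreal, ← Complex.ofReal_mul, Complex.ofReal_re, norm_mul, ← Complex.ofReal_sub,
      Complex.norm_real, mul_pow, Real.norm_eq_abs, sq_abs]
  · rw [inner_schur hB hD hR hR' (x := ∑ i, (c i * (z i - a)) • f i)
      (h := ∑ i, c i • h i) (y := ∑ i, (c i * (z i - a)) • h i), gram_sum horth]
    · simp only [map_sub, RCLike.re_to_complex, Complex.re_sum]
      congr 1
      refine Finset.sum_congr rfl fun i _ => ?_
      rw [← mul_assoc, hreal, ← Complex.ofReal_sub, ← Complex.ofReal_mul, ← Complex.ofReal_mul,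
        Complex.ofReal_re]
    · simp only [map_sum, map_smul, Finset.smul_sum, ← Finset.sum_add_distrib]
      refine Finset.sum_congr rfl fun i _ => ?_
      rw [← smul_add, h1 i, smul_smul, smul_smul, smul_smul, ← add_smul]
      congr 1
      push_cast
      ring
    · simp only [map_sum, map_smul, Finset.smul_sum, ← Finset.sum_add_distrib]
      refine Finset.sum_congr rfl fun i _ => ?_
      rw [← smul_add, h2 i, smul_smul, smul_smul, ← add_smul]
      congr 1
      ring

/-- One eigenvector is taken for each $z\in s$. With more than $n$ of them, a nonzero combination is
annihilated by all $\ell_k$, and on it the form of the Schur complement has strictly the wrong sign.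
This is immediate below $a$, where $R\ge0$. Above $a$, $\langle y,Ry\rangle\le\|y\|^2/(m-a)$ is
beaten because $(z_i-a)^2<(m-a)(z_i-a)$. -/
lemma card_le_of_schur_sign {n : ℕ} (ℓ : Fin n → F →ₗ[ℂ] ℂ) (s : Finset ℝ)
    (hs : ∀ z ∈ s, IsBlockEigenvalue A B Bs D ε z)
    (hsign : (∀ z ∈ s, z < a) ∧ (∀ y, 0 ≤ RCLike.re (inner ℂ y (R y))) ∧
        (∀ f, (∀ k, ℓ k f = 0) → 0 ≤ RCLike.re (inner ℂ f (schur A B Bs R ε a f))) ∨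
      ∃ m, 0 ≤ ε ∧ (∀ z ∈ s, a < z ∧ z < m) ∧
        (∀ y, RCLike.re (inner ℂ y (R y)) ≤ ‖y‖ ^ 2 / (m - a)) ∧
        (∀ f, (∀ k, ℓ k f = 0) → RCLike.re (inner ℂ f (schur A B Bs R ε a f)) ≤ 0)) :
    s.card ≤ n := by
  classical
  by_contra! hn
  choose! f h h1 h2 h3 using hs
  let T : (s → ℂ) →ₗ[ℂ] (Fin n → ℂ) :=
    LinearMap.pi fun k => ℓ k ∘ₗ Fintype.linearCombination ℂ (fun i : s => f i)
  have hker : LinearMap.ker T ≠ ⊥ := T.ker_ne_bot_of_finrank_lt (by simpa using hn)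
  obtain ⟨c, hcT, hc⟩ := (Submodule.ne_bot_iff _).1 hker
  have hcℓ : ∀ k, ℓ k (∑ i : s, c i • f i) = 0 := fun k => by
    have := congrFun (LinearMap.mem_ker.1 hcT) k
    simpa [T, Fintype.linearCombination_apply] using this
  obtain ⟨i₀, hi₀⟩ := Function.ne_iff.1 hc
  obtain ⟨y, hy1, hy2⟩ := re_inner_schur_sum hA hB hD hR hR' (z := fun i : s => (i : ℝ))
    Subtype.val_injective (f := fun i : s => f i) (h := fun i : s => h i)
    (fun i => h1 i i.2) (fun i => h2 i i.2) c
  have hpos : ∀ i : s, 0 < ε * ‖f i‖ ^ 2 + ‖h i‖ ^ 2 := fun i => h3 i i.2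
  have hci : 0 < ‖c i₀‖ ^ 2 := pow_pos (norm_pos_iff.2 hi₀) 2
  rcases hsign with ⟨hlt, hRpos, hform⟩ | ⟨m, hε, hlt, hRle, hform⟩
  · have hneg : ∑ i : s, ‖c i‖ ^ 2 * ((i : ℝ) - a) * (ε * ‖f i‖ ^ 2 + ‖h i‖ ^ 2) < 0 := by
      refine Finset.sum_neg' (fun i _ => ?_) ⟨i₀, Finset.mem_univ _, ?_⟩
      · have := hlt i i.2
        have := hpos i
        exact mul_nonpos_of_nonpos_of_nonneg
          (mul_nonpos_of_nonneg_of_nonpos (by positivity) (by linarith)) this.le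
      · exact mul_neg_of_neg_of_pos (mul_neg_of_pos_of_neg hci (by linarith [hlt i₀ i₀.2]))
          (hpos i₀)
    have := hform _ hcℓ
    have := hRpos y
    linarith
  · have hma : 0 < m - a := by linarith [hlt i₀ i₀.2]
    have hstrict : ∑ i : s, ‖c i‖ ^ 2 * ((i : ℝ) - a) ^ 2 * (ε * ‖f i‖ ^ 2 + ‖h i‖ ^ 2) <
        ∑ i : s, (m - a) * (‖c i‖ ^ 2 * ((i : ℝ) - a) * (ε * ‖f i‖ ^ 2 + ‖h i‖ ^ 2)) := by
      have hd : ∀ i : s, (m - a) * (‖c i‖ ^ 2 * ((i : ℝ) - a) * (ε * ‖f i‖ ^ 2 + ‖h i‖ ^ 2)) -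
          ‖c i‖ ^ 2 * ((i : ℝ) - a) ^ 2 * (ε * ‖f i‖ ^ 2 + ‖h i‖ ^ 2) =
          ‖c i‖ ^ 2 * (((i : ℝ) - a) * (m - i) * (ε * ‖f i‖ ^ 2 + ‖h i‖ ^ 2)) := fun i => by ring
      have hp : ∀ i : s, 0 < ((i : ℝ) - a) * (m - i) * (ε * ‖f i‖ ^ 2 + ‖h i‖ ^ 2) := fun i =>
        mul_pos (mul_pos (by linarith [hlt i i.2]) (by linarith [hlt i i.2])) (hpos i)
      refine Finset.sum_lt_sum (fun i _ => ?_) ⟨i₀, Finset.mem_univ _, ?_⟩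
      · rw [← sub_nonneg, hd]
        exact mul_nonneg (by positivity) (hp i).le
      · rw [← sub_pos, hd]
        exact mul_pos hci (hp i₀)
    rw [← Finset.mul_sum, hy1] at hstrict
    have h4 := hform _ hcℓ
    have h5 := hRle y
    rw [le_div_iff₀ hma] at h5
    -- With $\varepsilon\ge0$ the $f$-part of the weighted norm can be dropped, leaving an upper
    -- bound for $\|y\|^2$.
    have h6 : 0 ≤ ε * ‖∑ i : s, (c i * ((i : ℝ) - a)) • f i‖ ^ 2 := by positivity
    rw [hy2] at h4
    nlinarith

end Count
end Schur

/-! ### Continuity, monotonicity and positivity of the determinants. -/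

lemma integrable_mul_inv_tnorm_sub_sq (p₀ : T3) (C : ℝ) :
    Integrable fun s : T3 => C * (tnorm (s - p₀) ^ 2)⁻¹ :=
  (integrable_inv_tnorm_sub_sq p₀).const_mul _

namespace Model

/-- The determinant `w₁(p) - ε z - (1/2) ∫ v₁(s)² / (w₂(p, s) - z) ds`. -/
noncomputable def det (P : Model) (ε : ℝ) (p : T3) (z : ℝ) : ℝ :=
  P.w1 p - ε * z - 1 / 2 * ∫ s, P.v1 s ^ 2 / (P.w2 (p, s) - z)

lemma Δ₁_eq_det (P : Model) : P.Δ₁ = P.det 1 := by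
  ext p z
  simp [Δ₁, det]

variable {P : Model} {p₀ : T3} {c : ℝ}

lemma ae_ne (p₀ : T3) : ∀ᵐ s : T3, s ≠ p₀ := by
  have : volume ({p₀} : Set T3) = 0 := measure_singleton p₀
  rw [← compl_mem_ae_iff] at this
  exact this

namespace QuadraticMin

variable (hq : P.QuadraticMin p₀ c)
include hq

/-- Dropping the term in $p$ leaves a bound uniform in $p$ and in $z\le m$; its reciprocal is an
integrable majorant that reaches the endpoint $z=m$. -/
lemma le_sub (p s : T3) {z : ℝ} (hz : z ≤ P.m) : c * tnorm (s - p₀) ^ 2 ≤ P.w2 (p, s) - z := by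
  have := hq.2 p s
  have h1 : 0 ≤ c * tnorm (p - p₀) ^ 2 := mul_nonneg hq.1.le (sq_nonneg _)
  linarith

lemma sub_pos (p : T3) {s : T3} (hs : s ≠ p₀) {z : ℝ} (hz : z ≤ P.m) : 0 < P.w2 (p, s) - z :=
  (mul_pos hq.1 (pow_pos (tnorm_pos (sub_ne_zero.2 hs)) 2)).trans_le (hq.le_sub p s hz)

lemma norm_integrand_le (v : C(T3, ℝ)) (p : T3) {s : T3} (hs : s ≠ p₀) {z : ℝ} (hz : z ≤ P.m) :
    ‖v s ^ 2 / (P.w2 (p, s) - z)‖ ≤ ‖v‖ ^ 2 * c⁻¹ * (tnorm (s - p₀) ^ 2)⁻¹ := by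
  have h0 := pow_pos (tnorm_pos (sub_ne_zero.2 hs)) 2
  have hc := hq.1
  have hpos := hq.sub_pos p hs hz
  rw [norm_div, norm_pow, Real.norm_of_nonneg hpos.le, mul_assoc, ← mul_inv, ← div_eq_mul_inv]
  gcongr
  · exact v.norm_coe_le_norm s
  · exact hq.le_sub p s hz

lemma integrable_det (v : C(T3, ℝ)) (p : T3) {z : ℝ} (hz : z ≤ P.m) :
    Integrable fun s => v s ^ 2 / (P.w2 (p, s) - z) := by
  refine (integrable_mul_inv_tnorm_sub_sq p₀ (‖v‖ ^ 2 * c⁻¹)).mono' ?_ ?_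
  · have h1 : Measurable fun s : T3 => v s ^ 2 := by fun_prop
    have h2 : Measurable fun s : T3 => P.w2 (p, s) - z :=
      (by fun_prop : Continuous fun s : T3 => P.w2 (p, s) - z).measurable
    exact (h1.div h2).aestronglyMeasurable
  · filter_upwards [ae_ne p₀] with s hs using hq.norm_integrand_le v p hs hz

lemma continuousOn_det (ε : ℝ) :
    ContinuousOn (fun x : T3 × ℝ => P.det ε x.1 x.2) (Set.univ ×ˢ Set.Iic P.m) := by
  unfold det
  refine ContinuousOn.sub (by fun_prop) (ContinuousOn.mul continuousOn_const ?_)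
  refine continuousOn_of_dominated (bound := fun s => ‖P.v1‖ ^ 2 * c⁻¹ * (tnorm (s - p₀) ^ 2)⁻¹)
    (fun x hx => (hq.integrable_det P.v1 x.1 hx.2).aestronglyMeasurable) (fun x hx => ?_)
    (integrable_mul_inv_tnorm_sub_sq p₀ _) ?_
  · filter_upwards [ae_ne p₀] with s hs using hq.norm_integrand_le P.v1 x.1 hs hx.2
  · filter_upwards [ae_ne p₀] with s hs
    refine ContinuousOn.div (by fun_prop) (by fun_prop) fun x hx => ?_
    exact (hq.sub_pos x.1 hs hx.2).ne'

/-- For $\varepsilon>0$ the term $-\varepsilon z$ gives strictness; for $\varepsilon=0$ it must come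
from the integral, which requires $v_1\ne0$. -/
lemma strictAntiOn_det {ε : ℝ} (hε : 0 < ε ∨ ε = 0 ∧ P.v1 ≠ 0) (p : T3) :
    StrictAntiOn (P.det ε p) (Set.Iic P.m) := by
  intro z hz z' hz' hzz
  rcases hε with hε | ⟨rfl, hv⟩
  · have h1 : ∫ s, P.v1 s ^ 2 / (P.w2 (p, s) - z) ≤ ∫ s, P.v1 s ^ 2 / (P.w2 (p, s) - z') := by
      refine integral_mono_ae (hq.integrable_det _ p hz) (hq.integrable_det _ p hz') ?_
      filter_upwards [ae_ne p₀] with s hs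
      have := hq.sub_pos p hs hz'
      gcongr
    have h2 := mul_lt_mul_of_pos_left hzz hε
    simp only [det]
    linarith
  -- $W$ bounds $w_2-z$ and $w_2-z'$ from above, so the integrand grows by at least
  -- $(z'-z)v_1^2/W^2$, a quantity with positive integral.
  · set W : ℝ := ‖P.w2‖ + |z| + 1 with hW
    have hW0 : 0 < W := by positivity
    have hvint : 0 < ∫ s, P.v1 s ^ 2 := by
      obtain ⟨a, ha⟩ : ∃ a, P.v1 a ≠ 0 := by
        by_contra! h
        exact hv (ContinuousMap.ext h)
      exact Continuous.integral_pos_of_hasCompactSupport_nonneg_nonzero (by fun_prop)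
        (HasCompactSupport.of_compactSpace _) (fun s => sq_nonneg _) (pow_ne_zero 2 ha)
    have hvi : Integrable fun s : T3 => P.v1 s ^ 2 :=
      (by fun_prop : Continuous fun s : T3 => P.v1 s ^ 2).integrable_of_hasCompactSupport
        (HasCompactSupport.of_compactSpace _)
    have hi := hq.integrable_det P.v1 p hz
    have hle : ∫ s, (P.v1 s ^ 2 / (P.w2 (p, s) - z) + (z' - z) / W ^ 2 * P.v1 s ^ 2) ≤
        ∫ s, P.v1 s ^ 2 / (P.w2 (p, s) - z') := by
      refine integral_mono_ae (hi.add (hvi.const_mul _)) (hq.integrable_det _ p hz') ?_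
      filter_upwards [ae_ne p₀] with s hs
      have h1 := hq.sub_pos p hs hz'
      have h2 := hq.sub_pos p hs hz
      have h3 : P.w2 (p, s) - z ≤ W := by
        have := (le_abs_self _).trans (P.w2.norm_coe_le_norm (p, s))
        have := neg_abs_le z
        linarith
      have h4 : (P.w2 (p, s) - z') * (P.w2 (p, s) - z) ≤ W ^ 2 := by
        rw [sq]
        gcongr
        linarith
      have h5 : (z' - z) / W ^ 2 ≤ (z' - z) / ((P.w2 (p, s) - z') * (P.w2 (p, s) - z)) :=
        div_le_div_of_nonneg_left (by linarith) (by positivity) h4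
      have h6 : P.v1 s ^ 2 / (P.w2 (p, s) - z') = P.v1 s ^ 2 / (P.w2 (p, s) - z) +
          (z' - z) / ((P.w2 (p, s) - z') * (P.w2 (p, s) - z)) * P.v1 s ^ 2 := by
        field_simp
        ring
      rw [h6]
      gcongr
    rw [integral_add hi (hvi.const_mul _), integral_const_mul] at hle
    have : 0 < (z' - z) / W ^ 2 * ∫ s, P.v1 s ^ 2 :=
      mul_pos (div_pos (by linarith) (by positivity)) hvint
    simp only [det]
    linarith

omit hq in
-- As $z\to-\infty$ the integral tends to $0$; positivity then comes from $-\varepsilon z$, or from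
-- $w_1>0$ when $\varepsilon=0$.
lemma exists_det_pos {ε : ℝ} (hε : 0 < ε ∨ ε = 0 ∧ ∀ p, 0 < P.w1 p) :
    ∃ z₀ < P.m, ∀ p, ∀ z ≤ z₀, 0 < P.det ε p z := by
  set V : ℝ := ∫ s, P.v1 s ^ 2 with hV
  have hvi : Integrable fun s : T3 => P.v1 s ^ 2 :=
    (by fun_prop : Continuous fun s : T3 => P.v1 s ^ 2).integrable_of_hasCompactSupport
      (HasCompactSupport.of_compactSpace _)
  have hV0 : 0 ≤ V := integral_nonneg fun s => sq_nonneg _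
  have hbound : ∀ t > 0, ∀ p, ∀ z ≤ P.m - t,
      ∫ s, P.v1 s ^ 2 / (P.w2 (p, s) - z) ≤ V / t := by
    intro t ht p z hz
    rw [hV, ← integral_div]
    have hpos : ∀ s, t ≤ P.w2 (p, s) - z := fun s => by
      have := P.m_le (p, s)
      linarith
    refine integral_mono_of_nonneg (Filter.Eventually.of_forall fun s => ?_) (hvi.div_const _)
      (Filter.Eventually.of_forall fun s => ?_)
    · exact div_nonneg (sq_nonneg _) (ht.le.trans (hpos s))
    · have := hpos s
      simp only
      gcongr
  rcases hε with hε | ⟨rfl, hw⟩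
  · set t : ℝ := 1 + |P.m| + (‖P.w1‖ + V + 1) / ε with ht
    have ht1 : 1 ≤ t := by
      have : 0 ≤ (‖P.w1‖ + V + 1) / ε := by positivity
      have := abs_nonneg P.m
      linarith
    refine ⟨P.m - t, by linarith, fun p z hz => ?_⟩
    have h1 := hbound t (by linarith) p z hz
    have h2 : V / t ≤ V := div_le_self hV0 ht1
    have h3 : ‖P.w1‖ + V + 1 ≤ ε * (-z) := by
      have : (‖P.w1‖ + V + 1) / ε ≤ -z := by
        have := le_abs_self P.m
        linarith
      rwa [div_le_iff₀' hε] at this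
    have h4 := (neg_le_abs _).trans (P.w1.norm_coe_le_norm p)
    simp only [det]
    linarith
  · obtain ⟨q, -, hqmin⟩ := isCompact_univ.exists_isMinOn Set.univ_nonempty
      (P.w1.continuous.continuousOn)
    have hw0 := hw q
    set t : ℝ := 1 + V / P.w1 q with ht
    have ht1 : 1 ≤ t := by
      have : 0 ≤ V / P.w1 q := by positivity
      linarith
    refine ⟨P.m - t, by linarith, fun p z hz => ?_⟩
    have h1 := hbound t (by linarith) p z hz
    have h2 : V / t ≤ P.w1 q := by
      rw [div_le_iff₀ (by linarith), ht, mul_add, mul_div_cancel₀ _ hw0.ne']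
      linarith
    have h3 : P.w1 q ≤ P.w1 p := hqmin (Set.mem_univ p)
    simp only [det]
    linarith

end QuadraticMin
end Model

/-! ### Zeros of the determinant in the three regimes. -/

/-- The three possible shapes of the zero set of a determinant below `m`. -/
lemma Regime.cases {Δ : T3 → ℝ → ℝ} {σ : Set ℝ} {m : ℝ} (h : Regime Δ σ m)
    (hc : ContinuousOn (fun x : T3 × ℝ => Δ x.1 x.2) (Set.univ ×ˢ Set.Iic m))
    (hs : ∀ p, StrictAntiOn (Δ p) (Set.Iic m))
    (hpos : ∃ z₀ < m, ∀ p, ∀ z ≤ z₀, 0 < Δ p z)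
    (hσ : ∀ z ∈ σ, z ≤ m → ∃ p, Δ p z = 0)
    (hσ' : ∀ z < m, ∀ p, Δ p z = 0 → z ∈ σ) :
    (∀ p, 0 < Δ p m) ∨
    (∃ E < m, ZeroOrder (fun p => Δ p E) ∧ (∀ p, 0 ≤ Δ p E) ∧
      ∀ z, E < z → z < m → ∃ p, Δ p z = 0) ∨
    (∃ E < m, ∃ E' < m, ZeroOrder (fun p => Δ p E) ∧ (∀ p, 0 ≤ Δ p E) ∧
      ZeroOrder (fun p => Δ p E') ∧ (∀ p, Δ p E' ≤ 0) ∧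
      ∀ z, E < z → z < E' → ∃ p, Δ p z = 0) := by
  obtain ⟨z₀, hz₀, hpos⟩ := hpos
  have hcz : ∀ z ≤ m, Continuous fun p => Δ p z := fun z hz =>
    hc.comp_continuous (f := fun p : T3 => (p, z)) (by fun_prop) fun p => ⟨trivial, hz⟩
  have hcp : ∀ p, ContinuousOn (Δ p) (Set.Iic m) := fun p =>
    hc.comp (f := fun z : ℝ => (p, z)) (by fun_prop) fun z hz => ⟨trivial, hz⟩
  have hbdd : BddBelow (σ ∩ Set.Iic m) := ⟨z₀, fun z hz => by
    obtain ⟨p, hp⟩ := hσ z hz.1 hz.2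
    by_contra! hlt
    exact (hpos p z hlt.le).ne' hp⟩
  have hbddA : BddAbove (σ ∩ Set.Iic m) := ⟨m, fun z hz => hz.2⟩
  -- Intermediate values over the connected torus, at fixed $z$.
  have hivt : ∀ z ≤ m, (∃ p, Δ p z ≤ 0) → (∃ p, 0 ≤ Δ p z) → ∃ p, Δ p z = 0 := by
    rintro z hz ⟨p, hp⟩ ⟨q, hq⟩
    exact mem_range_of_exists_le_of_exists_ge (hcz z hz) ⟨p, hp⟩ ⟨q, hq⟩
  -- Intermediate values in $z$, at fixed $p$: positive far below, negative at $m$.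
  have hroot : ∀ p, Δ p m < 0 → ∃ z ∈ σ ∩ Set.Iic m, z < m := by
    intro p hp
    obtain ⟨z, hz, hz0⟩ := intermediate_value_Icc' hz₀.le
      ((hcp p).mono Set.Icc_subset_Iic_self) ⟨hp.le, (hpos p z₀ le_rfl).le⟩
    have hzm : z < m := hz.2.lt_of_ne (by rintro rfl; exact hp.ne hz0)
    exact ⟨z, ⟨hσ' z hzm p hz0, hz.2⟩, hzm⟩
  have hnn : ZeroOrderAtMin Δ σ m → ∀ p, 0 ≤ Δ p (sInf (σ ∩ Set.Iic m)) := fun h p => by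
    by_cases h0 : Δ p (sInf (σ ∩ Set.Iic m)) = 0
    · exact h0.ge
    · exact (h.2 p h0).le
  rcases h with h | ⟨⟨p, hp⟩, ⟨q, hq⟩, hmin⟩ | ⟨hneg, hmin, hmax⟩
  · exact Or.inl h
  · obtain ⟨z₁, hz₁, hz₁m⟩ := hroot p hp
    refine Or.inr (Or.inl ⟨sInf (σ ∩ Set.Iic m), (csInf_le hbdd hz₁).trans_lt hz₁m, hmin.1,
      hnn hmin, fun z hz hzm => ?_⟩)
    obtain ⟨z', hz', hlt⟩ := exists_lt_of_csInf_lt ⟨z₁, hz₁⟩ hz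
    obtain ⟨p', hp'⟩ := hσ z' hz'.1 hz'.2
    refine hivt z hzm.le ⟨p', ?_⟩ ⟨q, ?_⟩
    · rw [← hp']
      exact (hs p' hz'.2 hzm.le hlt).le
    · exact hq.trans (hs q hzm.le Set.self_mem_Iic hzm).le
  · obtain ⟨z₁, hz₁, hz₁m⟩ := hroot 0 (hneg 0)
    -- Negativity at $m$ persists at some $\zeta(p)<m$ in a neighbourhood of $p$. By compactness
    -- finitely many neighbourhoods suffice, and by monotonicity no zero lies above the largest of
    -- the corresponding $\zeta(p)$.
    have hmax_lt : sSup (σ ∩ Set.Iic m) < m := by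
      have hloc : ∀ p, ∃ ζ < m, ∀ᶠ q in nhds p, Δ q ζ < 0 := by
        intro p
        have h1 : ∀ᶠ z in nhdsWithin m (Set.Iic m), Δ p z < 0 :=
          (hcp p m Set.self_mem_Iic).eventually (eventually_lt_nhds (hneg p))
        have h2 : ∀ᶠ z in nhdsWithin m (Set.Iio m), Δ p z < 0 :=
          h1.filter_mono (nhdsWithin_mono _ Set.Iio_subset_Iic_self)
        obtain ⟨ζ, hζ, hζm⟩ := (h2.and self_mem_nhdsWithin).exists
        exact ⟨ζ, hζm, (hcz ζ (le_of_lt hζm)).continuousAt.eventually (eventually_lt_nhds hζ)⟩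
      choose ζ hζm hζ using hloc
      obtain ⟨t, -, ht⟩ := isCompact_univ.elim_nhds_subcover (fun p => {q | Δ q (ζ p) < 0})
        (fun p _ => hζ p)
      have hne : t.Nonempty := by
        rcases t.eq_empty_or_nonempty with h | h
        · have := ht (Set.mem_univ 0)
          simp [h] at this
        · exact h
      refine lt_of_le_of_lt (csSup_le ⟨z₁, hz₁⟩ (a := t.sup' hne ζ) fun z hz => ?_)
        ((Finset.sup'_lt_iff hne).2 fun p _ => hζm p)
      obtain ⟨q, hq⟩ := hσ z hz.1 hz.2
      obtain ⟨p, hpt, hpq⟩ := Set.mem_iUnion₂.1 (ht (Set.mem_univ q))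
      by_contra! hlt
      have h1 : ζ p < z := (Finset.le_sup' ζ hpt).trans_lt hlt
      have h2 := hs q (hζm p).le hz.2 h1
      have h3 : Δ q (ζ p) < 0 := hpq
      linarith
    refine Or.inr (Or.inr ⟨sInf (σ ∩ Set.Iic m), (csInf_le hbdd hz₁).trans_lt hz₁m,
      sSup (σ ∩ Set.Iic m), hmax_lt, hmin.1, hnn hmin, hmax.1, fun p => ?_, fun z hz hz' => ?_⟩)
    · by_cases h0 : Δ p (sSup (σ ∩ Set.Iic m)) = 0
      · exact h0.le
      · exact (hmax.2 p h0).le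
    -- A root below $z$ makes the determinant nonpositive somewhere at $z$, and a root above makes
    -- it nonnegative somewhere.
    · obtain ⟨y, hy, hlt⟩ := exists_lt_of_csInf_lt ⟨z₁, hz₁⟩ hz
      obtain ⟨y', hy', hlt'⟩ := exists_lt_of_lt_csSup ⟨z₁, hz₁⟩ hz'
      obtain ⟨p, hp⟩ := hσ y hy.1 hy.2
      obtain ⟨q, hq⟩ := hσ y' hy'.1 hy'.2
      have hzm : z ≤ m := (hz'.trans hmax_lt).le
      refine hivt z hzm ⟨p, ?_⟩ ⟨q, ?_⟩
      · rw [← hp]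
        exact (hs p hy.2 hzm hlt).le
      · rw [← hq]
        exact (hs q hzm hy'.2 hlt').le


/-! ### Multiplication operators on $L_2$ and their resolvents. -/

lemma integrable_norm_sq {X : Type} [MeasureSpace X] (f : L2 X) : Integrable fun x => ‖f x‖ ^ 2 :=
  (memLp_two_iff_integrable_sq_norm (Lp.memLp f).1).1 (Lp.memLp f)

lemma norm_sq_eq_integral {X : Type} [MeasureSpace X] (f : L2 X) : ‖f‖ ^ 2 = ∫ x, ‖f x‖ ^ 2 := by
  have h := inner_self_eq_norm_sq_to_K (𝕜 := ℂ) f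
  rw [L2.inner_def] at h
  simp only [inner_self_eq_norm_sq_to_K, Complex.coe_algebraMap] at h
  exact_mod_cast h.symm

section MulOp

variable {X : Type} [TopologicalSpace X] [CompactSpace X] [MeasureSpace X] [BorelSpace X]

lemma mulOp_coeFn (φ : C(X, ℝ)) (f : L2 X) : mulOp φ f =ᵐ[volume] fun x => (φ x : ℂ) * f x :=
  opOfFormula_coeFn _ _ _ _ _ _ _ _

lemma inner_mulOp_left (φ : C(X, ℝ)) (f g : L2 X) :
    inner ℂ (mulOp φ f) g = inner ℂ f (mulOp φ g) := by
  rw [L2.inner_def, L2.inner_def]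
  refine integral_congr_ae ?_
  filter_upwards [mulOp_coeFn φ f, mulOp_coeFn φ g] with x h1 h2
  rw [h1, h2]
  simp only [RCLike.inner_apply, map_mul, Complex.conj_ofReal]
  ring

lemma mulOp_mulOp (φ ψ : C(X, ℝ)) (f : L2 X) : mulOp φ (mulOp ψ f) = mulOp (φ * ψ) f := by
  apply Lp.ext
  filter_upwards [mulOp_coeFn φ (mulOp ψ f), mulOp_coeFn ψ f, mulOp_coeFn (φ * ψ) f] with x h1 h2 h3
  rw [h1, h2, h3, ContinuousMap.mul_apply]
  push_cast
  ring

lemma mulOp_one (f : L2 X) : mulOp (1 : C(X, ℝ)) f = f := by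
  apply Lp.ext
  filter_upwards [mulOp_coeFn (1 : C(X, ℝ)) f] with x h1
  rw [h1]
  simp

lemma mulOp_sub_const (φ : C(X, ℝ)) (b : ℝ) (f : L2 X) :
    mulOp (φ - ContinuousMap.const X b) f = mulOp φ f - (b : ℂ) • f := by
  apply Lp.ext
  filter_upwards [mulOp_coeFn φ f, mulOp_coeFn (φ - ContinuousMap.const X b) f,
    Lp.coeFn_sub (mulOp φ f) ((b : ℂ) • f), Lp.coeFn_smul (b : ℂ) f] with x h1 h2 h3 h4
  rw [h2, h3, Pi.sub_apply, h4, h1, Pi.smul_apply, smul_eq_mul]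
  simp only [ContinuousMap.sub_apply, ContinuousMap.const_apply, Complex.ofReal_sub]
  ring

lemma re_inner_mulOp (φ : C(X, ℝ)) (f : L2 X) :
    RCLike.re (inner ℂ f (mulOp φ f)) = ∫ x, φ x * ‖f x‖ ^ 2 := by
  have h : inner ℂ f (mulOp φ f) = ((∫ x, φ x * ‖f x‖ ^ 2 : ℝ) : ℂ) := by
    rw [L2.inner_def, ← integral_complex_ofReal]
    refine integral_congr_ae ?_
    filter_upwards [mulOp_coeFn φ f] with x h1
    rw [h1, RCLike.inner_apply, mul_assoc, Complex.mul_conj']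
    push_cast
    ring
  rw [h]
  exact Complex.ofReal_re _

lemma integrable_mul_norm_sq (φ : C(X, ℝ)) (f : L2 X) : Integrable fun x => φ x * ‖f x‖ ^ 2 :=
  (integrable_norm_sq f).bdd_mul (c := ‖φ‖) φ.continuous.aestronglyMeasurable
    (Filter.Eventually.of_forall fun x => φ.norm_coe_le_norm x)

lemma re_inner_mulOp_nonneg {φ : C(X, ℝ)} (hφ : ∀ x, 0 ≤ φ x) (f : L2 X) :
    0 ≤ RCLike.re (inner ℂ f (mulOp φ f)) := by
  rw [re_inner_mulOp]
  exact integral_nonneg fun x => mul_nonneg (hφ x) (sq_nonneg _)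

lemma re_inner_mulOp_le {φ : C(X, ℝ)} {K : ℝ} (hφ : ∀ x, φ x ≤ K) (f : L2 X) :
    RCLike.re (inner ℂ f (mulOp φ f)) ≤ K * ‖f‖ ^ 2 := by
  rw [re_inner_mulOp, norm_sq_eq_integral, ← integral_const_mul]
  exact integral_mono (integrable_mul_norm_sq φ f) ((integrable_norm_sq f).const_mul _)
    fun x => mul_le_mul_of_nonneg_right (hφ x) (sq_nonneg _)

end MulOp

/-- The function `x ↦ 1 / (w(x) - b)`. -/
noncomputable def shiftInv {X : Type*} [TopologicalSpace X] (w : C(X, ℝ)) (b : ℝ)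
    (h : ∀ x, b < w x) :
    C(X, ℝ) where
  toFun x := (w x - b)⁻¹
  continuous_toFun := (by fun_prop : Continuous fun x => w x - b).inv₀
    fun x => (sub_pos.2 (h x)).ne'

lemma shiftInv_apply {X : Type*} [TopologicalSpace X] (w : C(X, ℝ)) (b : ℝ) (h : ∀ x, b < w x)
    (x : X) : shiftInv w b h x = (w x - b)⁻¹ := rfl

section ShiftInv

variable {X : Type} [TopologicalSpace X] [CompactSpace X] [MeasureSpace X] [BorelSpace X]
  (w : C(X, ℝ)) (b : ℝ) (h : ∀ x, b < w x)

lemma mulOp_shiftInv_sub (f : L2 X) : mulOp (shiftInv w b h) (mulOp w f - (b : ℂ) • f) = f := by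
  rw [← mulOp_sub_const, mulOp_mulOp]
  have : shiftInv w b h * (w - ContinuousMap.const X b) = 1 := ContinuousMap.ext fun x => by
    simp [shiftInv_apply, inv_mul_cancel₀ (sub_pos.2 (h x)).ne']
  rw [this, mulOp_one]

lemma mulOp_sub_shiftInv (f : L2 X) :
    mulOp w (mulOp (shiftInv w b h) f) - (b : ℂ) • mulOp (shiftInv w b h) f = f := by
  rw [← mulOp_sub_const, mulOp_mulOp]
  have : (w - ContinuousMap.const X b) * shiftInv w b h = 1 := ContinuousMap.ext fun x => by
    simp [shiftInv_apply, mul_inv_cancel₀ (sub_pos.2 (h x)).ne']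
  rw [this, mulOp_one]

end ShiftInv

/-! ### Tensor products, partial integrals and their adjoints. -/

/-- Multiplication by a symmetric function, on symmetric functions. -/
noncomputable def symMulOp (w : C(T3 × T3, ℝ)) (hw : ∀ p q, w (p, q) = w (q, p)) :
    L2Sym →L[ℂ] L2Sym :=
  (mulOp w ∘L L2Sym.subtypeL).codRestrict L2Sym fun f => mulOp_symm w hw f f.2

lemma partialIntOp_coeFn (v : C(T3, ℝ)) (f : L2 (T3 × T3)) :
    partialIntOp v f =ᵐ[volume] fun p => ∫ s, (v s : ℂ) * f (p, s) :=
  opOfFormula_coeFn _ _ _ _ _ _ _ _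

lemma tensorOp_coeFn (v : C(T3, ℝ)) (g : L2 T3) :
    tensorOp v g =ᵐ[volume] fun x => (v x.2 : ℂ) * g x.1 :=
  opOfFormula_coeFn _ _ _ _ _ _ _ _

lemma inner_tensorOp (v : C(T3, ℝ)) (g : L2 T3) (h : L2 (T3 × T3)) :
    inner ℂ (tensorOp v g) h = inner ℂ g (partialIntOp v h) := by
  have hi := L2.integrable_inner (𝕜 := ℂ) (tensorOp v g) h
  rw [L2.inner_def, L2.inner_def]
  refine (integral_prod _ hi).trans ?_
  refine integral_congr_ae ?_
  filter_upwards [partialIntOp_coeFn v h, Measure.ae_ae_of_ae_prod (tensorOp_coeFn v g)]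
    with p h1 h2
  rw [h1, RCLike.inner_apply, ← integral_mul_const]
  refine integral_congr_ae ?_
  filter_upwards [h2] with s hs
  rw [hs, RCLike.inner_apply, map_mul, Complex.conj_ofReal]
  ring

lemma inner_swapOp (f g : L2 (T3 × T3)) : inner ℂ (swapOp f) g = inner ℂ f (swapOp g) := by
  conv_lhs => rw [← swapOp_swapOp g]
  exact LinearIsometry.inner_map_map _ f (swapOp g)

lemma inner_intOp (v : C(T3, ℝ)) (c : ℂ) (f : L2 T3) :
    inner ℂ (c • vec v) f = inner ℂ c (intOp v f) := by
  rw [inner_smul_left, inner_vec, RCLike.inner_apply, mul_comm]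
  rfl

lemma adjoint_intOp (v : C(T3, ℝ)) (c : ℂ) :
    ContinuousLinearMap.adjoint (intOp v) c = c • vec v := by
  refine ext_inner_right ℂ fun f => ?_
  rw [ContinuousLinearMap.adjoint_inner_left, inner_intOp]

lemma vec_coeFn (v : C(T3, ℝ)) : vec v =ᵐ[volume] fun s => (v s : ℂ) := MemLp.coeFn_toLp _

/-- The symmetrized tensor product `f ↦ (v(q) f(p) + v(p) f(q)) / 2`. -/
noncomputable def symTensor (v : C(T3, ℝ)) : L2 T3 →L[ℂ] L2Sym :=
  (((1 / 2 : ℝ) : ℂ) • (tensorOp v + swapOp ∘L tensorOp v)).codRestrict L2Sym fun f => by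
    rw [mem_L2Sym]
    simp only [FunLike.coe_smul, FunLike.coe_add, Pi.smul_apply, Pi.add_apply,
      ContinuousLinearMap.comp_apply, map_smul, map_add, swapOp_swapOp]
    rw [add_comm]

lemma coe_symTensor (v : C(T3, ℝ)) (f : L2 T3) :
    (symTensor v f : L2 (T3 × T3)) =
      ((1 / 2 : ℝ) : ℂ) • (tensorOp v f + swapOp (tensorOp v f)) := rfl

lemma ae_swap {p : T3 × T3 → Prop} (h : ∀ᵐ x : T3 × T3, p x) : ∀ᵐ x : T3 × T3, p x.swap :=
  ((Measure.measurePreserving_swap (μ := (volume : Measure T3))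
      (ν := (volume : Measure T3))).quasiMeasurePreserving).ae h

lemma symTensor_coeFn (v : C(T3, ℝ)) (f : L2 T3) :
    (symTensor v f : L2 (T3 × T3)) =ᵐ[volume] fun x =>
      1 / 2 * ((v x.2 : ℂ) * f x.1 + (v x.1 : ℂ) * f x.2) := by
  rw [coe_symTensor]
  filter_upwards [Lp.coeFn_smul ((1 / 2 : ℝ) : ℂ) (tensorOp v f + swapOp (tensorOp v f)),
    Lp.coeFn_add (tensorOp v f) (swapOp (tensorOp v f)), tensorOp_coeFn v f,
    swapOp_coeFn (tensorOp v f), ae_swap (tensorOp_coeFn v f)] with x h1 h2 h3 h4 h5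
  rw [h1, Pi.smul_apply, h2, Pi.add_apply, h3, h4, h5, smul_eq_mul]
  push_cast
  rfl

/-- Against a symmetric function both halves of the symmetrization contribute equally, so the
symmetrized tensor product is the adjoint of the partial integral. -/
lemma inner_symTensor (v : C(T3, ℝ)) (f : L2 T3) (h : L2Sym) :
    inner ℂ (symTensor v f) h = inner ℂ f (partialIntOp v h) := by
  rw [Submodule.coe_inner, coe_symTensor, inner_smul_left, inner_add_left, inner_swapOp,
    (mem_L2Sym _).1 h.2, inner_tensorOp, Complex.conj_ofReal]
  push_cast
  ring

lemma adjoint_H12 (P : Model) : ContinuousLinearMap.adjoint P.H12 = symTensor P.v1 := by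
  symm
  rw [ContinuousLinearMap.eq_adjoint_iff]
  exact fun f h => inner_symTensor P.v1 f h

/-! ### The Schur complement as a determinant plus an integral operator. -/

namespace Model

variable (P : Model)

/-- The operator of multiplication by `w₂` on symmetric functions. -/
noncomputable def mulW2 : L2Sym →L[ℂ] L2Sym := symMulOp P.w2 P.w2_symm

variable {P} {b : ℝ}

lemma lt_w2 (hb : b < P.m) (x : T3 × T3) : b < P.w2 x := hb.trans_le (P.m_le x)

/-- The function `1 / (w₂ - b)`, for `b < m`. -/
noncomputable def resFun (hb : b < P.m) : C(T3 × T3, ℝ) := shiftInv P.w2 b (lt_w2 hb)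

lemma resFun_apply (hb : b < P.m) (x : T3 × T3) : resFun hb x = (P.w2 x - b)⁻¹ := rfl

/-- The resolvent of multiplication by `w₂` on symmetric functions. -/
noncomputable def res (hb : b < P.m) : L2Sym →L[ℂ] L2Sym :=
  symMulOp (resFun hb) fun p q => by rw [resFun_apply, resFun_apply, P.w2_symm]

lemma res_mulW2_sub (hb : b < P.m) (h : L2Sym) : res hb (P.mulW2 h - (b : ℂ) • h) = h :=
  Subtype.ext (mulOp_shiftInv_sub P.w2 b (lt_w2 hb) h)

lemma mulW2_res_sub (hb : b < P.m) (h : L2Sym) : P.mulW2 (res hb h) - (b : ℂ) • res hb h = h :=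
  Subtype.ext (mulOp_sub_shiftInv P.w2 b (lt_w2 hb) h)

lemma mulW2_isSymmetric : (P.mulW2 : L2Sym →ₗ[ℂ] L2Sym).IsSymmetric :=
  fun f g => inner_mulOp_left P.w2 f g

lemma re_inner_res_nonneg (hb : b < P.m) (y : L2Sym) : 0 ≤ RCLike.re (inner ℂ y (res hb y)) :=
  re_inner_mulOp_nonneg (fun x => by
    rw [resFun_apply]
    exact (inv_pos.2 (sub_pos.2 (lt_w2 hb x))).le) (y : L2 (T3 × T3))

lemma re_inner_res_le (hb : b < P.m) (y : L2Sym) :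
    RCLike.re (inner ℂ y (res hb y)) ≤ ‖y‖ ^ 2 / (P.m - b) := by
  rw [div_eq_inv_mul]
  refine re_inner_mulOp_le (φ := resFun hb) (fun x => ?_) (y : L2 (T3 × T3))
  rw [resFun_apply]
  have := P.m_le x
  exact inv_anti₀ (by linarith) (by linarith)

/-- The kernel `v₁(p) v₁(s) / (w₂(p, s) - b)`. -/
noncomputable def kern (hb : b < P.m) : C(T3 × T3, ℝ) where
  toFun x := P.v1 x.1 * P.v1 x.2 * resFun hb x

lemma kern_apply (hb : b < P.m) (x : T3 × T3) :
    kern hb x = P.v1 x.1 * P.v1 x.2 * (P.w2 x - b)⁻¹ := rfl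

lemma integrable_of_L2 (f : L2 T3) : Integrable f :=
  (Lp.memLp f).integrable (by norm_num)

lemma integrable_kernel_mul (c : C(T3 × T3, ℝ)) (f : L2 T3) (p : T3) :
    Integrable fun s => (c (p, s) : ℂ) * f s :=
  (integrable_of_L2 f).bdd_mul (c := ‖c‖)
    (by fun_prop : Continuous fun s : T3 => (c (p, s) : ℂ)).aestronglyMeasurable
    (Filter.Eventually.of_forall fun s => by
      rw [Complex.norm_real]
      exact c.norm_coe_le_norm _)

/-- The action of the Schur complement on `L₂(𝕋³)`:
`f ↦ Δ(p; b) f(p) - (1/2) ∫ v₁(p) v₁(s) / (w₂(p, s) - b) f(s) ds`. -/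
noncomputable def schurL2 (ε : ℝ) (hb : b < P.m) (f : L2 T3) : L2 T3 :=
  mulOp P.w1 f - ((ε * b : ℝ) : ℂ) • f - P.H12 (res hb (symTensor P.v1 f))

/-- Of the two terms of the symmetrized tensor product, $v_1(s)f(p)$ yields the integral inside the
determinant and $v_1(p)f(s)$ yields the kernel. -/
lemma schurL2_coeFn (ε : ℝ) (hb : b < P.m) (f : L2 T3) :
    schurL2 ε hb f =ᵐ[volume] fun p =>
      (P.det ε p b : ℂ) * f p - 1 / 2 * ∫ s, (kern hb (p, s) : ℂ) * f s := by
  have h0 : P.H12 (res hb (symTensor P.v1 f)) =ᵐ[volume] fun p =>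
      ∫ s, (P.v1 s : ℂ) * mulOp (resFun hb) (symTensor P.v1 f : L2 (T3 × T3)) (p, s) :=
    partialIntOp_coeFn P.v1 _
  have h1 := Measure.ae_ae_of_ae_prod (mulOp_coeFn (resFun hb) (symTensor P.v1 f : L2 (T3 × T3)))
  have h2 := Measure.ae_ae_of_ae_prod (symTensor_coeFn P.v1 f)
  filter_upwards [Lp.coeFn_sub (mulOp P.w1 f - ((ε * b : ℝ) : ℂ) • f)
      (P.H12 (res hb (symTensor P.v1 f))),
    Lp.coeFn_sub (mulOp P.w1 f) (((ε * b : ℝ) : ℂ) • f), mulOp_coeFn P.w1 f,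
    Lp.coeFn_smul ((ε * b : ℝ) : ℂ) f, h0, h1, h2] with p e1 e2 e3 e4 e5 e6 e7
  have hI : Integrable fun s => P.v1 s ^ 2 / (P.w2 (p, s) - b) := by
    have : Continuous fun s => P.v1 s ^ 2 / (P.w2 (p, s) - b) :=
      Continuous.div (by fun_prop) (by fun_prop) fun s => (sub_pos.2 (lt_w2 hb (p, s))).ne'
    exact this.integrable_of_hasCompactSupport (HasCompactSupport.of_compactSpace _)
  have e8 : ∫ s, (P.v1 s : ℂ) * mulOp (resFun hb) (symTensor P.v1 f : L2 (T3 × T3)) (p, s) =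
      ∫ s, ((1 / 2 * f p) * ((P.v1 s ^ 2 / (P.w2 (p, s) - b) : ℝ) : ℂ) +
        1 / 2 * ((kern hb (p, s) : ℂ) * f s)) := by
    refine integral_congr_ae ?_
    filter_upwards [e6, e7] with s h6 h7
    rw [h6, h7, kern_apply, resFun_apply]
    push_cast
    ring
  have hIc : Integrable fun s => ((P.v1 s ^ 2 / (P.w2 (p, s) - b) : ℝ) : ℂ) := hI.ofReal
  have e9 : ∫ s, ((1 / 2 * f p) * ((P.v1 s ^ 2 / (P.w2 (p, s) - b) : ℝ) : ℂ) +
        1 / 2 * ((kern hb (p, s) : ℂ) * f s)) =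
      1 / 2 * f p * ((∫ s, P.v1 s ^ 2 / (P.w2 (p, s) - b) : ℝ) : ℂ) +
        1 / 2 * ∫ s, (kern hb (p, s) : ℂ) * f s := by
    rw [integral_add (hIc.const_mul _) ((integrable_kernel_mul _ f p).const_mul _),
      integral_const_mul, integral_const_mul, integral_complex_ofReal]
  rw [schurL2, e1, Pi.sub_apply, e2, Pi.sub_apply, e3, e4, Pi.smul_apply, e5, e8, e9,
    det, smul_eq_mul]
  push_cast
  ring

end Model

/-! ### Weighted Cauchy–Schwarz and bounds on kernel forms. -/

lemma integral_mul_le_sqrt {α : Type*} [MeasurableSpace α] {μ : Measure α} {f g : α → ℝ}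
    (hf : 0 ≤ᵐ[μ] f) (hg : 0 ≤ᵐ[μ] g) (hfm : AEStronglyMeasurable f μ)
    (hgm : AEStronglyMeasurable g μ) (hf2 : Integrable (fun x => f x ^ 2) μ)
    (hg2 : Integrable (fun x => g x ^ 2) μ) :
    ∫ x, f x * g x ∂μ ≤ √(∫ x, f x ^ 2 ∂μ) * √(∫ x, g x ^ 2 ∂μ) := by
  have hp : Real.HolderConjugate 2 2 := Real.HolderConjugate.two_two
  have h := integral_mul_le_Lp_mul_Lq_of_nonneg hp hf hg
    (by simpa using (memLp_two_iff_integrable_sq hfm).2 hf2)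
    (by simpa using (memLp_two_iff_integrable_sq hgm).2 hg2)
  simpa [Real.sqrt_eq_rpow] using h

/-- Cauchy–Schwarz for $|f|=|D|^{-1/2}\cdot|D|^{1/2}|f|$. The factorization fails where $D=0$, hence
the almost everywhere hypothesis. -/
lemma sq_integral_norm_le_weighted {D : T3 → ℝ} (hD : Continuous D)
    (hi : Integrable fun p => |D p|⁻¹) (hne : ∀ᵐ p, D p ≠ 0) (f : L2 T3) :
    (∫ p, ‖f p‖) ^ 2 ≤ (∫ p, |D p|⁻¹) * ∫ p, |D p| * ‖f p‖ ^ 2 := by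
  have hDf : Integrable fun p => |D p| * ‖f p‖ ^ 2 :=
    integrable_mul_norm_sq (⟨fun p => |D p|, hD.abs⟩ : C(T3, ℝ)) f
  have e1 : ∀ p, √(|D p|⁻¹) ^ 2 = |D p|⁻¹ := fun p => Real.sq_sqrt (by positivity)
  have e2 : ∀ p, (√|D p| * ‖f p‖) ^ 2 = |D p| * ‖f p‖ ^ 2 := fun p => by
    rw [mul_pow, Real.sq_sqrt (abs_nonneg _)]
  have h := integral_mul_le_sqrt (μ := (volume : Measure T3)) (f := fun p => √(|D p|⁻¹))
    (g := fun p => √|D p| * ‖f p‖)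
    (Filter.Eventually.of_forall fun p => Real.sqrt_nonneg _)
    (Filter.Eventually.of_forall fun p => by positivity)
    (hD.abs.measurable.inv.sqrt.aestronglyMeasurable)
    ((Real.continuous_sqrt.comp hD.abs).aestronglyMeasurable.mul (Lp.memLp f).1.norm)
    (by simpa only [e1] using hi) (by simpa only [e2] using hDf)
  simp only [e1, e2] at h
  have e3 : ∫ p, √(|D p|⁻¹) * (√|D p| * ‖f p‖) = ∫ p, ‖f p‖ := by
    refine integral_congr_ae ?_
    filter_upwards [hne] with p hp
    rw [← mul_assoc, ← Real.sqrt_mul (by positivity), inv_mul_cancel₀ (abs_ne_zero.2 hp),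
      Real.sqrt_one, one_mul]
  rw [e3] at h
  have h0 : 0 ≤ ∫ p, ‖f p‖ := integral_nonneg fun p => norm_nonneg _
  calc (∫ p, ‖f p‖) ^ 2 ≤ (√(∫ p, |D p|⁻¹) * √(∫ p, |D p| * ‖f p‖ ^ 2)) ^ 2 := by gcongr
    _ = _ := by
      rw [mul_pow, Real.sq_sqrt (integral_nonneg fun p => by positivity),
        Real.sq_sqrt (integral_nonneg fun p => by positivity)]

lemma sq_integral_norm_le (f : L2 T3) :
    (∫ p, ‖f p‖) ^ 2 ≤ (volume : Measure T3).real Set.univ * ‖f‖ ^ 2 := by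
  have := sq_integral_norm_le_weighted (D := fun _ => 1) continuous_const (by simp) (by simp) f
  rw [norm_sq_eq_integral]
  simpa using this

/-- The form `∬ conj f(p) c(p, s) f(s) ds dp`. -/
noncomputable def kernelForm (c : C(T3 × T3, ℝ)) (f : L2 T3) : ℂ :=
  ∫ p, (starRingEnd ℂ) (f p) * ∫ s, (c (p, s) : ℂ) * f s

section KernelForm

variable (c : C(T3 × T3, ℝ)) (f : L2 T3)

lemma norm_kernel_integral_le (p : T3) : ‖∫ s, (c (p, s) : ℂ) * f s‖ ≤ ‖c‖ * ∫ s, ‖f s‖ := by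
  rw [← integral_const_mul]
  refine norm_integral_le_of_norm_le ((Model.integrable_of_L2 f).norm.const_mul _)
    (Filter.Eventually.of_forall fun s => mul_bound (c.curry p) f s |>.trans ?_)
  gcongr
  refine (ContinuousMap.norm_le _ (norm_nonneg _)).2 fun s => ?_
  exact c.norm_coe_le_norm (p, s)

lemma integrable_kernelForm :
    Integrable fun p => (starRingEnd ℂ) (f p) * ∫ s, (c (p, s) : ℂ) * f s := by
  have hm : AEStronglyMeasurable (fun x : T3 × T3 => (c x : ℂ) * f x.2)
      ((volume : Measure T3).prod volume) :=
    (Complex.continuous_ofReal.comp c.continuous).aestronglyMeasurable.mul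
      ((Lp.memLp f).1.comp_quasiMeasurePreserving Measure.quasiMeasurePreserving_snd)
  refine Integrable.mul_bdd (c := ‖c‖ * ∫ s, ‖f s‖) ?_ hm.integral_prod_right'
    (Filter.Eventually.of_forall fun p => norm_kernel_integral_le c f p)
  exact (RCLike.conjCLE (K := ℂ)).toContinuousLinearMap.integrable_comp (Model.integrable_of_L2 f)

lemma norm_kernelForm_le_of_forall {M : ℝ} (hM : ∀ p, ‖∫ s, (c (p, s) : ℂ) * f s‖ ≤ M) :
    ‖kernelForm c f‖ ≤ M * ∫ p, ‖f p‖ := by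
  rw [kernelForm, ← integral_const_mul]
  refine norm_integral_le_of_norm_le ((Model.integrable_of_L2 f).norm.const_mul _)
    (Filter.Eventually.of_forall fun p => ?_)
  rw [norm_mul, RCLike.norm_conj, mul_comm]
  exact mul_le_mul_of_nonneg_right (hM p) (norm_nonneg _)

lemma kernelForm_sub (c' : C(T3 × T3, ℝ)) :
    kernelForm (c - c') f = kernelForm c f - kernelForm c' f := by
  rw [kernelForm, kernelForm, kernelForm,
    ← integral_sub (integrable_kernelForm c f) (integrable_kernelForm c' f)]
  refine integral_congr_ae (Filter.Eventually.of_forall fun p => ?_)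
  simp only
  rw [← mul_sub, ← integral_sub (Model.integrable_kernel_mul c f p)
    (Model.integrable_kernel_mul c' f p)]
  congr 2
  ext s
  rw [ContinuousMap.sub_apply]
  push_cast
  ring

/-- The Hilbert–Schmidt bound. -/
lemma norm_kernelForm_le : ‖kernelForm c f‖ ≤ √(∫ x, c x ^ 2) * ‖f‖ ^ 2 := by
  have hF : Integrable (fun x : T3 × T3 => (‖f x.1‖ * ‖f x.2‖) ^ 2)
      ((volume : Measure T3).prod volume) := by
    simp only [mul_pow]
    exact (integrable_norm_sq f).mul_prod (integrable_norm_sq f)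
  have hF1 : Integrable (fun x : T3 × T3 => ‖f x.1‖ * ‖f x.2‖)
      ((volume : Measure T3).prod volume) :=
    (Model.integrable_of_L2 f).norm.mul_prod (Model.integrable_of_L2 f).norm
  have hcF : Integrable (fun x : T3 × T3 => |c x| * (‖f x.1‖ * ‖f x.2‖))
      ((volume : Measure T3).prod volume) :=
    hF1.bdd_mul (c := ‖c‖) c.continuous.abs.aestronglyMeasurable
      (Filter.Eventually.of_forall fun x => by
        rw [Real.norm_eq_abs, abs_abs]
        exact c.norm_coe_le_norm x)
  have h1 : ‖kernelForm c f‖ ≤ ∫ p, ∫ s, |c (p, s)| * (‖f p‖ * ‖f s‖) := by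
    refine norm_integral_le_of_norm_le hcF.integral_prod_left
      (Filter.Eventually.of_forall fun p => ?_)
    rw [norm_mul, RCLike.norm_conj]
    calc ‖f p‖ * ‖∫ s, (c (p, s) : ℂ) * f s‖ ≤ ‖f p‖ * ∫ s, ‖(c (p, s) : ℂ) * f s‖ := by
          gcongr
          exact norm_integral_le_integral_norm _
      _ = ∫ s, |c (p, s)| * (‖f p‖ * ‖f s‖) := by
          rw [← integral_const_mul]
          congr 1
          ext s
          rw [norm_mul, Complex.norm_real, Real.norm_eq_abs]
          ring
  have h2 := integral_mul_le_sqrt (μ := (volume : Measure T3).prod volume)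
    (f := fun x => |c x|) (g := fun x => ‖f x.1‖ * ‖f x.2‖)
    (Filter.Eventually.of_forall fun x => abs_nonneg _)
    (Filter.Eventually.of_forall fun x => by positivity)
    c.continuous.abs.aestronglyMeasurable hF1.aestronglyMeasurable
    ((by fun_prop : Continuous fun x => |c x| ^ 2).integrable_of_hasCompactSupport
      (HasCompactSupport.of_compactSpace _)) hF
  rw [integral_prod _ hcF] at h2
  refine (h1.trans h2).trans_eq ?_
  have e : ∫ x : T3 × T3, (‖f x.1‖ * ‖f x.2‖) ^ 2 ∂((volume : Measure T3).prod volume) =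
      (‖f‖ ^ 2) ^ 2 := by
    simp only [mul_pow]
    rw [integral_prod_mul (fun p => ‖f p‖ ^ 2) (fun p => ‖f p‖ ^ 2), ← norm_sq_eq_integral]
    ring
  rw [e, Real.sqrt_sq (by positivity)]
  simp only [sq_abs]
  rfl

end KernelForm

/-- The rows $c(p,\cdot)$ form a compact family in the sup norm. The functionals are the rows of a
finite $\eta$-net; if $f$ is annihilated by these, every other row is within $\eta\|f\|_1$ of zero
on $f$. -/
lemma exists_kernel_net (c : C(T3 × T3, ℝ)) {η : ℝ} (hη : 0 < η) :
    ∃ (n : ℕ) (ℓ : Fin n → L2 T3 →L[ℂ] ℂ), ∀ f, (∀ i, ℓ i f = 0) →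
      ∀ p, ‖∫ s, (c (p, s) : ℂ) * f s‖ ≤ η * ∫ s, ‖f s‖ := by
  obtain ⟨t, -, ht⟩ := isCompact_univ.elim_nhds_subcover
    (fun p : T3 => {q | dist (c.curry q) (c.curry p) < η})
    (fun p _ => c.curry.continuous.continuousAt.eventually (Metric.ball_mem_nhds _ hη))
  refine ⟨t.card, fun i => intOp (c.curry (t.equivFin.symm i)), fun f hf p => ?_⟩
  obtain ⟨q, hqt, hpq⟩ := Set.mem_iUnion₂.1 (ht (Set.mem_univ p))
  have h0 : ∫ s, (c (q, s) : ℂ) * f s = 0 := by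
    have := hf (t.equivFin ⟨q, hqt⟩)
    simp only [Equiv.symm_apply_apply] at this
    exact this
  rw [← sub_zero (∫ s, (c (p, s) : ℂ) * f s), ← h0,
    ← integral_sub (Model.integrable_kernel_mul c f p) (Model.integrable_kernel_mul c f q),
    ← integral_const_mul]
  refine norm_integral_le_of_norm_le ((Model.integrable_of_L2 f).norm.const_mul _)
    (Filter.Eventually.of_forall fun s => ?_)
  rw [← sub_mul, norm_mul, ← Complex.ofReal_sub, Complex.norm_real]
  gcongr
  rw [← dist_eq_norm]
  exact (ContinuousMap.dist_apply_le_dist (f := c.curry p) (g := c.curry q) s).trans (le_of_lt hpq)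

/-! ### Sign of the Schur complement up to finite codimension. -/

namespace Model

variable {P : Model} {p₀ : T3} {c : ℝ}

lemma QuadraticMin.continuous_det (hq : P.QuadraticMin p₀ c) (ε : ℝ) {z : ℝ} (hz : z ≤ P.m) :
    Continuous fun p => P.det ε p z :=
  (hq.continuousOn_det ε).comp_continuous (f := fun p : T3 => (p, z)) (by fun_prop)
    fun _ => ⟨trivial, hz⟩

lemma QuadraticMin.re_inner_schurL2 (hq : P.QuadraticMin p₀ c) (ε : ℝ) {b : ℝ} (hb : b < P.m)
    (f : L2 T3) :
    RCLike.re (inner ℂ f (schurL2 ε hb f)) =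
      (∫ p, P.det ε p b * ‖f p‖ ^ 2) - 1 / 2 * (kernelForm (kern hb) f).re := by
  have h1 : Integrable fun p => P.det ε p b * ‖f p‖ ^ 2 :=
    integrable_mul_norm_sq (⟨fun p => P.det ε p b, hq.continuous_det ε hb.le⟩ : C(T3, ℝ)) f
  have h1c : Integrable fun p => ((P.det ε p b * ‖f p‖ ^ 2 : ℝ) : ℂ) := h1.ofReal
  have h : inner ℂ f (schurL2 ε hb f) =
      ((∫ p, P.det ε p b * ‖f p‖ ^ 2 : ℝ) : ℂ) - 1 / 2 * kernelForm (kern hb) f := by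
    rw [kernelForm, ← integral_const_mul, ← integral_complex_ofReal,
      ← integral_sub h1c ((integrable_kernelForm _ f).const_mul _), L2.inner_def]
    refine integral_congr_ae ?_
    filter_upwards [schurL2_coeFn ε hb f] with p hp
    rw [hp, RCLike.inner_apply, sub_mul, mul_assoc, Complex.mul_conj']
    push_cast
    ring
  rw [h, show (1 / 2 : ℂ) = ((1 / 2 : ℝ) : ℂ) by push_cast; rfl]
  simp only [RCLike.re_to_complex, Complex.sub_re, Complex.ofReal_re, Complex.re_ofReal_mul]

/-- At a threshold `E < m` where the determinant has a sign and zeros of order at most two, the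
Schur complement has the same sign on a subspace of finite codimension. -/
lemma QuadraticMin.exists_schurL2_sign (hq : P.QuadraticMin p₀ c) {ε E τ : ℝ} (hE : E < P.m)
    (hτ : |τ| = 1) (hz : ZeroOrder fun p => P.det ε p E) (hs : ∀ p, 0 ≤ τ * P.det ε p E) :
    ∃ (n : ℕ) (ℓ : Fin n → L2 T3 →L[ℂ] ℂ), ∀ f, (∀ i, ℓ i f = 0) →
      0 ≤ τ * RCLike.re (inner ℂ f (schurL2 ε hE f)) := by
  have hc := hq.continuous_det ε hE.le
  obtain ⟨hi, hne⟩ := hz.integrable_inv hc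
  set J : ℝ := ∫ p, |P.det ε p E|⁻¹ with hJ
  have hJ0 : 0 ≤ J := integral_nonneg fun p => by positivity
  -- With $\|f\|_1^2\le JI$, this $\eta$ makes the kernel form at most $\frac J{J+1}I\le I$.
  obtain ⟨n, ℓ, hℓ⟩ := exists_kernel_net (kern hE) (η := 1 / (J + 1)) (by positivity)
  refine ⟨n, ℓ, fun f hf => ?_⟩
  have h1 := norm_kernelForm_le_of_forall (kern hE) f (hℓ f hf)
  have h2 := sq_integral_norm_le_weighted hc hi hne f
  set I : ℝ := ∫ p, |P.det ε p E| * ‖f p‖ ^ 2 with hI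
  have hI0 : 0 ≤ I := integral_nonneg fun p => by positivity
  have hτI : τ * ∫ p, P.det ε p E * ‖f p‖ ^ 2 = I := by
    rw [← integral_const_mul]
    refine integral_congr_ae (Filter.Eventually.of_forall fun p => ?_)
    simp only
    rw [← mul_assoc, ← abs_of_nonneg (hs p), abs_mul, hτ, one_mul]
  have h3 : ‖kernelForm (kern hE) f‖ ≤ I := by
    refine h1.trans ?_
    rw [mul_assoc, ← sq, one_div, inv_mul_le_iff₀ (by positivity)]
    nlinarith
  have h4 : |τ * (kernelForm (kern hE) f).re| ≤ I := by
    rw [abs_mul, hτ, one_mul]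
    exact (Complex.abs_re_le_norm _).trans h3
  rw [hq.re_inner_schurL2, mul_sub, hτI]
  have := (abs_le.1 h4).2
  linarith

/-- From $a^2+b^2\ge ab$ one gets $w_2-m\ge c\,|p-p_0||q-p_0|$. The squared reciprocal is thus
dominated by a product of two integrable functions, so the limiting kernel at $m$ is
Hilbert–Schmidt. -/
lemma QuadraticMin.ae_sub_pos (hq : P.QuadraticMin p₀ c) : ∀ᵐ x : T3 × T3, P.m < P.w2 x ∧
    (P.w2 x - P.m)⁻¹ ^ 2 ≤
      c⁻¹ ^ 2 * ((tnorm (x.1 - p₀) ^ 2)⁻¹ * (tnorm (x.2 - p₀) ^ 2)⁻¹) := by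
  have h1 : ∀ᵐ x : T3 × T3, x.1 ≠ p₀ :=
    (Measure.quasiMeasurePreserving_fst (μ := (volume : Measure T3))
      (ν := (volume : Measure T3))).ae (ae_ne p₀)
  have h2 : ∀ᵐ x : T3 × T3, x.2 ≠ p₀ :=
    (Measure.quasiMeasurePreserving_snd (μ := (volume : Measure T3))
      (ν := (volume : Measure T3))).ae (ae_ne p₀)
  filter_upwards [h1, h2] with x hx1 hx2
  have ha := tnorm_pos (sub_ne_zero.2 hx1)
  have hb := tnorm_pos (sub_ne_zero.2 hx2)
  have hc := hq.1
  have h := hq.2 x.1 x.2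
  refine ⟨_root_.sub_pos.1 (hq.sub_pos x.1 hx2 le_rfl), ?_⟩
  set a := tnorm (x.1 - p₀)
  set b := tnorm (x.2 - p₀)
  have hab : c * (a * b) ≤ P.w2 x - P.m := by
    refine le_trans ?_ h
    gcongr
    nlinarith [sq_nonneg (a - b)]
  have hinv : 0 ≤ (P.w2 x - P.m)⁻¹ := inv_nonneg.2 (le_trans (by positivity) hab)
  calc (P.w2 x - P.m)⁻¹ ^ 2 ≤ (c * (a * b))⁻¹ ^ 2 := by gcongr
    _ = _ := by
      field_simp

lemma QuadraticMin.integrable_inv_sq (hq : P.QuadraticMin p₀ c) :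
    Integrable fun x : T3 × T3 => (P.w2 x - P.m)⁻¹ ^ 2 := by
  have h : Integrable (fun x : T3 × T3 =>
      c⁻¹ ^ 2 * ((tnorm (x.1 - p₀) ^ 2)⁻¹ * (tnorm (x.2 - p₀) ^ 2)⁻¹)) :=
    ((integrable_inv_tnorm_sub_sq p₀).mul_prod (integrable_inv_tnorm_sub_sq p₀)).const_mul _
  refine h.mono' ?_ ?_
  · exact ((by fun_prop : Continuous fun x => P.w2 x - P.m).measurable.inv.pow_const
      2).aestronglyMeasurable
  · filter_upwards [hq.ae_sub_pos] with x hx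
    rw [Real.norm_of_nonneg (sq_nonneg _)]
    exact hx.2

lemma QuadraticMin.tendsto_integral_sub_sq (hq : P.QuadraticMin p₀ c) :
    Filter.Tendsto (fun b : ℝ => ∫ x : T3 × T3, ((P.w2 x - P.m)⁻¹ - (P.w2 x - b)⁻¹) ^ 2)
      (nhdsWithin P.m (Set.Iio P.m)) (nhds 0) := by
  have h0 : ∫ _x : T3 × T3, (0 : ℝ) = 0 := by simp
  rw [← h0]
  refine tendsto_integral_filter_of_dominated_convergence
    (fun x => (P.w2 x - P.m)⁻¹ ^ 2) (Filter.Eventually.of_forall fun b => ?_) ?_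
    hq.integrable_inv_sq ?_
  · have h1 := (by fun_prop : Continuous fun x => P.w2 x - P.m).measurable.inv
    have h2 := (by fun_prop : Continuous fun x => P.w2 x - b).measurable.inv
    exact ((h1.sub h2).pow_const 2).aestronglyMeasurable
  · filter_upwards [self_mem_nhdsWithin] with b hb
    filter_upwards [hq.ae_sub_pos] with x hx
    have hb' : b < P.m := hb
    have h1 : 0 < P.w2 x - P.m := _root_.sub_pos.2 hx.1
    have h2 : 0 < P.w2 x - b := by linarith
    have h3 : (P.w2 x - b)⁻¹ ≤ (P.w2 x - P.m)⁻¹ := inv_anti₀ h1 (by linarith)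
    have h4 : 0 < (P.w2 x - b)⁻¹ := inv_pos.2 h2
    rw [Real.norm_of_nonneg (sq_nonneg _)]
    exact pow_le_pow_left₀ (by linarith) (by linarith) 2
  · filter_upwards [hq.ae_sub_pos] with x hx
    have h1 : P.w2 x - P.m ≠ 0 := (_root_.sub_pos.2 hx.1).ne'
    have h2 : Filter.Tendsto (fun b : ℝ => ((P.w2 x - P.m)⁻¹ - (P.w2 x - b)⁻¹) ^ 2) (nhds P.m)
        (nhds (((P.w2 x - P.m)⁻¹ - (P.w2 x - P.m)⁻¹) ^ 2)) := by
      have : ContinuousAt (fun b : ℝ => ((P.w2 x - P.m)⁻¹ - (P.w2 x - b)⁻¹) ^ 2) P.m :=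
        (continuousAt_const.sub ((continuousAt_const.sub continuousAt_id).inv₀ h1)).pow 2
      exact this
    rw [sub_self, zero_pow two_ne_zero] at h2
    exact h2.mono_left nhdsWithin_le_nhds

/-- $(w_2-b')^{-1}$ increases with $b'$, so comparison with the limit at $m$ gives a bound
independent of $b'$. -/
lemma QuadraticMin.integral_kern_sub_sq_le (hq : P.QuadraticMin p₀ c) {b b' : ℝ} (hb : b < P.m)
    (hb' : b' < P.m) (hbb : b ≤ b') :
    ∫ x, (kern hb' - kern hb) x ^ 2 ≤
      ‖P.v1‖ ^ 4 * ∫ x : T3 × T3, ((P.w2 x - P.m)⁻¹ - (P.w2 x - b)⁻¹) ^ 2 := by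
  rw [← integral_const_mul]
  have hi : Integrable fun x : T3 × T3 => ((P.w2 x - P.m)⁻¹ - (P.w2 x - b)⁻¹) ^ 2 := by
    refine hq.integrable_inv_sq.mono' ?_ ?_
    · have h1 := (by fun_prop : Continuous fun x => P.w2 x - P.m).measurable.inv
      have h2 := (by fun_prop : Continuous fun x => P.w2 x - b).measurable.inv
      exact ((h1.sub h2).pow_const 2).aestronglyMeasurable
    · filter_upwards [hq.ae_sub_pos] with x hx
      have h1 : 0 < P.w2 x - P.m := _root_.sub_pos.2 hx.1
      have h3 : (P.w2 x - b)⁻¹ ≤ (P.w2 x - P.m)⁻¹ := inv_anti₀ h1 (by linarith)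
      have h4 : 0 < (P.w2 x - b)⁻¹ := inv_pos.2 (by linarith)
      rw [Real.norm_of_nonneg (sq_nonneg _)]
      exact pow_le_pow_left₀ (by linarith) (by linarith) 2
  refine integral_mono_ae ((by fun_prop : Continuous fun x =>
    (kern hb' - kern hb) x ^ 2).integrable_of_hasCompactSupport
      (HasCompactSupport.of_compactSpace _)) (hi.const_mul _) ?_
  filter_upwards [hq.ae_sub_pos] with x hx
  have e : (kern hb' - kern hb) x ^ 2 =
      (P.v1 x.1 ^ 2 * P.v1 x.2 ^ 2) * ((P.w2 x - b')⁻¹ - (P.w2 x - b)⁻¹) ^ 2 := by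
    rw [ContinuousMap.sub_apply, kern_apply, kern_apply]
    ring
  have hv : ∀ s, P.v1 s ^ 2 ≤ ‖P.v1‖ ^ 2 := fun s =>
    sq_le_sq' (neg_le_of_abs_le (P.v1.norm_coe_le_norm s))
      ((le_abs_self _).trans (P.v1.norm_coe_le_norm s))
  have h3 : (P.w2 x - b)⁻¹ ≤ (P.w2 x - b')⁻¹ := inv_anti₀ (by linarith) (by linarith)
  have h4 : (P.w2 x - b')⁻¹ ≤ (P.w2 x - P.m)⁻¹ := inv_anti₀ (by linarith) (by linarith)
  rw [e]
  calc _ ≤ (‖P.v1‖ ^ 2 * ‖P.v1‖ ^ 2) * ((P.w2 x - P.m)⁻¹ - (P.w2 x - b)⁻¹) ^ 2 := by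
        exact mul_le_mul (mul_le_mul (hv _) (hv _) (sq_nonneg _) (sq_nonneg _))
          (pow_le_pow_left₀ (by linarith) (by linarith) 2) (sq_nonneg _) (by positivity)
    _ = _ := by ring

/-- If the determinant is positive at `m`, the Schur complements near `m` are nonnegative on a
common subspace of finite codimension. -/
lemma QuadraticMin.exists_schurL2_nonneg (hq : P.QuadraticMin p₀ c) {ε : ℝ}
    (hanti : ∀ p, AntitoneOn (P.det ε p) (Set.Iic P.m)) (hpos : ∀ p, 0 < P.det ε p P.m) :
    ∃ b₀ < P.m, ∃ (n : ℕ) (ℓ : Fin n → L2 T3 →L[ℂ] ℂ), ∀ b (hb : b < P.m), b₀ ≤ b →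
      ∀ f, (∀ i, ℓ i f = 0) → 0 ≤ RCLike.re (inner ℂ f (schurL2 ε hb f)) := by
  obtain ⟨q, -, hqmin⟩ := isCompact_univ.exists_isMinOn Set.univ_nonempty
    (hq.continuous_det ε le_rfl).continuousOn
  set a := P.det ε q P.m with ha
  have ha0 : 0 < a := hpos q
  -- This tolerance makes the kernels at $b\in[b_0,m)$ differ from the one at $b_0$ by at most $a$
  -- in Hilbert–Schmidt norm.
  have hlt : 0 < (a / (‖P.v1‖ ^ 2 + 1)) ^ 2 := by positivity
  obtain ⟨b₀, hb₀, hb₀m⟩ := ((hq.tendsto_integral_sub_sq.eventually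
    (eventually_lt_nhds hlt)).and self_mem_nhdsWithin).exists
  have hb₀m : b₀ < P.m := hb₀m
  set V := (volume : Measure T3).real Set.univ with hV
  have hV0 : 0 ≤ V := measureReal_nonneg
  obtain ⟨n, ℓ, hℓ⟩ := exists_kernel_net (kern hb₀m) (η := a / (V + 1)) (by positivity)
  refine ⟨b₀, hb₀m, n, ℓ, fun b hb hbb f hf => ?_⟩
  have h1 : ‖kernelForm (kern hb₀m) f‖ ≤ a * ‖f‖ ^ 2 := by
    refine (norm_kernelForm_le_of_forall _ f (hℓ f hf)).trans ?_
    have h2 := sq_integral_norm_le f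
    rw [mul_assoc, ← sq, div_mul_eq_mul_div, div_le_iff₀ (by positivity)]
    have h3 : (∫ p, ‖f p‖) ^ 2 ≤ ‖f‖ ^ 2 * (V + 1) := by nlinarith [sq_nonneg ‖f‖]
    calc _ ≤ a * (‖f‖ ^ 2 * (V + 1)) := by gcongr
      _ = _ := by ring
  have h2 : ‖kernelForm (kern hb - kern hb₀m) f‖ ≤ a * ‖f‖ ^ 2 := by
    refine (norm_kernelForm_le _ f).trans ?_
    gcongr
    refine Real.sqrt_le_iff.2 ⟨ha0.le, (hq.integral_kern_sub_sq_le hb₀m hb hbb).trans ?_⟩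
    calc _ ≤ ‖P.v1‖ ^ 4 * (a / (‖P.v1‖ ^ 2 + 1)) ^ 2 := by gcongr
      _ = (‖P.v1‖ ^ 2 / (‖P.v1‖ ^ 2 + 1)) ^ 2 * a ^ 2 := by ring
      _ ≤ 1 * a ^ 2 := by
        gcongr
        refine pow_le_one₀ (by positivity) ?_
        rw [div_le_one (by positivity)]
        linarith
      _ = a ^ 2 := one_mul _
  -- One $a\|f\|^2$ from the net at $b_0$ and one from the difference of kernels; the factor
  -- $\frac12$ in the form then leaves exactly $a\|f\|^2$.
  have h3 : ‖kernelForm (kern hb) f‖ ≤ 2 * (a * ‖f‖ ^ 2) := by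
    rw [kernelForm_sub] at h2
    have := norm_sub_norm_le (kernelForm (kern hb) f) (kernelForm (kern hb₀m) f)
    linarith
  have h4 : a * ‖f‖ ^ 2 ≤ ∫ p, P.det ε p b * ‖f p‖ ^ 2 := by
    rw [norm_sq_eq_integral, ← integral_const_mul]
    refine integral_mono ((integrable_norm_sq f).const_mul _)
      (integrable_mul_norm_sq (⟨fun p => P.det ε p b, hq.continuous_det ε hb.le⟩ : C(T3, ℝ)) f)
      fun p => ?_
    have h5 : a ≤ P.det ε p b :=
      (show a ≤ P.det ε p P.m from hqmin (Set.mem_univ p)).trans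
        (hanti p hb.le Set.self_mem_Iic hb.le)
    simp only
    gcongr
  rw [hq.re_inner_schurL2]
  have h5 := (Complex.re_le_norm (kernelForm (kern hb) f)).trans h3
  linarith

end Model

/-! ### Finiteness of the generalized eigenvalues below $m$. -/

lemma finite_of_card_le {T : Set ℝ} {n : ℕ} (h : ∀ s : Finset ℝ, (s : Set ℝ) ⊆ T → s.card ≤ n) :
    T.Finite := by
  by_contra hT
  obtain ⟨s, hs, hc⟩ := Set.Infinite.exists_subset_card_eq hT (n + 1)
  have := h s hs
  omega

lemma inner_cut2 (u u' : Cut2) :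
    inner ℂ u u' = inner ℂ u.fst u'.fst + inner ℂ u.snd u'.snd :=
  WithLp.prod_inner_apply u u'

namespace Model

/-- The block of `H` acting on `ℂ ⊕ L₂(𝕋³)`. -/
noncomputable def upper (P : Model) : Cut2 →ₗ[ℂ] Cut2 where
  toFun u := WithLp.toLp 2
    ((P.w0 : ℂ) * u.fst + intOp P.v0 u.snd, u.fst • vec P.v0 + mulOp P.w1 u.snd)
  map_add' u u' := by
    simp only [WithLp.add_fst, WithLp.add_snd, map_add, mul_add, add_smul, ← WithLp.toLp_add,
      Prod.mk_add_mk]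
    congr 2 <;> abel
  map_smul' c u := by
    simp only [WithLp.smul_fst, WithLp.smul_snd, map_smul, RingHom.id_apply, ← WithLp.toLp_smul,
      Prod.smul_mk, smul_add, smul_eq_mul, mul_smul]
    congr 2
    ring

/-- The coupling `ℂ ⊕ L₂(𝕋³) → L₂ˢ`. -/
noncomputable def coupling (P : Model) : Cut2 →ₗ[ℂ] L2Sym :=
  ((symTensor P.v1) ∘L WithLp.sndL 2 ℂ ℂ (L2 T3) : Cut2 →L[ℂ] L2Sym)

/-- The adjoint coupling `L₂ˢ → ℂ ⊕ L₂(𝕋³)`. -/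
noncomputable def couplingAdj (P : Model) : L2Sym →ₗ[ℂ] Cut2 where
  toFun h := WithLp.toLp 2 (0, P.H12 h)
  map_add' h h' := by rw [map_add, ← WithLp.toLp_add, Prod.mk_add_mk, add_zero]
  map_smul' c h := by
    rw [map_smul, RingHom.id_apply, ← WithLp.toLp_smul, Prod.smul_mk, smul_zero]

variable {P : Model}

lemma upper_apply (u : Cut2) : P.upper u = WithLp.toLp 2
    ((P.w0 : ℂ) * u.fst + intOp P.v0 u.snd, u.fst • vec P.v0 + mulOp P.w1 u.snd) := rfl

lemma coupling_apply (u : Cut2) : P.coupling u = symTensor P.v1 u.snd := rfl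

lemma couplingAdj_apply (h : L2Sym) : P.couplingAdj h = WithLp.toLp 2 (0, P.H12 h) := rfl

lemma upper_isSymmetric : P.upper.IsSymmetric := by
  intro u u'
  have h1 : inner ℂ (intOp P.v0 u.snd) u'.fst = inner ℂ u.snd (u'.fst • vec P.v0) := by
    rw [← inner_conj_symm, ← inner_intOp, inner_conj_symm]
  rw [upper_apply, upper_apply, inner_cut2, inner_cut2]
  simp only [WithLp.toLp_fst, WithLp.toLp_snd]
  simp only [inner_add_left, inner_add_right]
  rw [h1, inner_intOp, inner_mulOp_left]
  simp only [RCLike.inner_apply, map_mul, Complex.conj_ofReal]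
  ring

lemma inner_coupling (u : Cut2) (h : L2Sym) :
    inner ℂ (P.coupling u) h = inner ℂ u (P.couplingAdj h) := by
  rw [coupling_apply, couplingAdj_apply, inner_cut2, inner_symTensor]
  simp [H12]

variable (P) in
/-- Generalized eigenvalues of the block operator with weight `(ε, 1)`. -/
def IsEigen (ε z : ℝ) : Prop :=
  IsBlockEigenvalue P.upper P.coupling P.couplingAdj (P.mulW2 : L2Sym →ₗ[ℂ] L2Sym) ε z

/-- The scalar component costs one more linear condition, whence the $n+1$ in the counts that
follow. -/
lemma inner_schur_of_fst_eq_zero (ε : ℝ) {b : ℝ} (hb : b < P.m) {u : Cut2} (hu : u.fst = 0) :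
    inner ℂ u (schur P.upper P.coupling P.couplingAdj (res hb : L2Sym →ₗ[ℂ] L2Sym) ε b u) =
      inner ℂ u.snd (schurL2 ε hb u.snd) := by
  rw [inner_cut2, hu, inner_zero_left, zero_add]
  congr 1
  simp only [schur, LinearMap.sub_apply, LinearMap.smul_apply, LinearMap.id_apply,
    LinearMap.comp_apply, upper_apply, coupling_apply, couplingAdj_apply, WithLp.sub_snd,
    WithLp.smul_snd, hu, zero_smul, zero_add, schurL2]
  rfl

lemma card_le_of_lt {ε b : ℝ} (hb : b < P.m) {n : ℕ} (ℓ : Fin n → L2 T3 →L[ℂ] ℂ)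
    (h : ∀ f, (∀ i, ℓ i f = 0) → 0 ≤ RCLike.re (inner ℂ f (schurL2 ε hb f))) (s : Finset ℝ)
    (hs : ∀ z ∈ s, P.IsEigen ε z) (hsb : ∀ z ∈ s, z < b) : s.card ≤ n + 1 := by
  refine card_le_of_schur_sign (a := b) (R := (res hb : L2Sym →ₗ[ℂ] L2Sym)) upper_isSymmetric
    inner_coupling mulW2_isSymmetric (res_mulW2_sub hb) (mulW2_res_sub hb)
    (Fin.cons (WithLp.fstL 2 ℂ ℂ (L2 T3) : Cut2 →ₗ[ℂ] ℂ)
      fun i => (ℓ i ∘L WithLp.sndL 2 ℂ ℂ (L2 T3) : Cut2 →ₗ[ℂ] ℂ)) s hs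
    (Or.inl ⟨hsb, re_inner_res_nonneg hb, fun u hu => ?_⟩)
  rw [inner_schur_of_fst_eq_zero ε hb (by simpa using hu 0)]
  exact h _ fun i => by simpa using hu i.succ

lemma card_le_of_gt {ε b : ℝ} (hε : 0 ≤ ε) (hb : b < P.m) {n : ℕ} (ℓ : Fin n → L2 T3 →L[ℂ] ℂ)
    (h : ∀ f, (∀ i, ℓ i f = 0) → RCLike.re (inner ℂ f (schurL2 ε hb f)) ≤ 0) (s : Finset ℝ)
    (hs : ∀ z ∈ s, P.IsEigen ε z) (hsb : ∀ z ∈ s, b < z ∧ z < P.m) : s.card ≤ n + 1 := by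
  refine card_le_of_schur_sign (a := b) (R := (res hb : L2Sym →ₗ[ℂ] L2Sym)) upper_isSymmetric
    inner_coupling mulW2_isSymmetric (res_mulW2_sub hb) (mulW2_res_sub hb)
    (Fin.cons (WithLp.fstL 2 ℂ ℂ (L2 T3) : Cut2 →ₗ[ℂ] ℂ)
      fun i => (ℓ i ∘L WithLp.sndL 2 ℂ ℂ (L2 T3) : Cut2 →ₗ[ℂ] ℂ)) s hs
    (Or.inr ⟨P.m, hε, hsb, re_inner_res_le hb, fun u hu => ?_⟩)
  rw [inner_schur_of_fst_eq_zero ε hb (by simpa using hu 0)]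
  exact h _ fun i => by simpa using hu i.succ

variable {p₀ : T3} {c : ℝ}

lemma QuadraticMin.finite_eigen_lt (hq : P.QuadraticMin p₀ c) {ε E : ℝ} (hE : E < P.m)
    (hz : ZeroOrder fun p => P.det ε p E) (hs : ∀ p, 0 ≤ P.det ε p E) :
    {z | P.IsEigen ε z ∧ z < E}.Finite := by
  obtain ⟨n, ℓ, h⟩ := hq.exists_schurL2_sign (τ := 1) hE (by simp) hz (by simpa using hs)
  exact finite_of_card_le fun s hsT =>
    card_le_of_lt hE ℓ (by simpa using h) s (fun z hz => (hsT hz).1) fun z hz => (hsT hz).2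

lemma QuadraticMin.finite_eigen_gt (hq : P.QuadraticMin p₀ c) {ε E : ℝ} (hε : 0 ≤ ε)
    (hE : E < P.m) (hz : ZeroOrder fun p => P.det ε p E) (hs : ∀ p, P.det ε p E ≤ 0) :
    {z | P.IsEigen ε z ∧ E < z ∧ z < P.m}.Finite := by
  obtain ⟨n, ℓ, h⟩ := hq.exists_schurL2_sign (τ := -1) hE (by simp) hz (by simpa using hs)
  exact finite_of_card_le fun s hsT =>
    card_le_of_gt hε hE ℓ (by simpa using h) s (fun z hz => (hsT hz).1) fun z hz => (hsT hz).2

/-- The codimension does not depend on $b$, so for any finite set of eigenvalues $b$ may be placed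
between its maximum and $m$ without changing the bound. -/
lemma QuadraticMin.finite_eigen_lt_m (hq : P.QuadraticMin p₀ c) {ε : ℝ}
    (hanti : ∀ p, AntitoneOn (P.det ε p) (Set.Iic P.m)) (hpos : ∀ p, 0 < P.det ε p P.m) :
    {z | P.IsEigen ε z ∧ z < P.m}.Finite := by
  obtain ⟨b₀, hb₀, n, ℓ, h⟩ := hq.exists_schurL2_nonneg hanti hpos
  refine finite_of_card_le (n := n + 1) fun s hsT => ?_
  -- Including $b_0$ ensures $b\ge b_0$ and covers empty $s$.
  have hne : (insert b₀ s).Nonempty := Finset.insert_nonempty _ _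
  have hlt : (insert b₀ s).max' hne < P.m := by
    rw [Finset.max'_lt_iff]
    intro y hy
    rcases Finset.mem_insert.1 hy with rfl | hy
    · exact hb₀
    · exact (hsT hy).2
  obtain ⟨b, hb1, hb2⟩ := exists_between hlt
  refine card_le_of_lt hb2 ℓ (h b hb2 ?_) s (fun z hz => (hsT hz).1) fun z hz => ?_
  · exact ((Finset.le_max' _ _ (Finset.mem_insert_self _ _)).trans_lt hb1).le
  · exact (Finset.le_max' _ _ (Finset.mem_insert_of_mem hz)).trans_lt hb1

/-- In each of the three regimes only finitely many generalized eigenvalues below `m` have a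
neighbourhood containing a point where the determinant does not vanish. -/
lemma QuadraticMin.finite_eigen (hq : P.QuadraticMin p₀ c) {ε : ℝ} (hε : 0 ≤ ε)
    (hanti : ∀ p, StrictAntiOn (P.det ε p) (Set.Iic P.m))
    (hpos : ∃ z₀ < P.m, ∀ p, ∀ z ≤ z₀, 0 < P.det ε p z) {σ : Set ℝ}
    (hσ : ∀ z ∈ σ, z ≤ P.m → ∃ p, P.det ε p z = 0)
    (hσ' : ∀ z < P.m, ∀ p, P.det ε p z = 0 → z ∈ σ) (hreg : Regime (P.det ε) σ P.m)
    {T : Set ℝ} (hT : ∀ z ∈ T, P.IsEigen ε z ∧ z < P.m)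
    (hiso : ∀ z ∈ T, ∀ a b, a < z → z < b → ∃ y, a < y ∧ y < b ∧ ∀ p, P.det ε p y ≠ 0) :
    T.Finite := by
  rcases hreg.cases (hq.continuousOn_det ε) hanti hpos hσ hσ' with
    h | ⟨E, hE, hz, hs, hgap⟩ | ⟨E, hE, E', hE', hz, hs, hz', hs', hgap⟩
  · exact (hq.finite_eigen_lt_m (fun p => (hanti p).antitoneOn) h).subset hT
  · refine ((hq.finite_eigen_lt hE hz hs).union (Set.finite_singleton E)).subset fun z hzT => ?_
    rcases lt_trichotomy z E with h | h | h
    · exact Or.inl ⟨(hT z hzT).1, h⟩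
    · exact Or.inr h
    · obtain ⟨y, hy1, hy2, hy⟩ := hiso z hzT E P.m h (hT z hzT).2
      obtain ⟨p, hp⟩ := hgap y hy1 hy2
      exact absurd hp (hy p)
  · refine (((hq.finite_eigen_lt hE hz hs).union (hq.finite_eigen_gt hε hE' hz' hs')).union
      (Set.toFinite {E, E'})).subset fun z hzT => ?_
    rcases lt_trichotomy z E with h | h | h
    · exact Or.inl (Or.inl ⟨(hT z hzT).1, h⟩)
    · exact Or.inr (Or.inl h)
    · rcases lt_trichotomy z E' with h' | h' | h'
      · obtain ⟨y, hy1, hy2, hy⟩ := hiso z hzT E E' h h'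
        obtain ⟨p, hp⟩ := hgap y hy1 hy2
        exact absurd hp (hy p)
      · exact Or.inr (Or.inr h')
      · exact Or.inl (Or.inr ⟨(hT z hzT).1, h', (hT z hzT).2⟩)

end Model

/-! ### Discrete spectra of $h_1(p)$, $h_2(p)$ as zeros of the determinants. -/

/-- Self-adjointness makes the spectrum real, and bijectivity removes every real $y<m$ other than
$z$; so $z$ is isolated with radius $m-z$. -/
lemma mem_discSpec_of_simple {E : Type} [NormedAddCommGroup E] [InnerProductSpace ℂ E]
    [CompleteSpace E] {T : E →L[ℂ] E} (hT : (T : E →ₗ[ℂ] E).IsSymmetric) {z m : ℝ} (hz : z < m)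
    {e : E} (he : e ≠ 0) (hTe : T e = (z : ℂ) • e)
    (hspan : ∀ u, T u = (z : ℂ) • u → u ∈ Submodule.span ℂ {e})
    (hbij : ∀ y < m, y ≠ z → ∀ g, ∃! u, T u - (y : ℂ) • u = g) : z ∈ discSpec T := by
  refine ⟨End.hasEigenvalue_of_hasEigenvector ⟨End.mem_eigenspace_iff.2 hTe, he⟩, ?_,
    m - z, sub_pos.2 hz, fun μ hμ hne => ?_⟩
  · refine Submodule.finiteDimensional_of_le (S₂ := Submodule.span ℂ {e}) fun u hu => ?_
    exact hspan u (End.mem_eigenspace_iff.1 hu)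
  · have hsa : IsSelfAdjoint T := by
      rw [ContinuousLinearMap.isSelfAdjoint_iff_isSymmetric]
      exact hT
    have hre := hsa.mem_spectrum_eq_re hμ
    have hm : m ≤ μ.re := by
      by_contra! hlt
      have hb := hbij μ.re hlt (by rintro h; exact hne (by rw [hre, h]))
      apply hμ
      have hu : IsUnit (T - (algebraMap ℂ (E →L[ℂ] E)) μ) := by
        rw [ContinuousLinearMap.isUnit_iff_bijective]
        have happ : ∀ u, (T - (algebraMap ℂ (E →L[ℂ] E)) μ) u = T u - (μ.re : ℂ) • u := by
          intro u
          rw [← hre]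
          rfl
        refine (Function.bijective_iff_existsUnique _).2 fun g => ?_
        simp only [happ]
        exact hb g
      have := hu.neg
      rwa [neg_sub] at this
    have h1 : m - z ≤ (μ - z).re := by
      rw [Complex.sub_re, Complex.ofReal_re]
      linarith
    exact h1.trans (Complex.re_le_norm _)

namespace Model

variable {P : Model} {p : T3}

lemma h1_apply (u : Cut2) : P.h1 p u = WithLp.toLp 2
    ((P.w1 p : ℂ) * u.fst + ((1 / √2 : ℝ) : ℂ) * intOp P.v1 u.snd,
      ((1 / √2 : ℝ) : ℂ) • u.fst • vec P.v1 + mulOp (P.w2At p) u.snd) := by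
  have h : ContinuousLinearMap.adjoint P.h01 u.fst = ((1 / √2 : ℝ) : ℂ) • u.fst • vec P.v1 := by
    rw [h01, map_smulₛₗ, FunLike.coe_smul, Pi.smul_apply, adjoint_intOp, Complex.conj_ofReal]
  rw [← h]
  rfl

lemma h2_apply (f : L2 T3) :
    P.h2 p f = mulOp (P.w2At p) f - intOp P.v2 f • vec P.v2 := rfl

lemma half_eq : ((1 / √2 : ℝ) : ℂ) * ((1 / √2 : ℝ) : ℂ) = 1 / 2 := by
  rw [← Complex.ofReal_mul]
  have : (1 / √2 * (1 / √2) : ℝ) = 1 / 2 := by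
    rw [div_mul_div_comm, Real.mul_self_sqrt (by norm_num)]
    norm_num
  rw [this]
  push_cast
  rfl

lemma h1_isSymmetric : (P.h1 p : Cut2 →ₗ[ℂ] Cut2).IsSymmetric := by
  intro u u'
  have h1 : inner ℂ (intOp P.v1 u.snd) u'.fst = inner ℂ u.snd (u'.fst • vec P.v1) := by
    rw [← inner_conj_symm, ← inner_intOp, inner_conj_symm]
  change inner ℂ (P.h1 p u) u' = inner ℂ u (P.h1 p u')
  rw [h1_apply, h1_apply, inner_cut2, inner_cut2]
  simp only [WithLp.toLp_fst, WithLp.toLp_snd]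
  simp only [inner_add_left, inner_add_right]
  rw [inner_smul_left, inner_smul_right, ← h1, inner_intOp, inner_mulOp_left]
  simp only [RCLike.inner_apply, map_mul, Complex.conj_ofReal]
  ring

lemma h2_isSymmetric : (P.h2 p : L2 T3 →ₗ[ℂ] L2 T3).IsSymmetric := by
  intro f g
  change inner ℂ (P.h2 p f) g = inner ℂ f (P.h2 p g)
  have h : inner ℂ f (intOp P.v2 g • vec P.v2) = inner ℂ (intOp P.v2 f) (intOp P.v2 g) := by
    rw [← inner_conj_symm, inner_intOp, inner_conj_symm]
  rw [h2_apply, h2_apply, inner_sub_left, inner_sub_right, inner_mulOp_left, inner_intOp, h]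

section Resolvent

variable (p) {z : ℝ} (hz : z < P.m)

include hz in
lemma w2At_gt (s : T3) : z < P.w2At p s := lt_w2 hz (p, s)

/-- The resolvent of multiplication by `w₂(p, ·)`. -/
noncomputable def resAt : L2 T3 →L[ℂ] L2 T3 :=
  mulOp (shiftInv (P.w2At p) z (w2At_gt p hz))

lemma resAt_sub (f : L2 T3) : resAt p hz (mulOp (P.w2At p) f - (z : ℂ) • f) = f :=
  mulOp_shiftInv_sub _ _ _ f

lemma sub_resAt (f : L2 T3) :
    mulOp (P.w2At p) (resAt p hz f) - (z : ℂ) • resAt p hz f = f :=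
  mulOp_sub_shiftInv _ _ _ f

lemma sub_eq_iff (f g : L2 T3) :
    mulOp (P.w2At p) f - (z : ℂ) • f = g ↔ f = resAt p hz g := by
  constructor
  · rintro rfl
    rw [resAt_sub]
  · rintro rfl
    rw [sub_resAt]

lemma intOp_resAt_vec (v : C(T3, ℝ)) :
    intOp v (resAt p hz (vec v)) = ((∫ s, v s ^ 2 / (P.w2 (p, s) - z) : ℝ) : ℂ) := by
  rw [← integral_complex_ofReal]
  change ∫ s, (v s : ℂ) * resAt p hz (vec v) s = _
  refine integral_congr_ae ?_
  filter_upwards [mulOp_coeFn (shiftInv (P.w2At p) z (w2At_gt p hz)) (vec v),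
    vec_coeFn v] with s h1 h2
  rw [resAt, h1, h2]
  change (v s : ℂ) * (((P.w2 (p, s) - z)⁻¹ : ℝ) * (v s : ℂ)) = _
  push_cast
  ring

end Resolvent

lemma intOp_eq_of_ae (v : C(T3, ℝ)) {f : L2 T3} {a : ℂ} {z : ℝ}
    (hf : ∀ᵐ s, f s = a * v s / (P.w2 (p, s) - z)) :
    intOp v f = a * ((∫ s, v s ^ 2 / (P.w2 (p, s) - z) : ℝ) : ℂ) := by
  rw [← integral_complex_ofReal, ← integral_const_mul]
  change ∫ s, (v s : ℂ) * f s = _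
  refine integral_congr_ae ?_
  filter_upwards [hf] with s hs
  rw [hs]
  push_cast
  ring

variable {p₀ : T3} {c : ℝ}

/-- At $z=m$ the multiplication operator may lack a bounded inverse; the division is therefore
carried out pointwise, off the null set $\{p_0\}$. -/
lemma QuadraticMin.ae_eq_div (hq : P.QuadraticMin p₀ c) {z : ℝ} (hz : z ≤ P.m) {v : C(T3, ℝ)}
    {f : L2 T3} {a : ℂ} (hf : mulOp (P.w2At p) f = (z : ℂ) • f + a • vec v) :
    ∀ᵐ s, f s = a * v s / (P.w2 (p, s) - z) := by
  have h1 := mulOp_coeFn (P.w2At p) f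
  rw [hf] at h1
  filter_upwards [h1, Lp.coeFn_add ((z : ℂ) • f) (a • vec v), Lp.coeFn_smul (z : ℂ) f,
    Lp.coeFn_smul a (vec v), vec_coeFn v, ae_ne p₀] with s e1 e2 e3 e4 e5 hs
  have hne : (P.w2 (p, s) : ℂ) - z ≠ 0 := by
    rw [← Complex.ofReal_sub]
    exact_mod_cast (hq.sub_pos p hs hz).ne'
  rw [e2, Pi.add_apply, e3, e4, Pi.smul_apply, Pi.smul_apply, e5, smul_eq_mul, smul_eq_mul] at e1
  rw [eq_div_iff hne]
  change (z : ℂ) * f s + a * v s = (P.w2 (p, s) : ℂ) * f s at e1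
  linear_combination -e1

lemma QuadraticMin.det_eq_zero_of_mem_discSpec_h1 (hq : P.QuadraticMin p₀ c) {z : ℝ}
    (hz : z ≤ P.m) (h : z ∈ discSpec (P.h1 p)) : P.Δ₁ p z = 0 := by
  obtain ⟨u, hu, hu0⟩ := h.1.exists_hasEigenvector
  have he : P.h1 p u = (z : ℂ) • u := End.mem_eigenspace_iff.1 hu
  rw [h1_apply] at he
  have e1 := congrArg WithLp.fst he
  have e2 := congrArg WithLp.snd he
  simp only [WithLp.toLp_fst, WithLp.toLp_snd, WithLp.smul_fst, WithLp.smul_snd,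
    smul_eq_mul] at e1 e2
  set k : ℂ := ((1 / √2 : ℝ) : ℂ) with hk
  have hf := hq.ae_eq_div (p := p) (v := P.v1) (f := u.snd) (a := -(k * u.fst)) hz (by
    rw [← e2, smul_smul, neg_smul]
    abel)
  have h3 := intOp_eq_of_ae P.v1 hf
  rw [h3] at e1
  have hne : u.fst ≠ 0 := by
    intro h0
    apply hu0
    have hs : u.snd = 0 := by
      apply Lp.ext
      filter_upwards [hf, Lp.coeFn_zero ℂ 2 (volume : Measure T3)] with s h1 h2
      rw [h1, h2, h0]
      simp
    exact WithLp.ofLp_injective 2 (Prod.ext h0 hs)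
  have h4 : ((P.Δ₁ p z : ℝ) : ℂ) * u.fst = 0 := by
    rw [Δ₁]
    push_cast at e1 ⊢
    linear_combination e1 + (u.fst * ((∫ s, P.v1 s ^ 2 / (P.w2 (p, s) - z) : ℝ) : ℂ)) * half_eq
  exact_mod_cast (mul_eq_zero.1 h4).resolve_right hne

lemma QuadraticMin.det_eq_zero_of_mem_discSpec_h2 (hq : P.QuadraticMin p₀ c) {z : ℝ}
    (hz : z ≤ P.m) (h : z ∈ discSpec (P.h2 p)) : P.Δ₂ p z = 0 := by
  obtain ⟨f, hf, hf0⟩ := h.1.exists_hasEigenvector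
  have he : P.h2 p f = (z : ℂ) • f := End.mem_eigenspace_iff.1 hf
  rw [h2_apply, sub_eq_iff_eq_add] at he
  have hf := hq.ae_eq_div hz he
  have h3 := intOp_eq_of_ae P.v2 hf
  have hne : intOp P.v2 f ≠ 0 := by
    intro h0
    apply hf0
    apply Lp.ext
    filter_upwards [hf, Lp.coeFn_zero ℂ 2 (volume : Measure T3)] with s h1 h2
    rw [h1, h2, h0]
    simp
  have h4 : ((P.Δ₂ p z : ℝ) : ℂ) * intOp P.v2 f = 0 := by
    rw [Δ₂]
    push_cast at h3 ⊢
    linear_combination h3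
  exact_mod_cast (mul_eq_zero.1 h4).resolve_right hne

/-- Eliminating the function component leaves a scalar equation with coefficient $\Delta_1$, the
factor $\frac12$ coming from $(1/\sqrt2)^2$. -/
lemma h1_sub_eq_iff {z : ℝ} (hz : z < P.m) (u g : Cut2) :
    P.h1 p u - (z : ℂ) • u = g ↔
      (P.Δ₁ p z : ℂ) * u.fst = g.fst - ((1 / √2 : ℝ) : ℂ) * intOp P.v1 (resAt p hz g.snd) ∧
      u.snd = resAt p hz g.snd - (((1 / √2 : ℝ) : ℂ) * u.fst) • resAt p hz (vec P.v1) := by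
  set k : ℂ := ((1 / √2 : ℝ) : ℂ) with hk
  have h0 : P.h1 p u - (z : ℂ) • u = g ↔
      (P.w1 p : ℂ) * u.fst + k * intOp P.v1 u.snd - z * u.fst = g.fst ∧
      mulOp (P.w2At p) u.snd - (z : ℂ) • u.snd = g.snd - (k * u.fst) • vec P.v1 := by
    rw [h1_apply, ← (WithLp.ofLp_injective 2).eq_iff, Prod.ext_iff]
    refine and_congr Iff.rfl ?_
    change k • u.fst • vec P.v1 + mulOp (P.w2At p) u.snd - (z : ℂ) • u.snd = g.snd ↔ _
    rw [eq_sub_iff_add_eq, smul_smul]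
    constructor <;> intro h <;> rw [← h] <;> abel
  rw [h0, sub_eq_iff p hz, map_sub, map_smul]
  refine and_congr_left fun h => ?_
  have h2 : intOp P.v1 u.snd = intOp P.v1 (resAt p hz g.snd) -
      k * u.fst * ((∫ s, P.v1 s ^ 2 / (P.w2 (p, s) - z) : ℝ) : ℂ) := by
    rw [h, map_sub, map_smul, intOp_resAt_vec, smul_eq_mul]
  rw [h2, Δ₁]
  set J : ℝ := ∫ s, P.v1 s ^ 2 / (P.w2 (p, s) - z)
  push_cast
  constructor
  · intro h3
    linear_combination h3 + u.fst * J * half_eq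
  · intro h3
    linear_combination h3 - u.fst * J * half_eq

lemma QuadraticMin.mem_discSpec_h1 (hq : P.QuadraticMin p₀ c) {z : ℝ} (hz : z < P.m)
    (h : P.Δ₁ p z = 0) : z ∈ discSpec (P.h1 p) := by
  set k : ℂ := ((1 / √2 : ℝ) : ℂ) with hk
  refine mem_discSpec_of_simple (e := WithLp.toLp 2 (1, -k • resAt p hz (vec P.v1)))
    h1_isSymmetric hz (fun h0 => one_ne_zero (congrArg WithLp.fst h0)) ?_ (fun u hu => ?_)
    fun y hy hyz g => ?_
  · rw [← sub_eq_zero, h1_sub_eq_iff hz]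
    simp [h, hk]
  · rw [← sub_eq_zero, h1_sub_eq_iff hz] at hu
    refine Submodule.mem_span_singleton.2 ⟨u.fst, ?_⟩
    refine WithLp.ofLp_injective 2 (Prod.ext ?_ ?_)
    · change u.fst * 1 = u.fst
      ring
    · change u.fst • -k • resAt p hz (vec P.v1) = u.snd
      rw [hu.2]
      simp only [WithLp.zero_snd, map_zero, zero_sub, smul_smul, ← neg_smul]
      congr 1
      ring
  · have hne : (P.Δ₁ p y : ℂ) ≠ 0 := by
      intro h0
      have h0 : P.Δ₁ p y = 0 := by exact_mod_cast h0
      rw [Δ₁_eq_det] at h h0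
      -- Strict monotonicity: the determinant at $p$ has no second root up to $m$.
      exact hyz ((hq.strictAntiOn_det (Or.inl one_pos) p).injOn hy.le hz.le (h0.trans h.symm))
    simp only [h1_sub_eq_iff hy]
    set a := (g.fst - k * intOp P.v1 (resAt p hy g.snd)) / (P.Δ₁ p y : ℂ) with ha
    refine ⟨WithLp.toLp 2 (a, resAt p hy g.snd - (k * a) • resAt p hy (vec P.v1)), ⟨?_, rfl⟩, ?_⟩
    · change (P.Δ₁ p y : ℂ) * a = _
      rw [ha, mul_div_cancel₀ _ hne]
    · rintro u ⟨hu1, hu2⟩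
      have hua : u.fst = a := by rw [ha, eq_div_iff hne, mul_comm, hu1]
      refine WithLp.ofLp_injective 2 (Prod.ext hua ?_)
      change u.snd = _
      rw [hu2, hua]

/-- A rank-one perturbation: the only unknown after inverting $w_2(p,\cdot)-z$ is the number $\int
v_2f$, and its coefficient is $\Delta_2$. -/
lemma h2_sub_eq_iff {z : ℝ} (hz : z < P.m) (f g : L2 T3) :
    P.h2 p f - (z : ℂ) • f = g ↔
      (P.Δ₂ p z : ℂ) * intOp P.v2 f = intOp P.v2 (resAt p hz g) ∧
      f = resAt p hz g + intOp P.v2 f • resAt p hz (vec P.v2) := by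
  have h0 : P.h2 p f - (z : ℂ) • f = g ↔
      mulOp (P.w2At p) f - (z : ℂ) • f = g + intOp P.v2 f • vec P.v2 := by
    rw [h2_apply, ← sub_eq_iff_eq_add, sub_right_comm]
  rw [h0, sub_eq_iff p hz, map_add, map_smul]
  refine ⟨fun h => ⟨?_, h⟩, fun h => h.2⟩
  have h2 := congrArg (intOp P.v2) h
  rw [map_add, map_smul, intOp_resAt_vec, smul_eq_mul] at h2
  rw [Δ₂]
  push_cast at h2 ⊢
  linear_combination h2

lemma mem_discSpec_h2 {z : ℝ} (hz : z < P.m)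
    (hinj : Set.InjOn (P.Δ₂ p) (Set.Iic P.m)) (h : P.Δ₂ p z = 0) : z ∈ discSpec (P.h2 p) := by
  have hJ : intOp P.v2 (resAt p hz (vec P.v2)) = 1 := by
    rw [intOp_resAt_vec]
    rw [Δ₂] at h
    exact_mod_cast (sub_eq_zero.1 h).symm
  refine mem_discSpec_of_simple (e := resAt p hz (vec P.v2)) h2_isSymmetric hz
    (fun h0 => by rw [h0, map_zero] at hJ; exact zero_ne_one hJ) ?_ (fun f hf => ?_)
    fun y hy hyz g => ?_
  · rw [← sub_eq_zero, h2_sub_eq_iff hz]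
    simp [h, hJ]
  · rw [← sub_eq_zero, h2_sub_eq_iff hz] at hf
    refine Submodule.mem_span_singleton.2 ⟨intOp P.v2 f, ?_⟩
    conv_rhs => rw [hf.2]
    simp
  · have hne : (P.Δ₂ p y : ℂ) ≠ 0 := by
      intro h0
      have h0 : P.Δ₂ p y = 0 := by exact_mod_cast h0
      exact hyz (hinj hy.le hz.le (h0.trans h.symm))
    simp only [h2_sub_eq_iff hy]
    set a := intOp P.v2 (resAt p hy g) / (P.Δ₂ p y : ℂ) with ha
    have hJy : intOp P.v2 (resAt p hy (vec P.v2)) = 1 - (P.Δ₂ p y : ℂ) := by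
      rw [intOp_resAt_vec, Δ₂]
      push_cast
      ring
    have hva : intOp P.v2 (resAt p hy g + a • resAt p hy (vec P.v2)) = a := by
      have h1 : a * (P.Δ₂ p y : ℂ) = intOp P.v2 (resAt p hy g) := div_mul_cancel₀ _ hne
      rw [map_add, map_smul, hJy, ← h1, smul_eq_mul]
      ring
    refine ⟨resAt p hy g + a • resAt p hy (vec P.v2), ⟨?_, ?_⟩, ?_⟩
    · rw [hva, ha, mul_div_cancel₀ _ hne]
    · rw [hva]
    · rintro f ⟨hf1, hf2⟩
      have hfa : intOp P.v2 f = a := by rw [ha, eq_div_iff hne, mul_comm, hf1]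
      rw [hf2, hfa]

end Model

/-! ### Consequences of (A1), and zeros of the determinants as spectrum of $H$. -/

lemma twoPiBar_eq_zero : twoPiBar = 0 :=
  funext fun _ => AddCircle.coe_period (2 * Real.pi)

/-- Periodicity is vacuous on the torus, so `v'` itself is an admissible test function. -/
lemma PeriodicAndOrthogonal.eq_zero {v v' : C(T3, ℝ)} (h : PeriodicAndOrthogonal v v') :
    v' = 0 := by
  have h0 := h.2 (fun s => (v' s : ℂ))
    ((memLp_congr_ae (vec_coeFn v')).1 (Lp.memLp (vec v')))
    (fun s => by rw [twoPiBar_eq_zero, add_zero])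
  have h1 : ∫ s, v' s ^ 2 = 0 := by
    have : ∫ s, (v' s : ℂ) * v' s = ((∫ s, v' s ^ 2 : ℝ) : ℂ) := by
      rw [← integral_complex_ofReal]
      refine integral_congr_ae (Filter.Eventually.of_forall fun s => ?_)
      simp only
      push_cast
      ring
    rw [this] at h0
    exact_mod_cast h0
  by_contra hv
  obtain ⟨a, ha⟩ : ∃ a, v' a ≠ 0 := by
    by_contra! h
    exact hv (ContinuousMap.ext h)
  exact (Continuous.integral_pos_of_hasCompactSupport_nonneg_nonzero
    (f := fun s => v' s ^ 2) (μ := (volume : Measure T3)) (by fun_prop)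
    (HasCompactSupport.of_compactSpace _) (fun s => sq_nonneg _) (pow_ne_zero 2 ha)).ne' h1

lemma exists_norm_le_of_notMem_spectrum {E : Type} [NormedAddCommGroup E] [NormedSpace ℂ E]
    {T : E →L[ℂ] E} {μ : ℂ} (h : μ ∉ spectrum ℂ T) :
    ∃ C ≥ 0, ∀ u, ‖u‖ ≤ C * ‖T u - μ • u‖ := by
  rw [spectrum.notMem_iff] at h
  obtain ⟨S, hS⟩ := h.exists_left_inv
  refine ⟨‖S‖, norm_nonneg _, fun u => ?_⟩
  have h1 : S (μ • u - T u) = u := by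
    have := congrArg (fun A : E →L[ℂ] E => A u) hS
    exact this
  calc ‖u‖ = ‖S (μ • u - T u)‖ := by rw [h1]
    _ ≤ ‖S‖ * ‖μ • u - T u‖ := S.le_opNorm _
    _ = _ := by rw [norm_sub_rev]

lemma tensorOp_smul (k : ℝ) (v : C(T3, ℝ)) (g : L2 T3) :
    tensorOp (k • v) g = (k : ℂ) • tensorOp v g := by
  apply Lp.ext
  filter_upwards [tensorOp_coeFn (k • v) g, tensorOp_coeFn v g,
    Lp.coeFn_smul (k : ℂ) (tensorOp v g)] with x h1 h2 h3
  rw [h1, h3, Pi.smul_apply, h2, ContinuousMap.smul_apply, smul_eq_mul, smul_eq_mul]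
  push_cast
  ring

lemma partialIntOp_smul (k : ℝ) (v : C(T3, ℝ)) (f : L2 (T3 × T3)) :
    partialIntOp (k • v) f = (k : ℂ) • partialIntOp v f := by
  apply Lp.ext
  filter_upwards [partialIntOp_coeFn (k • v) f, partialIntOp_coeFn v f,
    Lp.coeFn_smul (k : ℂ) (partialIntOp v f)] with x h1 h2 h3
  rw [h1, h3, Pi.smul_apply, h2, smul_eq_mul, ← integral_const_mul]
  refine integral_congr_ae (Filter.Eventually.of_forall fun s => ?_)
  simp only [ContinuousMap.smul_apply, smul_eq_mul]
  push_cast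
  ring

lemma symTensor_smul (k : ℝ) (v : C(T3, ℝ)) (g : L2 T3) :
    symTensor (k • v) g = (k : ℂ) • symTensor v g := by
  apply Subtype.ext
  rw [Submodule.coe_smul, coe_symTensor, coe_symTensor, tensorOp_smul, map_smul, ← smul_add,
    smul_comm]

lemma symTensor_zero (g : L2 T3) : symTensor 0 g = 0 := by
  have := symTensor_smul 0 0 g
  rw [zero_smul] at this
  rw [this, Complex.ofReal_zero, zero_smul]

lemma partialIntOp_zero (f : L2 (T3 × T3)) : partialIntOp 0 f = 0 := by
  have := partialIntOp_smul 0 0 f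
  rw [zero_smul] at this
  rw [this, Complex.ofReal_zero, zero_smul]

namespace Model

variable {P : Model}

/-- The function $f$ is the $L_2$-normalized indicator of a small neighbourhood of $p$ on which
$|\Delta|$ is small. Its $L_1$ norm is the square root of the measure of that set, so the kernel
part and the functional are small too. -/
lemma exists_approx_kernel {p₀ : T3} {c : ℝ} (hq : P.QuadraticMin p₀ c) {ε z : ℝ}
    (hz : z < P.m) {p : T3} (hp : P.det ε p z = 0) (v : C(T3, ℝ)) {η : ℝ} (hη : 0 < η) :
    ∃ f : L2 T3, ‖f‖ = 1 ∧ ‖schurL2 ε hz f‖ ≤ η ∧ ‖intOp v f‖ ≤ η := by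
  set V := (volume : Measure T3).real Set.univ with hV
  have hV0 : 0 ≤ V := measureReal_nonneg
  set K := ‖kern hz‖ with hK
  have hK0 : 0 ≤ K := norm_nonneg _
  -- Measure at most $\delta$ gives both $2K^2Va\le\eta^2/2$ for the kernel part and
  -- $\|v\|^2a\le\eta^2$ for the functional.
  set δ : ℝ := η ^ 2 / (4 * K ^ 2 * V + ‖v‖ ^ 2 + 1) with hδ
  have hδ0 : 0 < δ := by positivity
  have hcd := hq.continuous_det ε hz.le
  obtain ⟨U, hpU, hUo, hUδ⟩ := ({p} : Set T3).exists_isOpen_lt_of_lt (μ := volume)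
    (ENNReal.ofReal δ) (by rw [measure_singleton]; exact ENNReal.ofReal_pos.2 hδ0)
  set W : Set T3 := U ∩ {q | |P.det ε q z| < η / 2} with hW
  have hWo : IsOpen W := hUo.inter (isOpen_lt hcd.abs continuous_const)
  have hpW : p ∈ W := ⟨hpU rfl, by
    rw [Set.mem_ofPred_eq, hp, abs_zero]
    positivity⟩
  set a := (volume : Measure T3).real W with ha
  have ha0 : 0 < a := ENNReal.toReal_pos (hWo.measure_pos volume ⟨p, hpW⟩).ne' (measure_ne_top _ _)
  have haδ : a ≤ δ := by
    refine ENNReal.toReal_le_of_le_ofReal hδ0.le ?_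
    exact (measure_mono Set.inter_subset_left).trans hUδ.le
  set f : L2 T3 := indicatorConstLp 2 hWo.measurableSet (measure_ne_top volume W)
    (((√a)⁻¹ : ℝ) : ℂ) with hf
  have hsa : 0 < √a := Real.sqrt_pos.2 ha0
  have hfae : f =ᵐ[volume] W.indicator fun _ => (((√a)⁻¹ : ℝ) : ℂ) := indicatorConstLp_coeFn
  have hf1 : ‖f‖ = 1 := by
    rw [hf, norm_indicatorConstLp (by norm_num) (by norm_num), Complex.norm_real,
      Real.norm_of_nonneg (by positivity), ← ha]
    simp only [ENNReal.toReal_ofNat]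
    rw [← Real.sqrt_eq_rpow, inv_mul_cancel₀ hsa.ne']
  have hfint : ∫ s, ‖f s‖ = √a := by
    have : ∫ s, ‖f s‖ = ∫ s, W.indicator (fun _ => (√a)⁻¹) s := by
      refine integral_congr_ae ?_
      filter_upwards [hfae] with s hs
      rw [hs, norm_indicator_eq_indicator_norm]
      simp only [Complex.norm_real, Real.norm_of_nonneg (inv_nonneg.2 hsa.le)]
    rw [this, integral_indicator hWo.measurableSet, setIntegral_const, smul_eq_mul, ← ha]
    nth_rw 1 [← Real.mul_self_sqrt ha0.le]
    rw [mul_inv_cancel_right₀ hsa.ne']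
  have hden : 0 < 4 * K ^ 2 * V + ‖v‖ ^ 2 + 1 := by positivity
  have haη : (4 * K ^ 2 * V + ‖v‖ ^ 2 + 1) * a ≤ η ^ 2 := by
    rw [hδ, le_div_iff₀ hden] at haδ
    linarith
  refine ⟨f, hf1, ?_, ?_⟩
  · have hpt : ∀ᵐ q, ‖schurL2 ε hz f q‖ ^ 2 ≤ η ^ 2 / 2 * ‖f q‖ ^ 2 + 2 * K ^ 2 * a := by
      filter_upwards [schurL2_coeFn ε hz f, hfae] with q hq1 hq2
      have h1 : ‖(P.det ε q z : ℂ) * f q‖ ≤ η / 2 * ‖f q‖ := by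
        rw [norm_mul, Complex.norm_real, Real.norm_eq_abs]
        by_cases hqW : q ∈ W
        · have := hqW.2
          exact mul_le_mul_of_nonneg_right (le_of_lt this) (norm_nonneg _)
        · rw [hq2, Set.indicator_of_notMem hqW]
          simp
      have h2 : ‖(1 / 2 : ℂ) * ∫ s, (kern hz (q, s) : ℂ) * f s‖ ≤ K * √a := by
        have := norm_kernel_integral_le (kern hz) f q
        rw [hfint] at this
        rw [norm_mul]
        have h3 : ‖(1 / 2 : ℂ)‖ = 1 / 2 := by norm_num
        rw [h3]
        have := norm_nonneg (∫ s, (kern hz (q, s) : ℂ) * f s)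
        linarith
      have h3 : ‖schurL2 ε hz f q‖ ≤ η / 2 * ‖f q‖ + K * √a := by
        rw [hq1]
        exact (norm_sub_le _ _).trans (add_le_add h1 h2)
      have h4 : (√a) ^ 2 = a := Real.sq_sqrt ha0.le
      calc ‖schurL2 ε hz f q‖ ^ 2 ≤ (η / 2 * ‖f q‖ + K * √a) ^ 2 := by gcongr
        _ ≤ 2 * (η / 2 * ‖f q‖) ^ 2 + 2 * (K * √a) ^ 2 := by
          nlinarith [sq_nonneg (η / 2 * ‖f q‖ - K * √a)]
        _ = _ := by rw [mul_pow K, h4]; ring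
    have h5 : ‖schurL2 ε hz f‖ ^ 2 ≤ η ^ 2 := by
      rw [norm_sq_eq_integral]
      calc ∫ q, ‖schurL2 ε hz f q‖ ^ 2 ≤ ∫ q, (η ^ 2 / 2 * ‖f q‖ ^ 2 + 2 * K ^ 2 * a) :=
            integral_mono_ae (integrable_norm_sq _)
              (((integrable_norm_sq f).const_mul _).add (integrable_const _)) hpt
        _ = η ^ 2 / 2 + V * (2 * K ^ 2 * a) := by
            rw [integral_add ((integrable_norm_sq f).const_mul _) (integrable_const _),
              integral_const_mul, ← norm_sq_eq_integral, hf1, integral_const, smul_eq_mul]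
            ring
        _ ≤ η ^ 2 := by nlinarith [sq_nonneg ‖v‖]
    exact (pow_le_pow_iff_left₀ (norm_nonneg _) hη.le two_ne_zero).1 h5
  · have h1 : ‖intOp v f‖ ≤ ‖v‖ * √a := by
      rw [← hfint, ← integral_const_mul]
      exact norm_integral_le_of_norm_le ((integrable_of_L2 f).norm.const_mul _)
        (Filter.Eventually.of_forall fun s => mul_bound v f s)
    refine h1.trans ?_
    rw [← pow_le_pow_iff_left₀ (by positivity) hη.le two_ne_zero, mul_pow, Real.sq_sqrt ha0.le]
    have : 0 ≤ 4 * K ^ 2 * V * a := by positivity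
    nlinarith

lemma H_apply (u : Cut3) : P.H u = WithLp.toLp 2
    ((P.w0 : ℂ) * u.fst + intOp P.v0 u.snd.fst,
      WithLp.toLp 2 (u.fst • vec P.v0 + mulOp P.w1 u.snd.fst + P.H12 u.snd.snd,
        symTensor P.v1 u.snd.fst + P.H22 u.snd.snd)) := by
  rw [← adjoint_H12, ← adjoint_intOp]
  rfl

/-- The model whose generalized eigenvalues with weight `(0, 1)` are the eigenvalues of `H₂₂`. -/
noncomputable def factor (P : Model) : Model where
  w0 := 1
  w1 := 1
  w2 := P.w2
  v0 := 0
  v1 := √2 • P.v2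
  v2 := 0
  w2_symm := P.w2_symm

/-- The $\sqrt2$ in `factor` cancels the $\frac12$ of `det`. -/
lemma det_factor (P : Model) : P.factor.det 0 = P.Δ₂ := by
  ext p z
  have h : ∀ s, P.factor.v1 s ^ 2 / (P.factor.w2 (p, s) - z) =
      2 * (P.v2 s ^ 2 / (P.w2 (p, s) - z)) := fun s => by
    change (√2 * P.v2 s) ^ 2 / (P.w2 (p, s) - z) = _
    rw [mul_pow, Real.sq_sqrt (by norm_num)]
    ring
  simp only [det, h, integral_const_mul, Δ₂]
  change 1 - 0 * z - _ = _
  ring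

/-- On symmetric functions the potential is $BB^*$ with $B$ the symmetrized tensor product with
$\sqrt2\,v_2$; this is what makes $H_{22}$ a Schur-type problem. -/
lemma H22_apply (h : L2Sym) :
    P.H22 h = P.mulW2 h - symTensor P.factor.v1 (P.factor.H12 h) := by
  have h2 : ((√2 : ℝ) : ℂ) * ((√2 : ℝ) : ℂ) = 2 := by
    rw [← Complex.ofReal_mul, Real.mul_self_sqrt (by norm_num)]
    rfl
  have h1 : symTensor P.factor.v1 (P.factor.H12 h) =
      (2 : ℂ) • symTensor P.v2 (partialIntOp P.v2 h) := by
    change symTensor (√2 • P.v2) (partialIntOp (√2 • P.v2) h) = _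
    rw [symTensor_smul, partialIntOp_smul, map_smul, smul_smul, h2]
  rw [h1]
  apply Subtype.ext
  rw [Submodule.coe_sub, Submodule.coe_smul, coe_symTensor, smul_smul]
  change mulOp P.w2 h - (tensorOp P.v2 (partialIntOp P.v2 h) +
    swapOp (tensorOp P.v2 (partialIntOp P.v2 (swapOp h)))) = _
  rw [(mem_L2Sym _).1 h.2]
  have h3 : (2 : ℂ) * ((1 / 2 : ℝ) : ℂ) = 1 := by push_cast; norm_num
  rw [h3, one_smul]
  rfl

lemma H22_apply_of_v2_eq_zero (hv : P.v2 = 0) (h : L2Sym) : P.H22 h = P.mulW2 h := by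
  rw [H22_apply]
  have : P.factor.v1 = 0 := by
    change √2 • P.v2 = 0
    rw [hv, smul_zero]
  rw [this, symTensor_zero, sub_zero]

lemma H12_apply_of_v1_eq_zero (hv : P.v1 = 0) (h : L2Sym) : P.H12 h = 0 := by
  change partialIntOp P.v1 h = 0
  rw [hv, partialIntOp_zero]

lemma norm_cut3_le (u : Cut3) : ‖u‖ ≤ ‖u.fst‖ + ‖u.snd.fst‖ + ‖u.snd.snd‖ := by
  have h1 : ‖u‖ ^ 2 = ‖u.fst‖ ^ 2 + ‖u.snd‖ ^ 2 := WithLp.prod_norm_sq_eq_of_L2 u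
  have h2 : ‖u.snd‖ ^ 2 = ‖u.snd.fst‖ ^ 2 + ‖u.snd.snd‖ ^ 2 := WithLp.prod_norm_sq_eq_of_L2 u.snd
  refine (pow_le_pow_iff_left₀ (norm_nonneg _) (by positivity) two_ne_zero).1 ?_
  rw [h1, h2]
  have := norm_nonneg u.fst
  have := norm_nonneg u.snd.fst
  have := norm_nonneg u.snd.snd
  have : 0 ≤ ‖u.fst‖ * ‖u.snd.fst‖ := by positivity
  have : 0 ≤ ‖u.fst‖ * ‖u.snd.snd‖ := by positivity
  have : 0 ≤ ‖u.snd.fst‖ * ‖u.snd.snd‖ := by positivity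
  nlinarith

lemma norm_le_cut3 (u : Cut3) : ‖u.snd.fst‖ ≤ ‖u‖ ∧ ‖u.snd.snd‖ ≤ ‖u‖ := by
  have h1 : ‖u‖ ^ 2 = ‖u.fst‖ ^ 2 + ‖u.snd‖ ^ 2 := WithLp.prod_norm_sq_eq_of_L2 u
  have h2 : ‖u.snd‖ ^ 2 = ‖u.snd.fst‖ ^ 2 + ‖u.snd.snd‖ ^ 2 := WithLp.prod_norm_sq_eq_of_L2 u.snd
  constructor <;> refine (pow_le_pow_iff_left₀ (norm_nonneg _) (norm_nonneg _) two_ne_zero).1 ?_ <;>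
    nlinarith [sq_nonneg ‖u.fst‖, sq_nonneg ‖u.snd.fst‖, sq_nonneg ‖u.snd.snd‖]

variable {p₀ : T3} {c : ℝ}

/-- The trial vector $(0,f,-RBf)$ solves the last row exactly; the second row is the Schur
complement of $f$ and the first is $\int v_0f$, both small. -/
lemma QuadraticMin.mem_spectrum_of_Δ₁ (hq : P.QuadraticMin p₀ c) (hv : P.v2 = 0 ∨ P.v1 = 0)
    {z : ℝ} (hz : z < P.m) {p : T3} (hp : P.Δ₁ p z = 0) : (z : ℂ) ∈ spectrum ℂ P.H := by
  by_contra hns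
  obtain ⟨C, hC, hb⟩ := exists_norm_le_of_notMem_spectrum hns
  rw [Δ₁_eq_det] at hp
  -- This $\eta$ satisfies $2C\eta<1$, contradicting a resolvent bound $C$.
  obtain ⟨f, hf1, hf2, hf3⟩ := exists_approx_kernel hq hz hp P.v0 (η := 1 / (4 * C + 1))
    (by positivity)
  set h : L2Sym := -res hz (symTensor P.v1 f) with hh
  have hH22 : P.H22 h = P.mulW2 h := by
    rcases hv with hv | hv
    · exact H22_apply_of_v2_eq_zero hv h
    · have : h = 0 := by rw [hh, hv, symTensor_zero, map_zero, neg_zero]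
      rw [this, map_zero, map_zero]
  have hlow : symTensor P.v1 f + P.H22 h - (z : ℂ) • h = 0 := by
    have := mulW2_res_sub hz (symTensor P.v1 f)
    rw [hH22, hh, map_neg, smul_neg]
    nth_rw 1 [← this]
    abel
  set u : Cut3 := WithLp.toLp 2 (0, WithLp.toLp 2 (f, h)) with hu
  have hHu : P.H u - (z : ℂ) • u =
      WithLp.toLp 2 (intOp P.v0 f, WithLp.toLp 2 (schurL2 1 hz f, 0)) := by
    rw [H_apply, ← hlow]
    refine WithLp.ofLp_injective 2 (Prod.ext ?_ (WithLp.ofLp_injective 2 (Prod.ext ?_ ?_)))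
    · change (P.w0 : ℂ) * 0 + intOp P.v0 f - (z : ℂ) * 0 = _
      simp
    · change (0 : ℂ) • vec P.v0 + mulOp P.w1 f + P.H12 h - (z : ℂ) • f = schurL2 1 hz f
      rw [schurL2, hh, map_neg, one_mul, zero_smul]
      abel
    · rfl
  have h1 := hb u
  rw [hHu] at h1
  have h2 := norm_cut3_le
    (WithLp.toLp 2 (intOp P.v0 f, WithLp.toLp 2 (schurL2 1 hz f, 0)) : Cut3)
  simp only [WithLp.toLp_fst, WithLp.toLp_snd, norm_zero, add_zero] at h2
  have h3 : 1 ≤ ‖u‖ := hf1 ▸ (norm_le_cut3 u).1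
  have h4 := mul_le_mul_of_nonneg_left (h2.trans (add_le_add hf3 hf2)) hC
  have h5 : C * (1 / (4 * C + 1) + 1 / (4 * C + 1)) < 1 := by
    rw [← two_mul, mul_one_div, mul_div_assoc', div_lt_one (by positivity)]
    linarith
  linarith

lemma QuadraticMin.factor (hq : P.QuadraticMin p₀ c) : P.factor.QuadraticMin p₀ c := hq

/-- With $h=-RBf$ and $r=f+B^*h$ one finds $(H_{22}-z)h=-Br$. A resolvent bound would make $h$ as
small as $r$, and then $f=r-B^*h$ could not have norm 1. -/
lemma QuadraticMin.mem_spectrum_of_Δ₂ (hq : P.QuadraticMin p₀ c) (hv : P.v1 = 0)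
    {z : ℝ} (hz : z < P.m) {p : T3} (hp : P.Δ₂ p z = 0) : (z : ℂ) ∈ spectrum ℂ P.H := by
  by_contra hns
  obtain ⟨C, hC, hb⟩ := exists_norm_le_of_notMem_spectrum hns
  rw [← det_factor] at hp
  set B := symTensor P.factor.v1 with hB
  set Bs := P.factor.H12 with hBs
  have hz' : z < P.factor.m := hz
  set L := ‖Bs‖ * (C * ‖B‖) with hL
  have hL0 : 0 ≤ L := by positivity
  -- Chosen so that $(L+1)\|r\|\le\frac12$, whereas $1=\|f\|\le(1+L)\|r\|$.
  obtain ⟨f, hf1, hf2, -⟩ := exists_approx_kernel hq.factor hz' hp 0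
    (η := 1 / (2 * (L + 1))) (by positivity)
  set r := schurL2 (P := P.factor) 0 hz' f with hr
  set h : L2Sym := -res hz' (B f) with hh
  have hrf : r = f + Bs h := by
    rw [hr, schurL2, hh, map_neg]
    change mulOp 1 f - _ - _ = _
    rw [mulOp_one, zero_mul, Complex.ofReal_zero, zero_smul, sub_zero, sub_eq_add_neg]
  have hlow : P.H22 h - (z : ℂ) • h = -B r := by
    have h1 : P.mulW2 h - (z : ℂ) • h = -B f := by
      have h2 : P.mulW2 (res hz' (B f)) - (z : ℂ) • res hz' (B f) = B f :=
        mulW2_res_sub hz' (B f)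
      calc P.mulW2 h - (z : ℂ) • h
          = -(P.mulW2 (res hz' (B f)) - (z : ℂ) • res hz' (B f)) := by
            rw [hh, map_neg, smul_neg]
            abel
        _ = -B f := by rw [h2]
    rw [H22_apply, hrf, map_add, sub_right_comm, h1]
    abel
  set u : Cut3 := WithLp.toLp 2 (0, WithLp.toLp 2 (0, h)) with hu
  have hHu : P.H u - (z : ℂ) • u = WithLp.toLp 2 (0, WithLp.toLp 2 (0, -B r)) := by
    rw [H_apply, ← hlow]
    refine WithLp.ofLp_injective 2 (Prod.ext ?_ (WithLp.ofLp_injective 2 (Prod.ext ?_ ?_)))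
    · change (P.w0 : ℂ) * 0 + intOp P.v0 0 - (z : ℂ) * 0 = 0
      simp
    · change (0 : ℂ) • vec P.v0 + mulOp P.w1 0 + P.H12 h - (z : ℂ) • (0 : L2 T3) = 0
      rw [H12_apply_of_v1_eq_zero hv]
      simp
    · change symTensor P.v1 0 + P.H22 h - (z : ℂ) • h = P.H22 h - (z : ℂ) • h
      rw [map_zero, zero_add]
  have h1 := hb u
  rw [hHu] at h1
  have h2 := norm_cut3_le (WithLp.toLp 2 (0, WithLp.toLp 2 (0, -B r)) : Cut3)
  simp only [WithLp.toLp_fst, WithLp.toLp_snd, norm_zero, zero_add, norm_neg] at h2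
  have h3 : ‖h‖ ≤ ‖u‖ := (norm_le_cut3 u).2
  have h4 : ‖h‖ ≤ C * (‖B‖ * ‖r‖) :=
    h3.trans (h1.trans (mul_le_mul_of_nonneg_left (h2.trans (B.le_opNorm r)) hC))
  have h5 : 1 ≤ ‖r‖ + ‖Bs‖ * ‖h‖ := by
    rw [← hf1, eq_sub_of_add_eq hrf.symm]
    exact (norm_sub_le _ _).trans (add_le_add_right (Bs.le_opNorm h) _)
  have h6 : ‖Bs‖ * ‖h‖ ≤ L * ‖r‖ := by
    calc _ ≤ ‖Bs‖ * (C * (‖B‖ * ‖r‖)) := by gcongr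
      _ = _ := by rw [hL]; ring
  have h7 : (L + 1) * ‖r‖ ≤ 1 / 2 := by
    calc _ ≤ (L + 1) * (1 / (2 * (L + 1))) := by gcongr
      _ = 1 / 2 := by field_simp
  linarith

/-! ### From discrete eigenvalues of $H$ to generalized eigenvalues, and the conclusion. -/

lemma isEigen_of_v2_eq_zero (hv : P.v2 = 0) {z : ℝ}
    (hz : End.HasEigenvalue (P.H : Cut3 →ₗ[ℂ] Cut3) (z : ℂ)) : P.IsEigen 1 z := by
  obtain ⟨u, hu, hu0⟩ := hz.exists_hasEigenvector
  have he : P.H u = (z : ℂ) • u := End.mem_eigenspace_iff.1 hu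
  rw [H_apply] at he
  have e1 := congrArg WithLp.fst he
  have e2 := congrArg (fun x => x.snd.fst) he
  have e3 := congrArg (fun x => x.snd.snd) he
  refine ⟨WithLp.toLp 2 (u.fst, u.snd.fst), u.snd.snd, ?_, ?_, ?_⟩
  · rw [one_mul]
    refine WithLp.ofLp_injective 2 (Prod.ext ?_ e2)
    change (P.w0 : ℂ) * u.fst + intOp P.v0 u.snd.fst + 0 = _
    rw [add_zero]
    exact e1
  · change symTensor P.v1 u.snd.fst + P.mulW2 u.snd.snd = _
    rw [← H22_apply_of_v2_eq_zero hv]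
    exact e3
  · have h1 : ‖u‖ ^ 2 = ‖u.fst‖ ^ 2 + ‖u.snd‖ ^ 2 := WithLp.prod_norm_sq_eq_of_L2 u
    have h2 : ‖u.snd‖ ^ 2 = ‖u.snd.fst‖ ^ 2 + ‖u.snd.snd‖ ^ 2 :=
      WithLp.prod_norm_sq_eq_of_L2 u.snd
    have h3 := WithLp.prod_norm_sq_eq_of_L2 (WithLp.toLp 2 (u.fst, u.snd.fst) : Cut2)
    simp only [WithLp.toLp_fst, WithLp.toLp_snd] at h3
    have h4 : 0 < ‖u‖ ^ 2 := pow_pos (norm_pos_iff.2 hu0) 2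
    rw [one_mul, h3]
    linarith

/-- The last component decouples. If it vanishes, the rest is an eigenvector of the upper block;
otherwise it is an eigenvector $h$ of $H_{22}$, and $(0,-B^*h,h)$ solves the factorized system. -/
lemma isEigen_of_v1_eq_zero (hv : P.v1 = 0) {z : ℝ}
    (hz : End.HasEigenvalue (P.H : Cut3 →ₗ[ℂ] Cut3) (z : ℂ)) :
    P.IsEigen 1 z ∨ P.factor.IsEigen 0 z := by
  obtain ⟨u, hu, hu0⟩ := hz.exists_hasEigenvector
  have he : P.H u = (z : ℂ) • u := End.mem_eigenspace_iff.1 hu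
  rw [H_apply, hv, symTensor_zero, H12_apply_of_v1_eq_zero hv, zero_add, add_zero] at he
  have e1 := congrArg WithLp.fst he
  have e2 := congrArg (fun x => x.snd.fst) he
  have e3 : P.H22 u.snd.snd = (z : ℂ) • u.snd.snd := congrArg (fun x => x.snd.snd) he
  by_cases hh : u.snd.snd = 0
  · refine Or.inl ⟨WithLp.toLp 2 (u.fst, u.snd.fst), 0, ?_, ?_, ?_⟩
    · rw [one_mul, map_zero, add_zero]
      exact WithLp.ofLp_injective 2 (Prod.ext e1 e2)
    · rw [coupling_apply, hv, symTensor_zero, map_zero, smul_zero, add_zero]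
    · have hne : (WithLp.toLp 2 (u.fst, u.snd.fst) : Cut2) ≠ 0 := by
        intro h0
        apply hu0
        exact WithLp.ofLp_injective 2 (Prod.ext (congrArg (fun x : Cut2 => x.fst) h0)
          (WithLp.ofLp_injective 2 (Prod.ext (congrArg (fun x : Cut2 => x.snd) h0) hh)))
      have := norm_pos_iff.2 hne
      positivity
  · refine Or.inr ⟨WithLp.toLp 2 (0, -P.factor.H12 u.snd.snd), u.snd.snd, ?_, ?_, ?_⟩
    · rw [zero_mul, Complex.ofReal_zero, zero_smul]
      refine WithLp.ofLp_injective 2 (Prod.ext ?_ ?_)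
      · change ((1 : ℝ) : ℂ) * 0 + intOp P.factor.v0 (-P.factor.H12 u.snd.snd) + 0 = 0
        have : intOp P.factor.v0 (-P.factor.H12 u.snd.snd) = 0 := by
          change ∫ s, ((0 : ℝ) : ℂ) * _ = 0
          simp
        rw [this]
        simp
      · change (0 : ℂ) • vec P.factor.v0 + mulOp 1 (-P.factor.H12 u.snd.snd) +
          P.factor.H12 u.snd.snd = 0
        rw [zero_smul, mulOp_one]
        abel
    · rw [← e3, H22_apply, coupling_apply, WithLp.toLp_snd, map_neg]
      change -_ + P.mulW2 u.snd.snd = _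
      abel
    · rw [zero_mul, zero_add]
      exact pow_pos (norm_pos_iff.2 hh) 2

lemma exists_notMem_spectrum {E : Type} [NormedAddCommGroup E] [InnerProductSpace ℂ E]
    {T : E →L[ℂ] E} {z : ℝ} (h : z ∈ discSpec T) {b : ℝ} (hb : z < b) :
    ∃ y, z < y ∧ y < b ∧ (y : ℂ) ∉ spectrum ℂ T := by
  obtain ⟨-, -, δ, hδ, hsep⟩ := h
  obtain ⟨y, hy1, hy2⟩ := exists_between (lt_min hb (lt_add_of_pos_right z hδ))
  refine ⟨y, hy1, hy2.trans_le (min_le_left _ _), fun hy => ?_⟩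
  have h1 := hsep y hy (by exact_mod_cast hy1.ne')
  rw [← Complex.ofReal_sub, Complex.norm_real, Real.norm_of_nonneg (by linarith)] at h1
  have := hy2.trans_le (min_le_right _ _)
  linarith

lemma QuadraticMin.finite_discSpec₁ (hq : P.QuadraticMin p₀ c) (hv : P.v2 = 0 ∨ P.v1 = 0)
    (h : Regime P.Δ₁ P.σ₁ P.m) : {z | z ∈ discSpec P.H ∧ z < P.m ∧ P.IsEigen 1 z}.Finite := by
  rw [Δ₁_eq_det] at h
  refine hq.finite_eigen zero_le_one (hq.strictAntiOn_det (Or.inl one_pos))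
    (QuadraticMin.exists_det_pos (Or.inl one_pos)) ?_ ?_ h (fun z hz => ⟨hz.2.2, hz.2.1⟩)
    fun z hz a b haz hzb => ?_
  · intro z hz hzm
    obtain ⟨p, hp⟩ := Set.mem_iUnion.1 hz
    exact ⟨p, Δ₁_eq_det P ▸ hq.det_eq_zero_of_mem_discSpec_h1 hzm hp⟩
  · intro z hz p hp
    exact Set.mem_iUnion.2 ⟨p, hq.mem_discSpec_h1 hz (by rw [Δ₁_eq_det]; exact hp)⟩
  -- Just above a discrete eigenvalue lie points outside the spectrum; at such a point the
  -- determinant cannot vanish for any $p$.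
  · obtain ⟨y, hy1, hy2, hy⟩ := exists_notMem_spectrum hz.1 (lt_min hzb hz.2.1)
    refine ⟨y, haz.trans hy1, hy2.trans_le (min_le_left _ _), fun p hp => hy ?_⟩
    exact hq.mem_spectrum_of_Δ₁ hv (hy2.trans_le (min_le_right _ _))
      (p := p) (by rw [Δ₁_eq_det]; exact hp)

/-- The weight is $\varepsilon=0$ here, so $v_2\ne0$ is what makes $\Delta_2$ strictly decreasing in
$z$. -/
lemma QuadraticMin.finite_discSpec₂ (hq : P.QuadraticMin p₀ c) (hv : P.v1 = 0) (hv2 : P.v2 ≠ 0)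
    (h : Regime P.Δ₂ P.σ₂ P.m) :
    {z | z ∈ discSpec P.H ∧ z < P.m ∧ P.factor.IsEigen 0 z}.Finite := by
  have hv1 : P.factor.v1 ≠ 0 := smul_ne_zero (by positivity) hv2
  have hanti := hq.factor.strictAntiOn_det (ε := 0) (Or.inr ⟨rfl, hv1⟩)
  have hpos := QuadraticMin.exists_det_pos (P := P.factor) (ε := 0)
    (Or.inr ⟨rfl, fun p => by change (0 : ℝ) < 1; norm_num⟩)
  rw [← det_factor] at h
  refine hq.factor.finite_eigen le_rfl hanti hpos ?_ ?_ h (fun z hz => ⟨hz.2.2, hz.2.1⟩)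
    fun z hz a b haz hzb => ?_
  · intro z hz hzm
    obtain ⟨p, hp⟩ := Set.mem_iUnion.1 hz
    exact ⟨p, det_factor P ▸ hq.det_eq_zero_of_mem_discSpec_h2 hzm hp⟩
  · intro z hz p hp
    refine Set.mem_iUnion.2 ⟨p, mem_discSpec_h2 hz ?_ (by rw [← det_factor]; exact hp)⟩
    rw [← det_factor]
    exact (hanti p).injOn
  · obtain ⟨y, hy1, hy2, hy⟩ := exists_notMem_spectrum hz.1 (lt_min hzb hz.2.1)
    refine ⟨y, haz.trans hy1, hy2.trans_le (min_le_left _ _), fun p hp => hy ?_⟩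
    exact hq.mem_spectrum_of_Δ₂ hv (hy2.trans_le (min_le_right _ _))
      (p := p) (by rw [← det_factor]; exact hp)

end Model
end ThreeParticle

theorem theorem4 (P : ThreeParticle.Model)
    (hA1 : ThreeParticle.PeriodicAndOrthogonal P.v1 P.v2 ∨
      ThreeParticle.PeriodicAndOrthogonal P.v2 P.v1)
    (hA2i : P.W2Periodic) (hA2ii : P.MinimumAndSmoothness)
    (h1 : ThreeParticle.Regime P.Δ₁ P.σ₁ P.m) (h2 : ThreeParticle.Regime P.Δ₂ P.σ₂ P.m) :
    {z : ℝ | z ∈ ThreeParticle.discSpec P.H ∧ z < P.m}.Finite := by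
  obtain ⟨p₀, c, hq⟩ := hA2ii.exists_quadraticMin
  have hv : P.v2 = 0 ∨ P.v1 = 0 := hA1.imp (fun h => h.eq_zero) fun h => h.eq_zero
  have hfin := hq.finite_discSpec₁ hv h1
  by_cases hv2 : P.v2 = 0
  · exact hfin.subset fun z hz => ⟨hz.1, hz.2, ThreeParticle.Model.isEigen_of_v2_eq_zero hv2 hz.1.1⟩
  · have hv1 := hv.resolve_left hv2
    refine (hfin.union (hq.finite_discSpec₂ hv1 hv2 h2)).subset fun z hz => ?_
    exact (ThreeParticle.Model.isEigen_of_v1_eq_zero hv1 hz.1.1).imp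
      (fun h => ⟨hz.1, hz.2, h⟩) fun h => ⟨hz.1, hz.2, h⟩
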